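/- Let $(A,Q)$ be a finite quadratic module: $A$ is a finite abelian group and $Q:A\to\mathbb{Q}/\mathbb{Z}$ a quadratic form whose bilinear form $\langle x,y\rangle=Q(x+y)-Q(x)-Q(y)$ is nondegenerate. Write $\mathbf{e}(x)=e^{2\pi i x}$, $q=\mathbf{e}(\tau)$, $\zeta=\mathbf{e}(z)$, and let $\mathrm{sig}(A,Q)\in\mathbb{Z}/8\mathbb{Z}$ be the signature, determined by $\sum_{\gamma\in A}\mathbf{e}(Q(\gamma))=\sqrt{|A|}\,\mathbf{e}(\mathrm{sig}(A,Q)/8)$. Let $\mathfrak{e}_\gamma$, $\gamma\in A$, be the canonical basis of $\mathbb{C}[A]$ and let $\rho^*$ be the dual Weil representation of $\mathrm{Mp}_2(\mathbb{Z})$ on $\mathbb{C}[A]$, i.e. the representation with $$\rho^*\big(\begin{psmallmatrix}0&-1\\1&0\end{psmallmatrix},\sqrt{\tau}\big)\mathfrak{e}_\gamma=\frac{\mathbf{e}(\mathrm{sig}(A,Q)/8)}{\sqrt{|A|}}\sum_{\delta\in A}\mathbf{e}(\langle\gamma,\delta\rangle)\mathfrak{e}_\delta,\qquad \rho^*\big(\begin{psmallmatrix}1&1\\0&1\end{psmallmatrix},1\big)\mathfrak{e}_\gamma=\mathbf{e}(-Q(\gamma))\mathfrak{e}_\gamma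 .$$ All square roots and powers below are principal. For coprime integers $c,d$ let $M=\begin{psmallmatrix}a&b\\c&d\end{psmallmatrix}\in SL_2(\mathbb{Z})$ be any matrix with bottom row $(c,d)$, and write $\rho^*(M)$ for $\rho^*(M,\sqrt{c\tau+d})$. Let $k\in\frac12\mathbb{Z}$, $k\ge 4$, be an antisymmetric weight, i.e. $k+\mathrm{sig}(A,Q)/2$ is an odd integer; let $\beta\in A$ and let $m\in\mathbb{Z}-Q(\beta)$ be a rational number with $m>0$. For $\gamma \in A$ and $n\in\mathbb{Z}-Q(\gamma)$ put $\phi_{n,\gamma}(\tau)=q^n\,\frac{\mathfrak{e}_\gamma+(-1)^{k+\mathrm{sig}(A,Q)/2}\mathfrak{e}_{-\gamma}}{2}$ and $$P_{k,n,\gamma}(\tau)=\frac12\sum_{\gcd(c,d)=1}(c\tau+d)^{-k}\rho^*(M)^{-1}\phi_{n,\gamma}(M\tau),\qquad R_{k,m,\beta}(\tau)=\sum_{\lambda\in\mathbb{Z}}\lambda\,P_{k,\lambda^2m,\lambda\beta}(\tau),$$ where the series over $\lambda\in\mathbb{Z}$ is the limit of the sums over $|\lambda|\le N$; and for $\tau\in\mathbb{H}$,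 $z\in\mathbb{C}$ let $$E_{k-1,m,\beta}(\tau,z)=\frac12\sum_{\gcd(c,d)=1}(c\tau+d)^{1-k}\sum_{\lambda\in\mathbb{Z}}\mathbf{e}\Big(\frac{m\lambda^2(a\tau+b)+2m\lambda z-cmz^2}{c\tau+d}\Big)\rho^*(M)^{-1}\mathfrak{e}_{\lambda\beta}$$ be the Jacobi Eisenstein series of weight $k-1$ and index $(m,\beta)$. Then all these series converge for all $\tau\in\mathbb{H}$ and $z\in\mathbb{C}$, $E_{k-1,m,\beta}(\tau,\cdot)$ is differentiable at $0$, and $$R_{k,m,\beta}(\tau)=\frac{1}{4\pi i m}\,\frac{\partial}{\partial z}\Big|_{z=0}E_{k-1,m,\beta}(\tau,z).$$ Moreover, $E_{k-1,m,\beta}$ has an absolutely convergent Fourier expansion $$E_{k-1,m,\beta}(\tau,z)=\sum_{\gamma\in A}\ \sum_{n\in\mathbb{Z}-Q(\gamma)}\ \sum_{r\in\mathbb{Z}-\langle\gamma,\beta\rangle}c(n,r,\gamma)\,q^n\zeta^r\,\mathfrak{e}_\gamma ,$$ its coefficients satisfy $c(n,r,\gamma)=0$ whenever $r^2>4mn$,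 and $$R_{k,m,\beta}(\tau)=\frac1{2m}\sum_{\gamma\in A}\ \sum_{n\in\mathbb{Z}-Q(\gamma)}\ \sum_{r\in\mathbb{Z}-\langle\gamma,\beta\rangle}c(n,r,\gamma)\,q^n\,\mathfrak{e}_\gamma\,\frac1{2\pi i}\frac{\partial}{\partial z}\Big|_{z=0}\zeta^r=\sum_{\gamma\in A}\ \sum_{n\in\mathbb{Z}-Q(\gamma)}\Big(\frac1{2m}\sum_{\substack{r\in\mathbb{Z}-\langle\gamma,\beta\rangle\\ r^2\le 4mn}}r\,c(n,r,\gamma)\Big)q^n\,\mathfrak{e}_\gamma .$$ -/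

import Mathlib

open scoped UpperHalfPlane MatrixGroups

noncomputable section

namespace JacobiEis

/-! ### The exponential `𝐞(x) = exp(2πix)` -/

/-- `𝐞(z) = exp(2πiz)` for complex `z`. -/
def ee (z : ℂ) : ℂ := Complex.exp (2 * Real.pi * Complex.I * z)

theorem ee_periodic : Function.Periodic (fun x : ℚ => ee (x : ℂ)) 1 := by
  intro x
  have h : 2 * (Real.pi : ℂ) * Complex.I * ((x + 1 : ℚ) : ℂ)
      = 2 * Real.pi * Complex.I * (x : ℂ) + 2 * Real.pi * Complex.I := by
    push_cast
    ring
  simp only [ee]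
  rw [h, Complex.exp_add, Complex.exp_two_pi_mul_I, mul_one]

/-- `𝐞(x) = exp(2πix)` for `x ∈ ℚ/ℤ`. -/
def eqz (x : AddCircle (1 : ℚ)) : ℂ := ee_periodic.lift x

/-! ### The metaplectic group `Mp₂(ℤ)` -/

/-- The automorphy factor `cτ + d`. -/
def autFactor (g : SL(2, ℤ)) (τ : ℍ) : ℂ := (g 1 0 : ℂ) * (τ : ℂ) + (g 1 1 : ℂ)

theorem autFactor_eq_denom (g : SL(2, ℤ)) (τ : ℍ) :
    autFactor g τ = UpperHalfPlane.denom (g : GL (Fin 2) ℝ) τ := by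
  simp [autFactor, UpperHalfPlane.denom]

theorem autFactor_ne_zero (g : SL(2, ℤ)) (τ : ℍ) : autFactor g τ ≠ 0 := by
  rw [autFactor_eq_denom]
  exact UpperHalfPlane.denom_ne_zero _ τ

theorem autFactor_mul (g h : SL(2, ℤ)) (τ : ℍ) :
    autFactor (g * h) τ = autFactor g (h • τ) * autFactor h τ := by
  rw [autFactor_eq_denom, autFactor_eq_denom, autFactor_eq_denom, map_mul, map_mul,
    UpperHalfPlane.denom_cocycle _ _ τ.im_ne_zero, ModularGroup.sl_moeb,
    UpperHalfPlane.coe_smul_of_det_pos (by simp)]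

theorem autFactor_one (τ : ℍ) : autFactor 1 τ = 1 := by
  simp [autFactor]

/-- An element of `Mp₂(ℤ)`: a pair `(M, φ)` of a matrix `M ∈ SL₂(ℤ)` with bottom row `(c, d)` and
a continuous (equivalently, holomorphic) function `φ` on `ℍ` such that `φ(τ)² = cτ + d`. -/
@[ext]
structure Mp2Z where
  mat : SL(2, ℤ)
  root : ℍ → ℂ
  continuous_root : Continuous root
  root_sq : ∀ τ, root τ ^ 2 = autFactor mat τ

namespace Mp2Z

theorem root_ne_zero (x : Mp2Z) (τ : ℍ) : x.root τ ≠ 0 := by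
  intro h
  have h2 := x.root_sq τ
  rw [h] at h2
  exact autFactor_ne_zero x.mat τ (by rw [← h2]; norm_num)

theorem continuous_smul_SL (g : SL(2, ℤ)) : Continuous fun τ : ℍ => g • τ :=
  continuous_const_smul (g : GL (Fin 2) ℝ)

instance : Mul Mp2Z where
  mul x y :=
    { mat := x.mat * y.mat
      root := fun τ => x.root (y.mat • τ) * y.root τ
      continuous_root :=
        (x.continuous_root.comp (continuous_smul_SL y.mat)).mul y.continuous_root
      root_sq := fun τ => by
        rw [mul_pow, x.root_sq, y.root_sq, autFactor_mul] }

instance : One Mp2Z where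
  one :=
    { mat := 1
      root := fun _ => 1
      continuous_root := continuous_const
      root_sq := fun τ => by rw [autFactor_one, one_pow] }

instance : Inv Mp2Z where
  inv x :=
    { mat := x.mat⁻¹
      root := fun τ => (x.root (x.mat⁻¹ • τ))⁻¹
      continuous_root :=
        (x.continuous_root.comp (continuous_smul_SL x.mat⁻¹)).inv₀ fun τ => x.root_ne_zero _
      root_sq := fun τ => by
        rw [inv_pow, x.root_sq]
        have h := autFactor_mul x.mat x.mat⁻¹ τ
        rw [mul_inv_cancel, autFactor_one] at h
        exact inv_eq_of_mul_eq_one_right h.symm }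

theorem mul_mat (x y : Mp2Z) : (x * y).mat = x.mat * y.mat := rfl

theorem mul_root (x y : Mp2Z) (τ : ℍ) :
    (x * y).root τ = x.root (y.mat • τ) * y.root τ := rfl

theorem one_mat : (1 : Mp2Z).mat = 1 := rfl

theorem one_root (τ : ℍ) : (1 : Mp2Z).root τ = 1 := rfl

theorem inv_mat (x : Mp2Z) : (x⁻¹).mat = x.mat⁻¹ := rfl

theorem inv_root (x : Mp2Z) (τ : ℍ) : (x⁻¹).root τ = (x.root (x.mat⁻¹ • τ))⁻¹ := rfl

/-- The group law `(M, φ)(N, ψ) = (MN, τ ↦ φ(Nτ)ψ(τ))`. -/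
instance : Group Mp2Z where
  mul_assoc x y z := by
    refine Mp2Z.ext (mul_assoc _ _ _) (funext fun τ => ?_)
    simp only [mul_root, mul_mat, mul_smul, mul_assoc]
  one_mul x := by
    refine Mp2Z.ext (one_mul _) (funext fun τ => ?_)
    simp only [mul_root, one_root, one_mul]
  mul_one x := by
    refine Mp2Z.ext (mul_one _) (funext fun τ => ?_)
    simp only [mul_root, one_root, one_mat, one_smul, mul_one]
  inv_mul_cancel x := by
    refine Mp2Z.ext (inv_mul_cancel _) (funext fun τ => ?_)
    simp only [mul_root, one_root, inv_root, inv_smul_smul]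
    exact inv_mul_cancel₀ (x.root_ne_zero τ)

theorem continuous_principalRoot (g : SL(2, ℤ)) :
    Continuous fun τ : ℍ => autFactor g τ ^ (1 / 2 : ℂ) := by
  have hc : Continuous fun τ : ℍ => autFactor g τ := by
    unfold autFactor
    exact (continuous_const.mul UpperHalfPlane.continuous_coe).add continuous_const
  by_cases h : g 1 0 = 0
  · have hconst : (fun τ : ℍ => autFactor g τ ^ (1 / 2 : ℂ))
        = fun _ => (g 1 1 : ℂ) ^ (1 / 2 : ℂ) := by
      funext τ
      simp [autFactor, h]
    rw [hconst]
    exact continuous_const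
  · refine hc.cpow continuous_const fun τ => Or.inr ?_
    have him : (autFactor g τ).im = (g 1 0 : ℝ) * τ.im := by
      simp [autFactor]
    rw [him]
    exact mul_ne_zero (by exact_mod_cast h) τ.im_ne_zero

/-- The lift `(M, √(cτ + d))` of `M ∈ SL₂(ℤ)`, with the principal branch of the square root. -/
def lift (g : SL(2, ℤ)) : Mp2Z where
  mat := g
  root := fun τ => autFactor g τ ^ (1 / 2 : ℂ)
  continuous_root := continuous_principalRoot g
  root_sq := fun τ => by
    rw [← Complex.cpow_nat_mul]
    norm_num

end Mp2Z

/-- Every coprime pair `(c, d)` is the bottom row of a matrix in `SL₂(ℤ)`. -/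
theorem exists_bottomRow (p : {p : ℤ × ℤ // IsCoprime p.1 p.2}) :
    ∃ g : SL(2, ℤ), g 1 0 = p.1.1 ∧ g 1 1 = p.1.2 := by
  obtain ⟨g, -, hg⟩ :=
    ModularGroup.bottom_row_surj (R := ℤ) (a := ![p.1.1, p.1.2]) (by simpa using p.2)
  exact ⟨g, by simpa using congrFun hg 0, by simpa using congrFun hg 1⟩

/-- A matrix in `SL₂(ℤ)` with bottom row `(c, d)`. -/
def rowRep (p : {p : ℤ × ℤ // IsCoprime p.1 p.2}) : SL(2, ℤ) := (exists_bottomRow p).choose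

/-! ### Finite quadratic modules and the dual Weil representation -/

section FiniteQuadraticModule

variable {A : Type*} [AddCommGroup A]

/-- The bilinear form `⟨x, y⟩ = Q(x + y) - Q(x) - Q(y)`. -/
def bil (Q : QuadraticMap ℤ A (AddCircle (1 : ℚ))) (x y : A) : AddCircle (1 : ℚ) :=
  QuadraticMap.polar Q x y

/-- `Q` is nondegenerate, that is, its bilinear form has trivial radical. -/
def IsNondegenerate (Q : QuadraticMap ℤ A (AddCircle (1 : ℚ))) : Prop :=
  ∀ x, (∀ y, bil Q x y = 0) → x = 0

/-- The canonical basis vector `𝔢_γ` of `ℂ[A]`; the group ring is written as `A → ℂ`. -/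
def basisVec (γ : A) : A → ℂ :=
  open Classical in Pi.single γ 1

variable [Fintype A]

/-- The signature of `(A, Q)`. It is the element of `ℤ/8` determined by Milgram's formula
`∑_γ 𝐞(Q(γ)) = √|A| 𝐞(sig/8)`, and we use its representative in `(-4, 4]`. -/
def sig (Q : QuadraticMap ℤ A (AddCircle (1 : ℚ))) : ℝ :=
  4 / Real.pi * Complex.arg (∑ γ, eqz (Q γ))

/-- `ρ` acts on the generators `S = ((0, -1; 1, 0), √τ)` and `T = ((1, 1; 0, 1), 1)` of `Mp₂(ℤ)`
by the formulas of the dual Weil representation attached to `(A, Q)`. -/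
def IsDualWeil (Q : QuadraticMap ℤ A (AddCircle (1 : ℚ)))
    (ρ : Mp2Z →* Module.End ℂ (A → ℂ)) : Prop :=
  (∀ γ, ρ (Mp2Z.lift ModularGroup.S) (basisVec γ) =
    ((Real.sqrt (Fintype.card A) : ℂ)⁻¹ * ee (sig Q / 8)) •
      ∑ β, eqz (bil Q γ β) • basisVec β) ∧
  (∀ γ, ρ (Mp2Z.lift ModularGroup.T) (basisVec γ) = eqz (-Q γ) • basisVec γ)

/-- The dual Weil representation `ρ*` of `Mp₂(ℤ)` on `ℂ[A]`: for nondegenerate `Q` there is exactly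
one representation with the prescribed action of the generators `S` and `T`. -/
def dualWeil (Q : QuadraticMap ℤ A (AddCircle (1 : ℚ))) : Mp2Z →* Module.End ℂ (A → ℂ) :=
  Classical.epsilon (IsDualWeil Q)

/-- `k` is an antisymmetric weight: `k ∈ ½ℤ` and `k + sig(A, Q)/2` is an odd integer. -/
def IsAntisymmetricWeight (Q : QuadraticMap ℤ A (AddCircle (1 : ℚ))) (k : ℝ) : Prop :=
  (∃ w : ℤ, 2 * k = w) ∧ ∃ j : ℤ, Odd j ∧ k + sig Q / 2 = j

/-! ### Poincaré series and the forms `R_{k,m,β}` -/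

/-- The summand `(cτ + d)^{-k} ρ*(M)^{-1} φ(Mτ)` of a Poincaré series, `M = (·, ·; c, d)` with the
root `√(cτ + d)`. -/
def poincareTerm (Q : QuadraticMap ℤ A (AddCircle (1 : ℚ))) (k : ℝ) (φ : ℍ → A → ℂ) (τ : ℍ)
    (p : {p : ℤ × ℤ // IsCoprime p.1 p.2}) : A → ℂ :=
  (autFactor (rowRep p) τ ^ (-k : ℂ)) •
    dualWeil Q ((Mp2Z.lift (rowRep p))⁻¹) (φ (rowRep p • τ))

/-- The Poincaré series `ℙ_k(φ)`. -/
def poincareSeries (Q : QuadraticMap ℤ A (AddCircle (1 : ℚ))) (k : ℝ) (φ : ℍ → A → ℂ)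
    (τ : ℍ) : A → ℂ :=
  (1 / 2 : ℂ) • ∑' p, poincareTerm Q k φ τ p

/-- The seed function `q^n (𝔢_γ + (-1)^{k + sig/2} 𝔢_{-γ})/2`. -/
def expSeed (Q : QuadraticMap ℤ A (AddCircle (1 : ℚ))) (k : ℝ) (n : ℚ) (γ : A) (τ : ℍ) : A → ℂ :=
  (ee (n * τ) / 2) •
    (basisVec γ + ((-1 : ℂ) ^ ((k + sig Q / 2 : ℝ) : ℂ)) • basisVec (-γ))

/-- The Poincaré series of exponential type `P_{k,n,γ}`. -/
def expPoincare (Q : QuadraticMap ℤ A (AddCircle (1 : ℚ))) (k : ℝ) (n : ℚ) (γ : A) (τ : ℍ) :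
    A → ℂ :=
  poincareSeries Q k (expSeed Q k n γ) τ

/-- The form `R_{k,m,β} = ∑_{λ ∈ ℤ} λ P_{k,λ²m,λβ}`, the limit of the sums over `|λ| ≤ N`. -/
def formR (Q : QuadraticMap ℤ A (AddCircle (1 : ℚ))) (k : ℝ) (m : ℚ) (β : A) (τ : ℍ) : A → ℂ :=
  ∑'[SummationFilter.symmetricIcc ℤ] l : ℤ, (l : ℂ) • expPoincare Q k (l ^ 2 * m) (l • β) τ

/-! ### The Jacobi Eisenstein series -/

/-- The term `𝐞((mλ²(aτ + b) + 2mλz - cmz²)/(cτ + d)) ρ*(M)^{-1} 𝔢_{λβ}`. -/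
def jacobiThetaTerm (Q : QuadraticMap ℤ A (AddCircle (1 : ℚ))) (m : ℚ) (β : A) (τ : ℍ) (z : ℂ)
    (g : SL(2, ℤ)) (l : ℤ) : A → ℂ :=
  ee ((m * l ^ 2 * ((g 0 0 : ℂ) * (τ : ℂ) + (g 0 1 : ℂ)) + 2 * m * l * z
      - (g 1 0 : ℂ) * m * z ^ 2) / autFactor g τ) •
    dualWeil Q ((Mp2Z.lift g)⁻¹) (basisVec (l • β))

/-- The summand of the Jacobi Eisenstein series that belongs to the coprime pair `(c, d)`. -/
def jacobiEisensteinTerm (Q : QuadraticMap ℤ A (AddCircle (1 : ℚ))) (k : ℝ) (m : ℚ) (β : A)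
    (τ : ℍ) (z : ℂ) (p : {p : ℤ × ℤ // IsCoprime p.1 p.2}) : A → ℂ :=
  (autFactor (rowRep p) τ ^ (-k : ℂ)) • ∑' l : ℤ, jacobiThetaTerm Q m β τ z (rowRep p) l

/-- The Jacobi Eisenstein series `E_{k,m,β}(τ, z)` of weight `k` and index `(m, β)`. -/
def jacobiEisenstein (Q : QuadraticMap ℤ A (AddCircle (1 : ℚ))) (k : ℝ) (m : ℚ) (β : A)
    (τ : ℍ) (z : ℂ) : A → ℂ :=
  (1 / 2 : ℂ) • ∑' p, jacobiEisensteinTerm Q k m β τ z p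

/-! ### Fourier expansions -/

/-- The coset `-x` of `ℤ` in `ℚ`, for `x ∈ ℚ/ℤ`; for instance `negCoset (Q γ) = ℤ - Q(γ)`. -/
abbrev negCoset (x : AddCircle (1 : ℚ)) : Type :=
  {n : ℚ // (n : AddCircle (1 : ℚ)) = -x}

/-- `Φ(τ, z) = ∑_γ ∑_{n ∈ ℤ - Q(γ)} ∑_{r ∈ ℤ - ⟨γ, β⟩} c(n, r, γ) q^n ζ^r 𝔢_γ` on `ℍ × ℂ`, with
absolute convergence. -/
def HasJacobiExpansion (Q : QuadraticMap ℤ A (AddCircle (1 : ℚ))) (β : A) (Φ : ℍ → ℂ → A → ℂ)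
    (c : ℚ → ℚ → A → ℂ) : Prop :=
  ∀ (τ : ℍ) (z : ℂ) (γ : A),
    HasSum (fun x : negCoset (Q γ) × negCoset (bil Q γ β) =>
      c x.1 x.2 γ * ee ((x.1 : ℚ) * τ) * ee ((x.2 : ℚ) * z)) (Φ τ z γ)

/-- `f(τ) = ∑_γ ∑_{n ∈ ℤ - Q(γ)} b(n, γ) q^n 𝔢_γ` on `ℍ`, with absolute convergence. -/
def HasFourierExpansion (Q : QuadraticMap ℤ A (AddCircle (1 : ℚ))) (f : ℍ → A → ℂ)
    (b : ℚ → A → ℂ) : Prop :=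
  ∀ (τ : ℍ) (γ : A),
    HasSum (fun n : negCoset (Q γ) => b n γ * ee ((n : ℚ) * τ)) (f τ γ)

end FiniteQuadraticModule

end JacobiEis

end

open scoped UpperHalfPlane MatrixGroups

noncomputable section

namespace JacobiEis

/-! Write j = cτ+d. The (c,d)-summand of E is j^{1-k} ρ*(M)^{-1} applied to 𝐞(-cmz²/j) Σ_λ 𝐞(mλ²Mτ +
2mλz/j) 𝔢_{λβ}. At z = 0 the quadratic prefactor has derivative zero, so differentiation brings down
4πimλ/j: the weight rises from k-1 to k, and the sum over λ becomes the moment Σ λ 𝐞(mλ²Mτ) 𝔢_{λβ}.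
In an antisymmetric weight λ and -λ contribute equally to Σ λφ, so the partial sums of R are the
Poincaré series of the truncated moments. The identity is therefore an interchange of the limit N →
∞ with the sum over (c,d).

The interchange is dominated convergence, and termwise estimates are too weak: Σ|λ|exp(-2πmλ²y/|j|²)
has size |j|², which fails at k = 4, and the theta series itself would be O(|j|), which fails for E
in weight 3. Cancellation is needed. Because ρ* is unitary, it suffices to bound Σ_γ|θ_γ|². Sorting
pairs (λ,λ') by p = λ-λ' and applying Poisson summation in λ turns this into a Gaussian sum over a
lattice, dominated by the SL₂(ℤ)-invariant `latticeSum`; the outcome is θ = O(|j|^{1/2})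
(`exists_norm_thetaVec_le`). Cauchy's estimate on a circle of radius 1/|j| gives moments
O(|j|^{3/2}), uniformly under twists by 𝐞(λu) (`exists_norm_moment_le`). The Dirichlet kernel passes
to partial sums at the cost of N^{1/8}; only λ up to |j|² matter, so truncated moments are
O(|j|^{7/4}) (`exists_norm_partialMoment_le`), and k - 7/4 > 2.

For the Fourier expansion, E is holomorphic in each variable, quasi-periodic under τ+1 and z+1, and
O((1+y)exp(2πmv²/y)) for v = Im z. Its coefficients are torus integrals independent of the heights
(y,v). Moving the heights gives exponential decay in n and r, hence absolute convergence; taking v =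
-ry/(2m) and y → ∞ kills the coefficient when r² > 4mn. Termwise differentiation at z = 0 then gives
the expansion of R.

All this uses that `dualWeil`, chosen by `Classical.epsilon`, really is a representation with the
given generators. That existence comes from the presentation of Mp₂(ℤ) by (ST)³ = S² and S⁸ = 1
(`Mp2Z.exists_hom`), proved by a positivity argument on words. -/

theorem ee_add (x y : ℂ) : ee (x + y) = ee x * ee y := by
  simp only [ee, mul_add, Complex.exp_add]

theorem ee_zero : ee 0 = 1 := by simp [ee]

theorem ee_neg (x : ℂ) : ee (-x) = (ee x)⁻¹ := by
  simp only [ee, mul_neg, Complex.exp_neg]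

theorem ee_ne_zero (x : ℂ) : ee x ≠ 0 := Complex.exp_ne_zero _

theorem norm_ee (x : ℂ) : ‖ee x‖ = Real.exp (-2 * Real.pi * x.im) := by
  rw [ee, Complex.norm_exp]
  congr 1
  simp

theorem ee_int_mul (n : ℤ) (x : ℂ) : ee (n * x) = ee x ^ n := by
  rw [ee, ee, ← Complex.exp_int_mul]
  congr 1
  ring

theorem ee_one : ee 1 = 1 := by simp [ee]

theorem ee_int (n : ℤ) : ee n = 1 := by
  have := ee_int_mul n 1
  rwa [mul_one, ee_one, one_zpow] at this

theorem conj_ee (x : ℂ) : (starRingEnd ℂ) (ee x) = ee (-(starRingEnd ℂ) x) := by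
  simp only [ee, ← Complex.exp_conj, map_mul, Complex.conj_ofReal, Complex.conj_I, map_ofNat]
  congr 1
  ring

theorem eqz_coe (x : ℚ) : eqz (x : AddCircle (1 : ℚ)) = ee x := rfl

theorem eqz_add (x y : AddCircle (1 : ℚ)) : eqz (x + y) = eqz x * eqz y := by
  induction x using QuotientAddGroup.induction_on with | H x =>
  induction y using QuotientAddGroup.induction_on with | H y =>
  rw [← AddCircle.coe_add, eqz_coe, eqz_coe, eqz_coe, ← ee_add, Rat.cast_add]

theorem eqz_zero : eqz 0 = 1 := by
  rw [← AddCircle.coe_zero, eqz_coe, Rat.cast_zero, ee_zero]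

theorem norm_eqz (x : AddCircle (1 : ℚ)) : ‖eqz x‖ = 1 := by
  induction x using QuotientAddGroup.induction_on with | H x =>
  rw [eqz_coe, norm_ee, Complex.ratCast_im, mul_zero, Real.exp_zero]

theorem eqz_neg (x : AddCircle (1 : ℚ)) : eqz (-x) = (eqz x)⁻¹ := by
  apply eq_inv_of_mul_eq_one_left
  rw [← eqz_add, neg_add_cancel, eqz_zero]

theorem conj_eqz (x : AddCircle (1 : ℚ)) : (starRingEnd ℂ) (eqz x) = eqz (-x) := by
  rw [eqz_neg, Complex.inv_def, Complex.normSq_eq_norm_sq, norm_eqz]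
  simp

theorem eqz_zsmul (n : ℤ) (x : AddCircle (1 : ℚ)) : eqz (n • x) = eqz x ^ n := by
  induction x using QuotientAddGroup.induction_on with | H x =>
  rw [← QuotientAddGroup.mk_zsmul]
  change ee ((n • x : ℚ) : ℂ) = ee x ^ n
  rw [← ee_int_mul]
  simp

theorem eqz_eq_one_iff (x : AddCircle (1 : ℚ)) : eqz x = 1 ↔ x = 0 := by
  refine ⟨fun h => ?_, fun h => h ▸ eqz_zero⟩
  induction x using QuotientAddGroup.induction_on with | H x =>
  change ee x = 1 at h
  obtain ⟨n, hn⟩ := Complex.exp_eq_one_iff.1 h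
  have h2 : (x : ℂ) = n := by
    have : (2 * Real.pi * Complex.I : ℂ) ≠ 0 := Complex.two_pi_I_ne_zero
    apply mul_left_cancel₀ this
    rw [hn]; ring
  have h3 : x = n := by exact_mod_cast h2
  exact (AddCircle.coe_eq_zero_iff (1 : ℚ)).2 ⟨n, by simp [h3]⟩

/-! ### Gauss sums and the operators of S and T on ℂ[A] -/

section FiniteQuadraticModule

set_option linter.unusedSectionVars false

variable {A : Type*} [AddCommGroup A] (Q : QuadraticMap ℤ A (AddCircle (1 : ℚ)))

theorem bil_add_left (x y z : A) : bil Q (x + y) z = bil Q x z + bil Q y z :=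
  QuadraticMap.polar_add_left Q x y z

theorem bil_add_right (x y z : A) : bil Q x (y + z) = bil Q x y + bil Q x z :=
  QuadraticMap.polar_add_right Q x y z

theorem bil_comm (x y : A) : bil Q x y = bil Q y x := QuadraticMap.polar_comm Q x y

theorem bil_sub_left (x y z : A) : bil Q (x - y) z = bil Q x z - bil Q y z :=
  QuadraticMap.polar_sub_left Q x y z

theorem bil_sub_right (x y z : A) : bil Q x (y - z) = bil Q x y - bil Q x z :=
  QuadraticMap.polar_sub_right Q x y z

theorem bil_zsmul_left (n : ℤ) (x y : A) : bil Q (n • x) y = n • bil Q x y :=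
  QuadraticMap.polar_smul_left Q n x y

theorem bil_zsmul_right (n : ℤ) (x y : A) : bil Q x (n • y) = n • bil Q x y :=
  QuadraticMap.polar_smul_right Q n x y

theorem bil_self (x : A) : bil Q x x = 2 • Q x := QuadraticMap.polar_self Q x

theorem Q_add (x y : A) : Q (x + y) = Q x + Q y + bil Q x y := by
  simp [bil, QuadraticMap.polar]

theorem Q_zsmul (n : ℤ) (x : A) : Q (n • x) = (n * n) • Q x := QuadraticMap.map_smul Q n x

variable [Fintype A] {Q}

theorem sum_eqz_bil (hQ : IsNondegenerate Q) [DecidableEq A] (x : A) :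
    ∑ y, eqz (bil Q x y) = if x = 0 then (Fintype.card A : ℂ) else 0 := by
  split_ifs with h
  · have : ∀ y, bil Q x y = 0 := fun y => by simp [h, bil, QuadraticMap.polar_zero_left]
    simp [this, eqz_zero]
  · have : ∃ y, bil Q x y ≠ 0 := by
      by_contra! h'
      exact h (hQ x h')
    obtain ⟨y₀, hy₀⟩ := this
    have h1 : eqz (bil Q x y₀) * ∑ y, eqz (bil Q x y) = ∑ y, eqz (bil Q x y) := by
      rw [Finset.mul_sum, ← Equiv.sum_comp (Equiv.addLeft y₀) fun y => eqz (bil Q x y)]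
      refine Finset.sum_congr rfl fun y _ => ?_
      rw [Equiv.coe_addLeft, bil_add_right, eqz_add]
    have h2 : (eqz (bil Q x y₀) - 1) * ∑ y, eqz (bil Q x y) = 0 := by
      rw [sub_mul, h1, one_mul, sub_self]
    refine (mul_eq_zero.1 h2).resolve_left fun h3 => hy₀ ?_
    rw [← eqz_eq_one_iff]
    exact sub_eq_zero.1 h3

theorem card_ne_zero' (A : Type*) [AddCommGroup A] [Fintype A] : (Fintype.card A : ℂ) ≠ 0 := by
  exact_mod_cast Fintype.card_ne_zero

/-- Expanding the squared modulus and substituting γ ↦ δ+γ leaves 𝐞(Q(γ)) times a character sum in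
δ, which vanishes unless γ = 0. -/
theorem norm_gaussSum (hQ : IsNondegenerate Q) :
    ‖∑ γ, eqz (Q γ)‖ = Real.sqrt (Fintype.card A) := by
  classical
  have h : (starRingEnd ℂ) (∑ γ, eqz (Q γ)) * ∑ γ, eqz (Q γ) = Fintype.card A := by
    calc (starRingEnd ℂ) (∑ γ, eqz (Q γ)) * ∑ γ, eqz (Q γ)
        = ∑ δ, ∑ γ, eqz (-Q δ) * eqz (Q (δ + γ)) := by
          rw [map_sum, Finset.sum_mul]
          refine Finset.sum_congr rfl fun δ _ => ?_
          rw [Finset.mul_sum, ← Equiv.sum_comp (Equiv.addLeft δ), conj_eqz]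
          rfl
      _ = ∑ γ, eqz (Q γ) * ∑ δ, eqz (bil Q γ δ) := by
          rw [Finset.sum_comm]
          refine Finset.sum_congr rfl fun γ _ => ?_
          rw [Finset.mul_sum]
          refine Finset.sum_congr rfl fun δ _ => ?_
          rw [← eqz_add, ← eqz_add, Q_add, bil_comm]
          congr 1
          abel
      _ = Fintype.card A := by
          simp [sum_eqz_bil hQ, eqz_zero]
  rw [Complex.conj_mul'] at h
  have h2 : ‖∑ γ, eqz (Q γ)‖ ^ 2 = Fintype.card A := by exact_mod_cast h
  rw [← h2, Real.sqrt_sq (norm_nonneg _)]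

/-- Since `sig` is read off from the argument of the Gauss sum, only the modulus has to be supplied.
-/
theorem ee_sig (Q : QuadraticMap ℤ A (AddCircle (1 : ℚ))) (hQ : IsNondegenerate Q) :
    (Real.sqrt (Fintype.card A) : ℂ) * ee (sig Q / 8) = ∑ γ, eqz (Q γ) := by
  conv_rhs => rw [← Complex.norm_mul_exp_arg_mul_I (∑ γ, eqz (Q γ))]
  rw [norm_gaussSum hQ, ee, sig]
  congr 2
  have : (Real.pi : ℂ) ≠ 0 := by exact_mod_cast Real.pi_ne_zero
  push_cast
  field_simp
  ring

theorem norm_ee_real (x : ℝ) : ‖ee x‖ = 1 := by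
  rw [norm_ee, Complex.ofReal_im, mul_zero, Real.exp_zero]

/-- The action of `S` under the dual Weil representation. -/
def weilS (Q : QuadraticMap ℤ A (AddCircle (1 : ℚ))) : Module.End ℂ (A → ℂ) where
  toFun v δ := ((Real.sqrt (Fintype.card A) : ℂ)⁻¹ * ee (sig Q / 8)) *
    ∑ γ, eqz (bil Q γ δ) * v γ
  map_add' v w := by
    ext δ
    simp only [Pi.add_apply, mul_add, Finset.sum_add_distrib]
  map_smul' a v := by
    ext δ
    simp only [Pi.smul_apply, smul_eq_mul, RingHom.id_apply, Finset.mul_sum]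
    refine Finset.sum_congr rfl fun γ _ => ?_
    ring

/-- Multiplication by a function as an endomorphism of `ℂ[A]`. -/
def diagEnd (f : A → ℂ) : Module.End ℂ (A → ℂ) where
  toFun v δ := f δ * v δ
  map_add' v w := by ext δ; simp [mul_add]
  map_smul' a v := by ext δ; simp [mul_left_comm]

theorem sqrt_card_sq (A : Type*) [Fintype A] :
    (Real.sqrt (Fintype.card A) : ℂ) * (Real.sqrt (Fintype.card A) : ℂ) = Fintype.card A := by
  rw [← Complex.ofReal_mul, Real.mul_self_sqrt (by positivity)]
  simp

theorem sqrt_card_ne_zero (A : Type*) [AddCommGroup A] [Fintype A] :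
    (Real.sqrt (Fintype.card A) : ℂ) ≠ 0 := by
  intro h
  have := sqrt_card_sq A
  rw [h, zero_mul] at this
  exact card_ne_zero' A this.symm

/-- Fourier inversion on A: both transforms use the same sign in the character, which produces the
reflection δ ↦ -δ. -/
theorem weilS_sq (hQ : IsNondegenerate Q) (v : A → ℂ) (δ : A) :
    weilS Q (weilS Q v) δ = ee (sig Q / 4) * v (-δ) := by
  classical
  have hc : (ee (sig Q / 8)) * ee (sig Q / 8) = ee (sig Q / 4) := by
    rw [← ee_add]; congr 1; ring
  have key : ∑ γ, eqz (bil Q γ δ) * ∑ ε, eqz (bil Q ε γ) * v ε = Fintype.card A * v (-δ) := by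
    simp only [Finset.mul_sum]
    rw [Finset.sum_comm]
    have : ∀ ε, ∑ γ, eqz (bil Q γ δ) * (eqz (bil Q ε γ) * v ε)
        = (if ε + δ = 0 then (Fintype.card A : ℂ) else 0) * v ε := by
      intro ε
      rw [← sum_eqz_bil hQ, Finset.sum_mul]
      refine Finset.sum_congr rfl fun γ _ => ?_
      rw [← mul_assoc, ← eqz_add, bil_add_left, bil_comm Q γ δ, add_comm]
    simp only [this, add_eq_zero_iff_eq_neg]
    simp
  have hs := sqrt_card_sq A
  have hs0 := sqrt_card_ne_zero A
  simp only [weilS, LinearMap.coe_mk, AddHom.coe_mk]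
  simp only [mul_left_comm _ (_ * _), ← Finset.mul_sum]
  rw [key, ← hc, ← hs]
  field_simp

/-- This is STS = T⁻¹ST⁻¹. Completing the square in the inner sum leaves a conjugate Gauss sum, and
the normalization of S by 𝐞(sig/8)/√|A| is exactly what cancels it. -/
theorem weilS_diag_weilS (hQ : IsNondegenerate Q) :
    weilS Q * diagEnd (fun γ => eqz (-Q γ)) * weilS Q
      = diagEnd (fun γ => eqz (Q γ)) * weilS Q * diagEnd (fun γ => eqz (Q γ)) := by
  ext1 v
  funext δ
  have hs0 := sqrt_card_ne_zero A
  have hgs : ∀ x, ∑ γ, eqz (bil Q γ x - Q γ)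
      = eqz (Q x) * ((Real.sqrt (Fintype.card A) : ℂ) * (ee (sig Q / 8))⁻¹) := by
    intro x
    have h1 : (Real.sqrt (Fintype.card A) : ℂ) * (ee (sig Q / 8))⁻¹ = ∑ γ, eqz (-Q γ) := by
      have := congrArg (starRingEnd ℂ) (ee_sig Q hQ)
      rw [map_mul, Complex.conj_ofReal, map_sum] at this
      simp only [conj_eqz] at this
      rw [← this, conj_ee, ← ee_neg]
      simp [map_ofNat]
    -- The shift γ ↦ γ+x turns ⟨γ,x⟩ - Q(γ) into Q(x) - Q(γ).
    rw [h1, Finset.mul_sum, ← Equiv.sum_comp (Equiv.addRight x)]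
    refine Finset.sum_congr rfl fun γ _ => ?_
    rw [← eqz_add, Equiv.coe_addRight, Q_add, bil_add_left, bil_self]
    congr 1
    rw [two_nsmul]
    abel
  simp only [Module.End.mul_apply, weilS, diagEnd, LinearMap.coe_mk, AddHom.coe_mk]
  set κ : ℂ := (Real.sqrt (Fintype.card A) : ℂ)⁻¹ * ee (sig Q / 8) with hκ
  have key : ∑ γ, eqz (bil Q γ δ) * (eqz (-Q γ) * (κ * ∑ ε, eqz (bil Q ε γ) * v ε))
      = ∑ ε, eqz (Q δ) * (eqz (bil Q ε δ) * (eqz (Q ε) * v ε)) := by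
    simp only [Finset.mul_sum]
    rw [Finset.sum_comm]
    refine Finset.sum_congr rfl fun ε _ => ?_
    have : ∑ γ, eqz (bil Q γ δ) * (eqz (-Q γ) * (κ * (eqz (bil Q ε γ) * v ε)))
        = κ * v ε * ∑ γ, eqz (bil Q γ (ε + δ) - Q γ) := by
      rw [Finset.mul_sum]
      refine Finset.sum_congr rfl fun γ _ => ?_
      rw [sub_eq_add_neg, eqz_add, bil_add_right, eqz_add, bil_comm Q ε γ]
      ring
    rw [this, hgs, Q_add, eqz_add, eqz_add, hκ]
    have := ee_ne_zero (sig Q / 8)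
    field_simp
  rw [key, ← Finset.mul_sum]
  ring

theorem diagEnd_mul (f g : A → ℂ) : diagEnd f * diagEnd g = diagEnd (fun x => f x * g x) := by
  ext1 v
  funext δ
  simp [diagEnd, mul_assoc]

theorem diagEnd_one : diagEnd (fun _ : A => (1 : ℂ)) = 1 := by
  ext1 v
  funext δ
  simp [diagEnd]

/-- The action of `T` under the dual Weil representation, as a unit. -/
def weilTUnit (Q : QuadraticMap ℤ A (AddCircle (1 : ℚ))) : (Module.End ℂ (A → ℂ))ˣ where
  val := diagEnd (fun γ => eqz (-Q γ))
  inv := diagEnd (fun γ => eqz (Q γ))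
  val_inv := by
    rw [diagEnd_mul, ← diagEnd_one]
    congr 1; funext x
    rw [← eqz_add, neg_add_cancel, eqz_zero]
  inv_val := by
    rw [diagEnd_mul, ← diagEnd_one]
    congr 1; funext x
    rw [← eqz_add, add_neg_cancel, eqz_zero]

/-- S⁴ is the scalar 𝐞(sig/2), so S⁸ is 𝐞(sig). Integrality of `sig` is taken as a hypothesis; in
the application it follows from the antisymmetry of the weight instead of from Milgram's theorem. -/
theorem weilS_pow_eight (hQ : IsNondegenerate Q) (hsig : ∃ n : ℤ, sig Q = n) :
    weilS Q ^ 8 = 1 := by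
  have h4 : ∀ v, (weilS Q ^ 4) v = ee (sig Q / 2) • v := by
    intro v
    funext δ
    have : (weilS Q ^ 4) v = weilS Q (weilS Q (weilS Q (weilS Q v))) := rfl
    rw [this, weilS_sq hQ, weilS_sq hQ, neg_neg, ← mul_assoc, ← ee_add, Pi.smul_apply, smul_eq_mul]
    congr 2; ring
  ext1 v
  have : weilS Q ^ 8 = weilS Q ^ 4 * weilS Q ^ 4 := by rw [← pow_add]
  rw [this, Module.End.mul_apply, h4, h4, smul_smul, ← ee_add]
  obtain ⟨n, hn⟩ := hsig
  have : (sig Q / 2 + sig Q / 2 : ℂ) = n := by rw [hn]; push_cast; ring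
  rw [this, ee_int, one_smul]
  rfl

/-- The action of `S` under the dual Weil representation, as a unit. -/
def weilSUnit (hQ : IsNondegenerate Q) (hsig : ∃ n : ℤ, sig Q = n) :
    (Module.End ℂ (A → ℂ))ˣ :=
  Units.ofPowEqOne (weilS Q) 8 (weilS_pow_eight hQ hsig) (by norm_num)

theorem braid_imp_pow_three_eq {G : Type*} [Group G] {s t : G}
    (h : s * t * s = t⁻¹ * s * t⁻¹) : (s * t) ^ 3 = s ^ 2 := by
  calc (s * t) ^ 3 = s * t * (s * t * s) * t := by simp only [pow_succ, pow_zero, one_mul, mul_assoc]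
    _ = s ^ 2 := by
      rw [h, sq]
      simp only [mul_assoc, inv_mul_cancel, mul_one, mul_inv_cancel_left]

theorem weilSUnit_relation (hQ : IsNondegenerate Q) (hsig : ∃ n : ℤ, sig Q = n) :
    (weilSUnit hQ hsig * weilTUnit Q) ^ 3 = weilSUnit hQ hsig ^ 2 := by
  set s := weilSUnit hQ hsig
  set t := weilTUnit Q
  have h : s * t * s = t⁻¹ * s * t⁻¹ := by
    apply Units.ext
    exact weilS_diag_weilS hQ
  exact braid_imp_pow_three_eq h

theorem weilS_basisVec (γ : A) : weilS Q (basisVec γ)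
    = ((Real.sqrt (Fintype.card A) : ℂ)⁻¹ * ee (sig Q / 8)) •
      ∑ β, eqz (bil Q γ β) • basisVec β := by
  classical
  funext δ
  simp [weilS, basisVec, Finset.sum_apply, Pi.single_apply]

theorem diagEnd_basisVec (f : A → ℂ) (γ : A) :
    diagEnd f (basisVec γ) = f γ • basisVec γ := by
  classical
  funext δ
  by_cases h : δ = γ
  · subst h; simp [diagEnd, basisVec]
  · simp [diagEnd, basisVec, h]

end FiniteQuadraticModule

/-! ### Generators and relations of Mp₂(ℤ) -/

namespace Mp2Z

theorem lift_mat (g : SL(2, ℤ)) : (lift g).mat = g := rfl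

theorem lift_root (g : SL(2, ℤ)) (τ : ℍ) : (lift g).root τ = autFactor g τ ^ (1 / 2 : ℂ) := rfl

theorem lift_T_root (τ : ℍ) : (lift ModularGroup.T).root τ = 1 := by
  rw [lift_root, autFactor, ModularGroup.coe_T]
  simp

theorem lift_S_root (τ : ℍ) : (lift ModularGroup.S).root τ = (τ : ℂ) ^ (1 / 2 : ℂ) := by
  rw [lift_root, autFactor, ModularGroup.coe_S]
  simp

/-- Principal roots of points of ℍ have argument in (0, π/2). This decides every sign ambiguity in
the relations below, without evaluating a root. -/
theorem cpow_half_quadrant {z : ℂ} (hz : 0 < z.im) :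
    0 < (z ^ (1 / 2 : ℂ)).re ∧ 0 < (z ^ (1 / 2 : ℂ)).im := by
  have hz0 : z ≠ 0 := by rintro rfl; simp at hz
  have hsq : (z ^ (1 / 2 : ℂ)) ^ 2 = z := by
    rw [← Complex.cpow_nat_mul]; norm_num
  have him : 2 * ((z ^ (1 / 2 : ℂ)).re * (z ^ (1 / 2 : ℂ)).im) = z.im := by
    conv_rhs => rw [← hsq, sq, Complex.mul_im]
    ring
  have hre : 0 ≤ (z ^ (1 / 2 : ℂ)).re := by
    rw [Complex.cpow_def_of_ne_zero hz0, Complex.exp_re]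
    refine mul_nonneg (Real.exp_pos _).le (Real.cos_nonneg_of_mem_Icc ?_)
    have h1 := Complex.neg_pi_lt_arg z
    have h2 := Complex.arg_le_pi z
    have : (Complex.log z * (1 / 2)).im = Complex.arg z / 2 := by
      rw [Complex.mul_im, Complex.log_im]
      norm_num
      ring
    rw [this]
    constructor <;> linarith
  have h3 : 0 < (z ^ (1 / 2 : ℂ)).re * (z ^ (1 / 2 : ℂ)).im := by linarith
  rcases hre.lt_or_eq with h | h
  · exact ⟨h, pos_of_mul_pos_right h3 h.le⟩
  · rw [← h] at h3; simp at h3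

/-- Two continuous square roots of the same nowhere vanishing function on the connected space ℍ
differ by one global sign. -/
theorem eq_or_root_eq_neg {x y : Mp2Z} (h : x.mat = y.mat) : x = y ∨ ∀ τ, x.root τ = -y.root τ := by
  have h1 : IsPreconnected (Set.univ : Set ℍ) := isPreconnected_univ
  rcases h1.eq_or_eq_neg_of_sq_eq x.continuous_root.continuousOn y.continuous_root.continuousOn
    (fun τ _ => by simp [x.root_sq, y.root_sq, h]) (fun {τ} _ => y.root_ne_zero τ) with h2 | h2
  · exact Or.inl (Mp2Z.ext h (funext fun τ => h2 (Set.mem_univ τ)))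
  · exact Or.inr fun τ => h2 (Set.mem_univ τ)

theorem lift_S_sq_mat : (lift ModularGroup.S ^ 2).mat = -1 := by
  apply Subtype.ext
  rw [sq, mul_mat, lift_mat, Matrix.SpecialLinearGroup.coe_mul, ModularGroup.coe_S]
  ext i j
  fin_cases i <;> fin_cases j <;> simp

theorem autFactor_neg_one (τ : ℍ) : autFactor (-1) τ = -1 := by
  simp [autFactor]

theorem root_eq_of_mat {x : Mp2Z} (h : x.mat = -1) (τ : ℍ) :
    x.root τ = Complex.I ∨ x.root τ = -Complex.I := by
  have h1 := x.root_sq τ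
  rw [h, autFactor_neg_one, ← Complex.I_sq] at h1
  exact sq_eq_sq_iff_eq_or_eq_neg.1 h1

theorem lift_S_sq_root (τ : ℍ) : (lift ModularGroup.S ^ 2).root τ = Complex.I := by
  refine (root_eq_of_mat lift_S_sq_mat τ).resolve_right fun h => ?_
  rw [sq, mul_root, lift_S_root, lift_S_root] at h
  obtain ⟨h1, h2⟩ := cpow_half_quadrant (ModularGroup.S • τ).im_pos
  obtain ⟨h3, h4⟩ := cpow_half_quadrant τ.im_pos
  have h5 := congrArg Complex.im h
  rw [Complex.mul_im] at h5
  simp only [Complex.neg_im, Complex.I_im, lift_mat] at h5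
  have := mul_pos h1 h4
  have := mul_pos h2 h3
  linarith

theorem lift_ST_mat : ((lift ModularGroup.S * lift ModularGroup.T).mat : Matrix (Fin 2) (Fin 2) ℤ)
    = !![0, -1; 1, 1] := by
  rw [mul_mat, lift_mat, lift_mat, Matrix.SpecialLinearGroup.coe_mul, ModularGroup.coe_S,
    ModularGroup.coe_T]
  ext i j
  fin_cases i <;> fin_cases j <;> simp

theorem lift_ST_cube_mat : ((lift ModularGroup.S * lift ModularGroup.T) ^ 3).mat = -1 := by
  apply Subtype.ext
  rw [pow_succ, sq, mul_mat, mul_mat, Matrix.SpecialLinearGroup.coe_mul,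
    Matrix.SpecialLinearGroup.coe_mul, lift_ST_mat]
  ext i j
  fin_cases i <;> fin_cases j <;> simp

/-- The matrices agree, so the roots agree up to sign. The left root is a product of three numbers
with arguments in (0, π/2), so its argument lies in (0, 3π/2) and it cannot be -i. -/
theorem lift_relation : (lift ModularGroup.S * lift ModularGroup.T) ^ 3 = lift ModularGroup.S ^ 2 := by
  refine (eq_or_root_eq_neg (lift_ST_cube_mat.trans lift_S_sq_mat.symm)).resolve_right fun h => ?_
  have h' := h UpperHalfPlane.I
  rw [lift_S_sq_root, pow_succ, sq, mul_root, mul_root, mul_root, mul_root, mul_root, lift_T_root,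
    lift_T_root, lift_T_root, mul_one, mul_one, mul_one, lift_S_root, lift_S_root, lift_S_root] at h'
  generalize (lift ModularGroup.T).mat • (lift ModularGroup.S * lift ModularGroup.T).mat •
    (lift ModularGroup.S * lift ModularGroup.T).mat • UpperHalfPlane.I = τ₁ at h'
  generalize (lift ModularGroup.T).mat •
    (lift ModularGroup.S * lift ModularGroup.T).mat • UpperHalfPlane.I = τ₂ at h'
  generalize (lift ModularGroup.T).mat • UpperHalfPlane.I = τ₃ at h'
  obtain ⟨h1, h2⟩ := cpow_half_quadrant τ₁.im_pos
  obtain ⟨h3, h4⟩ := cpow_half_quadrant τ₂.im_pos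
  obtain ⟨h5, h6⟩ := cpow_half_quadrant τ₃.im_pos
  set a := (τ₁ : ℂ) ^ (1 / 2 : ℂ)
  set b := (τ₂ : ℂ) ^ (1 / 2 : ℂ)
  set c := (τ₃ : ℂ) ^ (1 / 2 : ℂ)
  have e1 := congrArg Complex.re h'
  have e2 := congrArg Complex.im h'
  simp only [Complex.mul_re, Complex.mul_im, Complex.neg_re, Complex.neg_im, Complex.I_re,
    Complex.I_im] at e1 e2
  have p : 0 < a.re * b.im + a.im * b.re := by positivity
  -- With ab = X + ip and p > 0, a product abc = -i would give X·Re c = p·Im c and X·Im c + p·Re c =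
  -- -1; multiplying the latter by Re c yields p|c|² = -Re c, a sign contradiction.
  nlinarith [mul_pos p (mul_pos h5 h5), mul_pos p (mul_pos h6 h6)]

theorem lift_S_pow_four_mat : (lift ModularGroup.S ^ 4).mat = 1 := by
  rw [show 4 = 2 + 2 by rfl, pow_add, mul_mat, lift_S_sq_mat]
  simp

theorem lift_S_pow_four_root (τ : ℍ) : (lift ModularGroup.S ^ 4).root τ = -1 := by
  rw [show 4 = 2 + 2 by rfl, pow_add, mul_root, lift_S_sq_root, lift_S_sq_root, Complex.I_mul_I]

theorem lift_S_pow_eight : lift ModularGroup.S ^ 8 = 1 := by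
  rw [show 8 = 4 + 4 by rfl, pow_add]
  refine Mp2Z.ext ?_ (funext fun τ => ?_)
  · rw [mul_mat, lift_S_pow_four_mat, one_mat, one_mul]
  · rw [mul_root, lift_S_pow_four_root, lift_S_pow_four_root, one_root]; norm_num

/-- The projection `Mp₂(ℤ) → SL₂(ℤ)`. -/
def matHom : Mp2Z →* SL(2, ℤ) where
  toFun := mat
  map_one' := rfl
  map_mul' _ _ := rfl

/-- S and T generate SL₂(ℤ), and the nontrivial element of the kernel of Mp₂(ℤ) → SL₂(ℤ) is S⁴. -/
theorem closure_lift_S_T :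
    Subgroup.closure {lift ModularGroup.S, lift ModularGroup.T} = ⊤ := by
  set K := Subgroup.closure {lift ModularGroup.S, lift ModularGroup.T}
  have hS : lift ModularGroup.S ∈ K := Subgroup.subset_closure (by simp)
  have hmap : K.map matHom = ⊤ := by
    rw [MonoidHom.map_closure, Set.image_pair]
    exact SpecialLinearGroup.SL2Z_generators
  rw [eq_top_iff]
  intro x _
  obtain ⟨y, hy, hxy⟩ : matHom x ∈ K.map matHom := by rw [hmap]; trivial
  rcases eq_or_root_eq_neg (x := x) (y := y) hxy.symm with h | h
  · exact h ▸ hy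
  · have : x = lift ModularGroup.S ^ 4 * y := by
      refine Mp2Z.ext ?_ (funext fun τ => ?_)
      · rw [mul_mat, lift_S_pow_four_mat, one_mul]; exact hxy.symm
      · rw [mul_root, lift_S_pow_four_root, h, neg_one_mul]
    rw [this]
    exact K.mul_mem (K.pow_mem hS 4) hy

/-- Nonnegative integral `2 × 2` matrices with positive diagonal that are not diagonal. -/
def IsPositive (M : Matrix (Fin 2) (Fin 2) ℤ) : Prop :=
  0 ≤ M 0 1 ∧ 0 ≤ M 1 0 ∧ 1 ≤ M 0 0 ∧ 1 ≤ M 1 1 ∧ 1 ≤ M 0 1 + M 1 0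

section Presentation

variable {G : Type*} [Group G]

/-- The normal form of an amalgam of ⟨s⟩ and ⟨u⟩ over the central element z = s² = u³. The class of
such products is closed under left multiplication by s, u and powers of z, and inverses of
generators reduce to these because s⁻¹ = z⁻¹s and u⁻¹ = z⁻¹u². -/
theorem normalForm {s u z : G} (hs : s ^ 2 = z) (hu : u ^ 3 = z) {k : G}
    (hk : k ∈ Subgroup.closure {s, u}) :
    ∃ i : ℤ, ∃ e : G, (e = 1 ∨ e = u ∨ e = u⁻¹) ∧ ∃ p ∈ Submonoid.closure {s * u, s * u⁻¹},
      ∃ b : G, (b = 1 ∨ b = s) ∧ k = z ^ i * (e * (p * b)) := by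
  have hsz : ∀ i : ℤ, s * z ^ i = z ^ i * s := fun i => by
    have : Commute s z := hs ▸ (Commute.refl s).pow_right 2
    exact this.zpow_right i
  have huz : ∀ i : ℤ, u * z ^ i = z ^ i * u := fun i => by
    have : Commute u z := hu ▸ (Commute.refl u).pow_right 3
    exact this.zpow_right i
  have left_s : ∀ y, (∃ i : ℤ, ∃ e : G, (e = 1 ∨ e = u ∨ e = u⁻¹) ∧
      ∃ p ∈ Submonoid.closure {s * u, s * u⁻¹}, ∃ b : G, (b = 1 ∨ b = s) ∧
        y = z ^ i * (e * (p * b))) → ∃ i : ℤ, ∃ e : G, (e = 1 ∨ e = u ∨ e = u⁻¹) ∧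
      ∃ p ∈ Submonoid.closure {s * u, s * u⁻¹}, ∃ b : G, (b = 1 ∨ b = s) ∧
        s * y = z ^ i * (e * (p * b)) := by
    rintro y ⟨i, e, he, p, hp, b, hb, rfl⟩
    rcases he with rfl | he
    -- A leading s either meets the first letter s·u^{±1} of the positive word, where s² = z is
    -- extracted and u^{±1} becomes the new e, or the word is empty and it meets b.
    · have hdec : p = 1 ∨ ∃ x, (x = u ∨ x = u⁻¹) ∧
          ∃ p' ∈ Submonoid.closure {s * u, s * u⁻¹}, p = s * x * p' := by
        induction hp using Submonoid.closure_induction_left with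
        | one => exact Or.inl rfl
        | mul_left x hx y hy _ =>
          right
          rcases hx with rfl | rfl
          · exact ⟨u, Or.inl rfl, y, hy, rfl⟩
          · exact ⟨u⁻¹, Or.inr rfl, y, hy, rfl⟩
      rcases hdec with rfl | ⟨x, hx, p', hp', rfl⟩
      · rcases hb with rfl | rfl
        · exact ⟨i, 1, Or.inl rfl, 1, one_mem _, s, Or.inr rfl, by simp [hsz]⟩
        · refine ⟨i + 1, 1, Or.inl rfl, 1, one_mem _, 1, Or.inl rfl, ?_⟩
          rw [← mul_assoc, hsz, mul_assoc, one_mul, one_mul, ← sq, hs, zpow_add_one]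
          simp
      · refine ⟨i + 1, x, Or.inr hx, p', hp', b, hb, ?_⟩
        rw [← mul_assoc, hsz, zpow_add_one]
        nth_rw 3 [← hs]
        rw [sq]
        simp only [mul_assoc, one_mul]
    · refine ⟨i, 1, Or.inl rfl, s * e * p, Submonoid.mul_mem _ (Submonoid.subset_closure ?_) hp,
        b, hb, ?_⟩
      · rcases he with rfl | rfl <;> simp
      · rw [← mul_assoc, hsz]
        simp only [mul_assoc, one_mul]
  have left_u : ∀ y, (∃ i : ℤ, ∃ e : G, (e = 1 ∨ e = u ∨ e = u⁻¹) ∧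
      ∃ p ∈ Submonoid.closure {s * u, s * u⁻¹}, ∃ b : G, (b = 1 ∨ b = s) ∧
        y = z ^ i * (e * (p * b))) → ∃ i : ℤ, ∃ e : G, (e = 1 ∨ e = u ∨ e = u⁻¹) ∧
      ∃ p ∈ Submonoid.closure {s * u, s * u⁻¹}, ∃ b : G, (b = 1 ∨ b = s) ∧
        u * y = z ^ i * (e * (p * b)) := by
    rintro y ⟨i, e, he, p, hp, b, hb, rfl⟩
    rcases he with rfl | rfl | rfl
    · exact ⟨i, u, Or.inr (Or.inl rfl), p, hp, b, hb, by rw [← mul_assoc, huz, mul_assoc, one_mul]⟩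
    -- Here u·u = u³u⁻¹ = z·u⁻¹.
    · refine ⟨i + 1, e⁻¹, Or.inr (Or.inr rfl), p, hp, b, hb, ?_⟩
      rw [← mul_assoc, huz, zpow_add_one]
      nth_rw 3 [← hu]
      rw [pow_succ, sq]
      simp only [mul_assoc, mul_inv_cancel_left]
    · exact ⟨i, 1, Or.inl rfl, p, hp, b, hb, by
        rw [← mul_assoc, huz, mul_assoc, mul_inv_cancel_left, one_mul]⟩
  have left_z : ∀ (j : ℤ) (y), (∃ i : ℤ, ∃ e : G, (e = 1 ∨ e = u ∨ e = u⁻¹) ∧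
      ∃ p ∈ Submonoid.closure {s * u, s * u⁻¹}, ∃ b : G, (b = 1 ∨ b = s) ∧
        y = z ^ i * (e * (p * b))) → ∃ i : ℤ, ∃ e : G, (e = 1 ∨ e = u ∨ e = u⁻¹) ∧
      ∃ p ∈ Submonoid.closure {s * u, s * u⁻¹}, ∃ b : G, (b = 1 ∨ b = s) ∧
        z ^ j * y = z ^ i * (e * (p * b)) := by
    rintro j y ⟨i, e, he, p, hp, b, hb, rfl⟩
    exact ⟨j + i, e, he, p, hp, b, hb, by rw [zpow_add, mul_assoc]⟩
  induction hk using Subgroup.closure_induction_left with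
  | one => exact ⟨0, 1, Or.inl rfl, 1, one_mem _, 1, Or.inl rfl, by simp⟩
  | mul_left x hx y _ ih =>
    rcases hx with rfl | rfl
    · exact left_s y ih
    · exact left_u y ih
  | inv_mul_cancel x hx y _ ih =>
    rcases hx with rfl | rfl
    · have : x⁻¹ * y = z ^ (-1 : ℤ) * (x * y) := by rw [← hs]; group
      rw [this]
      exact left_z _ _ (left_s _ ih)
    · have : x⁻¹ * y = z ^ (-1 : ℤ) * (x * (x * y)) := by rw [← hu]; group
      rw [this]
      exact left_z _ _ (left_u _ (left_u _ ih))

end Presentation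

theorem lift_ST_inv_mat :
    (((lift ModularGroup.S * lift ModularGroup.T)⁻¹).mat : Matrix (Fin 2) (Fin 2) ℤ)
      = !![1, 1; -1, 0] := by
  rw [inv_mat, Matrix.SpecialLinearGroup.coe_inv, lift_ST_mat, Matrix.adjugate_fin_two]
  simp

theorem lift_S_coe_mat : ((lift ModularGroup.S).mat : Matrix (Fin 2) (Fin 2) ℤ)
    = !![0, -1; 1, 0] := ModularGroup.coe_S

/-- The letters su and su⁻¹ have matrices -(1 1; 0 1) and (1 0; 1 1). Up to sign they are
nonnegative unipotent matrices, so a nonempty word in them never returns to ±1. -/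
theorem isPositive_of_mem_closure {G : Type*} [Group G] (φ : G →* Mp2Z) {s u : G}
    (hs : φ s = lift ModularGroup.S) (hu : φ u = lift ModularGroup.S * lift ModularGroup.T)
    {p : G} (hp : p ∈ Submonoid.closure {s * u, s * u⁻¹}) :
    p = 1 ∨ IsPositive (φ p).mat ∨ IsPositive (-(φ p).mat.1) := by
  induction hp using Submonoid.closure_induction_left with
  | one => left; rfl
  | mul_left x hx y hy ih =>
    right
    replace ih : ((φ y).mat : Matrix (Fin 2) (Fin 2) ℤ) = 1 ∨ IsPositive (φ y).mat ∨
        IsPositive (-(φ y).mat.1) := ih.imp_left fun h => by rw [h, map_one]; rfl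
    rcases hx with rfl | rfl
    · rw [map_mul, mul_mat, Matrix.SpecialLinearGroup.coe_mul, map_mul, hs, hu]
      have : ((lift ModularGroup.S * (lift ModularGroup.S * lift ModularGroup.T)).mat :
          Matrix (Fin 2) (Fin 2) ℤ) = !![-1, -1; 0, -1] := by
        rw [mul_mat, Matrix.SpecialLinearGroup.coe_mul, lift_ST_mat, lift_S_coe_mat]
        ext i j
        fin_cases i <;> fin_cases j <;> simp
      rw [this]
      simp only [IsPositive, Matrix.mul_apply, Matrix.neg_apply, Fin.sum_univ_two] at ih ⊢
      simp only [Matrix.of_apply, Matrix.cons_val', Matrix.cons_val_zero, Matrix.cons_val_one,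
        Matrix.cons_val_fin_one] at ih ⊢
      rcases ih with ih | ih | ih
      · rw [ih]; simp
      · omega
      · omega
    · rw [map_mul, mul_mat, Matrix.SpecialLinearGroup.coe_mul, map_mul, map_inv, hs, hu]
      have : ((lift ModularGroup.S * (lift ModularGroup.S * lift ModularGroup.T)⁻¹).mat :
          Matrix (Fin 2) (Fin 2) ℤ) = !![1, 0; 1, 1] := by
        rw [mul_mat, Matrix.SpecialLinearGroup.coe_mul, lift_ST_inv_mat, lift_S_coe_mat]
        ext i j
        fin_cases i <;> fin_cases j <;> simp
      rw [this]
      simp only [IsPositive, Matrix.mul_apply, Matrix.neg_apply, Fin.sum_univ_two] at ih ⊢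
      simp only [Matrix.of_apply, Matrix.cons_val', Matrix.cons_val_zero, Matrix.cons_val_one,
        Matrix.cons_val_fin_one] at ih ⊢
      rcases ih with ih | ih | ih
      · rw [ih]; simp
      · omega
      · omega

theorem lift_S_sq_zpow_mat (i : ℤ) :
    (((lift ModularGroup.S ^ 2) ^ i).mat : Matrix (Fin 2) (Fin 2) ℤ) = 1 ∨
    (((lift ModularGroup.S ^ 2) ^ i).mat : Matrix (Fin 2) (Fin 2) ℤ) = -1 := by
  have h : ((lift ModularGroup.S ^ 2) ^ i).mat = (-1) ^ i := by
    change matHom _ = _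
    rw [map_zpow]
    exact congrArg (· ^ i) lift_S_sq_mat
  rw [h]
  rcases Int.even_or_odd i with hi | hi
  · left; rw [hi.neg_one_zpow]; rfl
  · right; rw [hi.neg_one_zpow]; simp

/-- A product in normal form that is trivial in `Mp₂(ℤ)` has trivial factors. -/
theorem normalForm_eq_one {i : ℤ} {e p b : Mp2Z}
    (he : e = 1 ∨ e = lift ModularGroup.S * lift ModularGroup.T ∨
      e = (lift ModularGroup.S * lift ModularGroup.T)⁻¹)
    (hp : (p.mat : Matrix (Fin 2) (Fin 2) ℤ) = 1 ∨ IsPositive p.mat ∨ IsPositive (-p.mat.1))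
    (hb : b = 1 ∨ b = lift ModularGroup.S)
    (h : (lift ModularGroup.S ^ 2) ^ i * (e * (p * b)) = 1) :
    e ≠ lift ModularGroup.S * lift ModularGroup.T ∧
      e ≠ (lift ModularGroup.S * lift ModularGroup.T)⁻¹ ∧ b ≠ lift ModularGroup.S ∧
      ¬ IsPositive p.mat ∧ ¬ IsPositive (-p.mat.1) := by
  have h1 : (((lift ModularGroup.S ^ 2) ^ i).mat : Matrix (Fin 2) (Fin 2) ℤ) *
      (e.mat.1 * (p.mat.1 * b.mat.1)) = 1 := by
    have := congrArg (fun x : Mp2Z => (x.mat : Matrix (Fin 2) (Fin 2) ℤ)) h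
    simpa only [mul_mat, Matrix.SpecialLinearGroup.coe_mul] using! this
  have h2 : e.mat.1 * (p.mat.1 * b.mat.1) = 1 ∨ e.mat.1 * (p.mat.1 * b.mat.1) = -1 := by
    rcases lift_S_sq_zpow_mat i with h3 | h3 <;> rw [h3] at h1
    · left; rwa [one_mul] at h1
    · right; rw [← h1]; simp
  have one' : (((1 : Mp2Z).mat : Matrix (Fin 2) (Fin 2) ℤ)) = !![1, 0; 0, 1] := by
    rw [one_mat]; simp [Matrix.one_fin_two]
  -- If e·M·b = ±1, then M = ±e⁻¹b⁻¹ for one of six pairs (e,b). Comparing entries, only e = b = 1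
  -- is compatible with M being 1 or positive up to sign, and then M is ±1, hence not positive.
  have hcontra : ∀ e' b' : Matrix (Fin 2) (Fin 2) ℤ,
      e' = e.mat.1 → b' = b.mat.1 →
      (e' = !![1, 0; 0, 1] ∨ e' = !![0, -1; 1, 1] ∨ e' = !![1, 1; -1, 0]) →
      (b' = !![1, 0; 0, 1] ∨ b' = !![0, -1; 1, 0]) →
      (e' = !![1, 0; 0, 1] ∧ b' = !![1, 0; 0, 1] ∧ ¬ IsPositive p.mat ∧ ¬ IsPositive (-p.mat.1)) := by
    intro e' b' he' hb' hee hbb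
    rw [← he', ← hb'] at h2
    have hp' := hp
    generalize p.mat.1 = M at h2 hp hp' ⊢
    have entries : ∀ N : Matrix (Fin 2) (Fin 2) ℤ, (N = 1 → N 0 0 = 1 ∧ N 0 1 = 0 ∧ N 1 0 = 0 ∧
        N 1 1 = 1) ∧ (N = -1 → N 0 0 = -1 ∧ N 0 1 = 0 ∧ N 1 0 = 0 ∧ N 1 1 = -1) := by
      intro N
      constructor <;> rintro rfl <;> simp
    have h3 := h2.imp (entries _).1 (entries _).2
    have h4 := hp.imp_left (entries _).1
    simp only [Matrix.mul_apply, Fin.sum_univ_two] at h3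
    simp only [IsPositive, Matrix.neg_apply] at h4 ⊢
    rcases hee with rfl | rfl | rfl <;> rcases hbb with rfl | rfl <;>
      simp only [Matrix.of_apply, Matrix.cons_val', Matrix.cons_val_zero, Matrix.cons_val_one,
        Matrix.cons_val_fin_one] at h3
    · refine ⟨rfl, rfl, ?_, ?_⟩ <;> omega
    all_goals exfalso; omega
  have hS1 : (lift ModularGroup.S).mat.1 ≠ !![1, 0; 0, 1] := by
    rw [lift_S_coe_mat]; intro h; simpa using congrFun (congrFun h 0) 0
  have hU1 : (lift ModularGroup.S * lift ModularGroup.T).mat.1 ≠ !![1, 0; 0, 1] := by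
    rw [lift_ST_mat]; intro h; simpa using congrFun (congrFun h 0) 0
  have hV1 : ((lift ModularGroup.S * lift ModularGroup.T)⁻¹).mat.1 ≠ !![1, 0; 0, 1] := by
    rw [lift_ST_inv_mat]; intro h; simpa using congrFun (congrFun h 0) 1
  obtain ⟨k1, k2, k3, k4⟩ := hcontra _ _ rfl rfl (by
    rcases he with rfl | rfl | rfl
    · exact Or.inl one'
    · exact Or.inr (Or.inl lift_ST_mat)
    · exact Or.inr (Or.inr lift_ST_inv_mat)) (by
    rcases hb with rfl | rfl
    · exact Or.inl one'
    · exact Or.inr lift_S_coe_mat)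
  refine ⟨?_, ?_, ?_, k3, k4⟩
  · rintro rfl; exact hU1 k1
  · rintro rfl; exact hV1 k1
  · rintro rfl; exact hS1 k2

/-- S² has order 4: odd exponents are excluded by the matrix -1, and exponent 2 by the root -1 of
S⁴. -/
theorem four_dvd_of_zpow_eq_one {i : ℤ} (h : (lift ModularGroup.S ^ 2) ^ i = 1) : 4 ∣ i := by
  have h4 : (lift ModularGroup.S ^ 2) ^ (4 : ℤ) = 1 := by
    rw [← lift_S_pow_eight]; group
  have hr : (lift ModularGroup.S ^ 2) ^ (i % 4) = 1 := by
    have := Int.emod_add_mul_ediv i 4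
    rw [← this, zpow_add, zpow_mul, h4, one_zpow, mul_one] at h
    exact h
  have hneg : (-1 : Matrix (Fin 2) (Fin 2) ℤ) ≠ 1 := by
    intro h
    simpa using congrFun (congrFun h 0) 0
  have hmat : ((lift ModularGroup.S ^ 2).mat : Matrix (Fin 2) (Fin 2) ℤ) = -1 := by
    rw [lift_S_sq_mat]; simp
  have cases : i % 4 = 0 ∨ i % 4 = 1 ∨ i % 4 = 2 ∨ i % 4 = 3 := by omega
  rcases cases with h0 | h1 | h2 | h3
  · exact Int.dvd_of_emod_eq_zero h0
  · rw [h1, zpow_one] at hr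
    rw [hr] at hmat
    exact absurd hmat.symm hneg
  · rw [h2] at hr
    have h5 : lift ModularGroup.S ^ 4 = 1 := by rw [← hr]; group
    have h6 := lift_S_pow_four_root UpperHalfPlane.I
    rw [h5, one_root] at h6
    norm_num at h6
  · rw [h3] at hr
    have : lift ModularGroup.S ^ 2 = 1 := by
      calc lift ModularGroup.S ^ 2 = (lift ModularGroup.S ^ 2) ^ (4 : ℤ) *
          ((lift ModularGroup.S ^ 2) ^ (3 : ℤ))⁻¹ := by group
        _ = 1 := by rw [h4, hr]; simp
    rw [this] at hmat
    exact absurd hmat.symm hneg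

/-- `Mp₂(ℤ)` is presented by `S`, `T` with the relations `(ST)³ = S²` and `S⁸ = 1`. -/
theorem exists_hom {H : Type*} [Group H] (a b : H) (h3 : (a * b) ^ 3 = a ^ 2) (h8 : a ^ 8 = 1) :
    ∃ f : Mp2Z →* H, f (lift ModularGroup.S) = a ∧ f (lift ModularGroup.T) = b := by
  set s : Mp2Z × H := (lift ModularGroup.S, a) with hs
  set u : Mp2Z × H := (lift ModularGroup.S * lift ModularGroup.T, a * b) with hu
  have hsu : u ^ 3 = s ^ 2 := Prod.ext lift_relation h3
  have hs8 : s ^ 8 = 1 := Prod.ext lift_S_pow_eight h8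
  -- K is to be the graph of the desired homomorphism, so it suffices that its projection to Mp₂(ℤ)
  -- is bijective.
  set K := Subgroup.closure {s, u} with hK
  have hsK : s ∈ K := Subgroup.subset_closure (by simp)
  have huK : u ∈ K := Subgroup.subset_closure (by simp)
  set π : K →* Mp2Z := (MonoidHom.fst Mp2Z H).comp K.subtype with hπ
  have hinj : Function.Injective π := by
    rw [injective_iff_map_eq_one]
    rintro ⟨k, hk⟩ hk1
    change k.1 = 1 at hk1
    obtain ⟨i, e, he, p, hp, b', hb', rfl⟩ := normalForm rfl hsu hk
    have hp1 : p = 1 ∨ (IsPositive p.1.mat ∨ IsPositive (-p.1.mat.1)) :=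
      isPositive_of_mem_closure (MonoidHom.fst Mp2Z H) rfl rfl hp
    -- A normal form with trivial first component collapses to a power of s²; its exponent is
    -- divisible by 4, and s⁸ = 1 also holds in the second component.
    have hcases := normalForm_eq_one (i := i) (e := e.1) (p := p.1) (b := b'.1)
      (by rcases he with rfl | rfl | rfl <;> simp [hu]) (by
        rcases hp1 with rfl | h
        · left; rfl
        · exact Or.inr h) (by rcases hb' with rfl | rfl <;> simp [hs]) hk1
    obtain ⟨c1, c2, c3, c4, c5⟩ := hcases
    have he1 : e = 1 := by
      rcases he with h | rfl | rfl
      · exact h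
      · exact absurd rfl c1
      · exact absurd rfl c2
    have hb1 : b' = 1 := by
      rcases hb' with h | rfl
      · exact h
      · exact absurd rfl c3
    have hp2 : p = 1 := hp1.resolve_right (by tauto)
    subst he1 hb1 hp2
    have hz : (lift ModularGroup.S ^ 2) ^ i = 1 := by
      simpa using! hk1
    obtain ⟨j, rfl⟩ := four_dvd_of_zpow_eq_one hz
    apply Subtype.ext
    change (s ^ 2) ^ (4 * j) * (1 * (1 * 1)) = 1
    rw [mul_one, mul_one, mul_one, zpow_mul]
    have : (s ^ 2) ^ (4 : ℤ) = s ^ 8 := by group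
    rw [this, hs8, one_zpow]
  have hsurj : Function.Surjective π := by
    rw [← MonoidHom.range_eq_top, eq_top_iff, ← closure_lift_S_T, Subgroup.closure_le]
    have h1 : lift ModularGroup.S ∈ π.range := ⟨⟨s, hsK⟩, rfl⟩
    have h2 : lift ModularGroup.S * lift ModularGroup.T ∈ π.range := ⟨⟨u, huK⟩, rfl⟩
    rintro x (rfl | rfl)
    · exact h1
    · have := π.range.mul_mem (π.range.inv_mem h1) h2
      rwa [inv_mul_cancel_left] at this
  let ε := MulEquiv.ofBijective π ⟨hinj, hsurj⟩
  refine ⟨((MonoidHom.snd Mp2Z H).comp K.subtype).comp ε.symm.toMonoidHom, ?_, ?_⟩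
  · have : ε.symm (lift ModularGroup.S) = ⟨s, hsK⟩ := by
      rw [MulEquiv.symm_apply_eq]; rfl
    change (ε.symm (lift ModularGroup.S)).1.2 = a
    rw [this]
  · have : ε.symm (lift ModularGroup.T) = ⟨s, hsK⟩⁻¹ * ⟨u, huK⟩ := by
      rw [MulEquiv.symm_apply_eq]
      change _ = (lift ModularGroup.S)⁻¹ * (lift ModularGroup.S * lift ModularGroup.T)
      rw [inv_mul_cancel_left]
    change (ε.symm (lift ModularGroup.T)).1.2 = b
    rw [this]
    change a⁻¹ * (a * b) = b
    rw [inv_mul_cancel_left]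

end Mp2Z

/-! ### The dual Weil representation: existence, unitarity, compatibility with the Heisenberg group
-/

section FiniteQuadraticModule

set_option linter.unusedSectionVars false

variable {A : Type*} [AddCommGroup A] [Fintype A] {Q : QuadraticMap ℤ A (AddCircle (1 : ℚ))}

theorem IsAntisymmetricWeight.sig_int {k : ℝ} (h : IsAntisymmetricWeight Q k) :
    ∃ n : ℤ, sig Q = n := by
  obtain ⟨⟨w, hw⟩, j, -, hj⟩ := h
  refine ⟨2 * j - w, ?_⟩
  push_cast
  rw [← hw, ← hj]
  ring

theorem eq_sum_basisVec (v : A → ℂ) : v = ∑ γ, v γ • basisVec γ := by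
  classical
  funext δ
  simp [basisVec, Finset.sum_apply, Pi.single_apply]

theorem end_ext {f g : Module.End ℂ (A → ℂ)} (h : ∀ γ, f (basisVec γ) = g (basisVec γ)) :
    f = g := by
  ext1 v
  rw [eq_sum_basisVec v, map_sum, map_sum]
  exact Finset.sum_congr rfl fun γ _ => by rw [map_smul, map_smul, h]

/-- `dualWeil` is an epsilon term, so nothing is known about it until some representation with these
generators has been exhibited; the presentation of Mp₂(ℤ) supplies one. -/
theorem isDualWeil_dualWeil (hQ : IsNondegenerate Q) (hsig : ∃ n : ℤ, sig Q = n) :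
    IsDualWeil Q (dualWeil Q) := by
  apply Classical.epsilon_spec (p := IsDualWeil Q)
  obtain ⟨f, hS, hT⟩ := Mp2Z.exists_hom (weilSUnit hQ hsig) (weilTUnit Q)
    (weilSUnit_relation hQ hsig) (Units.pow_ofPowEqOne _ _)
  refine ⟨(Units.coeHom _).comp f, fun γ => ?_, fun γ => ?_⟩
  · rw [MonoidHom.comp_apply, hS]
    exact weilS_basisVec γ
  · rw [MonoidHom.comp_apply, hT]
    exact diagEnd_basisVec _ γ

theorem dualWeil_S (hQ : IsNondegenerate Q) (hsig : ∃ n : ℤ, sig Q = n) :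
    dualWeil Q (Mp2Z.lift ModularGroup.S) = weilS Q :=
  end_ext fun γ => by rw [(isDualWeil_dualWeil hQ hsig).1, weilS_basisVec]

theorem dualWeil_T (hQ : IsNondegenerate Q) (hsig : ∃ n : ℤ, sig Q = n) :
    dualWeil Q (Mp2Z.lift ModularGroup.T) = diagEnd fun γ => eqz (-Q γ) :=
  end_ext fun γ => by rw [(isDualWeil_dualWeil hQ hsig).2, diagEnd_basisVec]

/-- Plancherel on the finite group A. -/
theorem sum_normSq_weilS (hQ : IsNondegenerate Q) (v : A → ℂ) :
    ∑ δ, ‖weilS Q v δ‖ ^ 2 = ∑ γ, ‖v γ‖ ^ 2 := by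
  classical
  have hn := card_ne_zero' A
  have key : ∑ δ, (starRingEnd ℂ) (∑ γ, eqz (bil Q γ δ) * v γ) * ∑ γ, eqz (bil Q γ δ) * v γ
      = Fintype.card A * ∑ γ, (starRingEnd ℂ) (v γ) * v γ := by
    have h1 : ∀ δ, (starRingEnd ℂ) (∑ γ, eqz (bil Q γ δ) * v γ) * ∑ γ, eqz (bil Q γ δ) * v γ
        = ∑ γ, ∑ ε, (starRingEnd ℂ) (v γ) * v ε * eqz (bil Q (ε - γ) δ) := by
      intro δ
      rw [map_sum, Finset.sum_mul_sum]
      refine Finset.sum_congr rfl fun γ _ => Finset.sum_congr rfl fun ε _ => ?_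
      rw [map_mul, conj_eqz, bil_sub_left, sub_eq_add_neg, eqz_add]
      ring
    simp only [h1]
    rw [Finset.sum_comm, Finset.mul_sum]
    refine Finset.sum_congr rfl fun γ _ => ?_
    rw [Finset.sum_comm]
    simp only [← Finset.mul_sum, sum_eqz_bil hQ, sub_eq_zero]
    simp
    ring
  have hnorm : ∀ w : ℂ, ((‖w‖ ^ 2 : ℝ) : ℂ) = (starRingEnd ℂ) w * w := fun w => by
    rw [Complex.conj_mul']; push_cast; rfl
  have : ((∑ δ, ‖weilS Q v δ‖ ^ 2 : ℝ) : ℂ) = ((∑ γ, ‖v γ‖ ^ 2 : ℝ) : ℂ) := by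
    rw [Complex.ofReal_sum, Complex.ofReal_sum]
    simp only [hnorm]
    have h2 : ∀ δ, (starRingEnd ℂ) (weilS Q v δ) * weilS Q v δ = (Fintype.card A : ℂ)⁻¹ *
        ((starRingEnd ℂ) (∑ γ, eqz (bil Q γ δ) * v γ) * ∑ γ, eqz (bil Q γ δ) * v γ) := by
      intro δ
      have hκ : (starRingEnd ℂ) ((Real.sqrt (Fintype.card A) : ℂ)⁻¹ * ee (sig Q / 8)) *
          ((Real.sqrt (Fintype.card A) : ℂ)⁻¹ * ee (sig Q / 8)) = (Fintype.card A : ℂ)⁻¹ := by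
        have he : ‖ee ((sig Q : ℂ) / 8)‖ = 1 := by
          have := norm_ee_real (sig Q / 8)
          push_cast at this
          exact this
        rw [Complex.conj_mul', norm_mul, he, mul_one, norm_inv, Complex.norm_real,
          Real.norm_of_nonneg (Real.sqrt_nonneg _), ← Complex.ofReal_pow, inv_pow,
          Real.sq_sqrt (by positivity)]
        simp
      simp only [weilS, LinearMap.coe_mk, AddHom.coe_mk]
      rw [← hκ, map_mul]
      ring
    simp only [h2, ← Finset.mul_sum]
    rw [key, inv_mul_cancel_left₀ hn]
  exact_mod_cast this

/-- The dual Weil representation is unitary. -/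
theorem sum_normSq_dualWeil (hQ : IsNondegenerate Q) (hsig : ∃ n : ℤ, sig Q = n) (x : Mp2Z)
    (v : A → ℂ) : ∑ δ, ‖dualWeil Q x v δ‖ ^ 2 = ∑ γ, ‖v γ‖ ^ 2 := by
  have hx : x ∈ Subgroup.closure {Mp2Z.lift ModularGroup.S, Mp2Z.lift ModularGroup.T} := by
    rw [Mp2Z.closure_lift_S_T]; trivial
  induction hx using Subgroup.closure_induction generalizing v with
  | mem x hx =>
    rcases hx with rfl | rfl
    · rw [dualWeil_S hQ hsig, sum_normSq_weilS hQ]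
    · rw [dualWeil_T hQ hsig]
      simp [diagEnd, norm_eqz]
  | one => simp
  | mul x y _ _ ihx ihy => rw [map_mul, Module.End.mul_apply, ihx, ihy]
  | inv x _ ih =>
    have := ih (dualWeil Q x⁻¹ v)
    rw [← Module.End.mul_apply, ← map_mul, mul_inv_cancel, map_one] at this
    exact this.symm

theorem norm_dualWeil_le (hQ : IsNondegenerate Q) (hsig : ∃ n : ℤ, sig Q = n) (x : Mp2Z)
    (v : A → ℂ) : ‖dualWeil Q x v‖ ≤ Real.sqrt (∑ γ, ‖v γ‖ ^ 2) := by
  rw [pi_norm_le_iff_of_nonneg (Real.sqrt_nonneg _)]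
  intro δ
  rw [← sum_normSq_dualWeil hQ hsig x v]
  apply Real.le_sqrt_of_sq_le
  exact Finset.single_le_sum (f := fun δ => ‖dualWeil Q x v δ‖ ^ 2) (fun _ _ => sq_nonneg _)
    (Finset.mem_univ δ)

/-! ### The Heisenberg group -/

/-- The Schrödinger representation of the Heisenberg group generated by `β`. -/
def heis (Q : QuadraticMap ℤ A (AddCircle (1 : ℚ))) (β : A) (l μ : ℤ) :
    Module.End ℂ (A → ℂ) where
  toFun v δ := eqz (-(μ • bil Q δ β) + (l * μ) • Q β) * v (δ - l • β)
  map_add' v w := by ext δ; simp [mul_add]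
  map_smul' a v := by ext δ; simp [mul_left_comm]

theorem weilS_heis (β : A) (l μ : ℤ) :
    weilS Q * heis Q β l μ = heis Q β μ (-l) * weilS Q := by
  ext1 v
  funext δ
  simp only [Module.End.mul_apply, weilS, heis, LinearMap.coe_mk, AddHom.coe_mk]
  rw [mul_left_comm]
  congr 1
  rw [← Equiv.sum_comp (Equiv.addRight (l • β)), Finset.mul_sum]
  refine Finset.sum_congr rfl fun γ _ => ?_
  rw [Equiv.coe_addRight, add_sub_cancel_right, ← mul_assoc, ← mul_assoc, ← eqz_add, ← eqz_add]
  congr 2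
  simp only [bil_add_left, bil_zsmul_left, bil_sub_right, bil_zsmul_right, bil_self, bil_comm Q β δ]
  module

theorem diagEnd_heis (β : A) (l μ : ℤ) :
    diagEnd (fun γ => eqz (-Q γ)) * heis Q β l μ
      = heis Q β l (l + μ) * diagEnd (fun γ => eqz (-Q γ)) := by
  ext1 v
  funext δ
  simp only [Module.End.mul_apply, diagEnd, heis, LinearMap.coe_mk, AddHom.coe_mk]
  rw [← mul_assoc, ← mul_assoc, ← eqz_add, ← eqz_add]
  congr 2
  have h : Q (δ - l • β) = Q δ - l • bil Q δ β + (l * l) • Q β := by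
    rw [sub_eq_add_neg, ← neg_zsmul, Q_add, Q_zsmul, bil_zsmul_right]
    module
  rw [h]
  module

/-- The Weil representation normalizes the Heisenberg group and acts on it through SL₂(ℤ). The
relation is multiplicative in x, so S and T suffice. It is what makes the theta series
quasi-periodic under z ↦ z+1. -/
theorem dualWeil_heis (hQ : IsNondegenerate Q) (hsig : ∃ n : ℤ, sig Q = n) (β : A) (x : Mp2Z)
    (l μ : ℤ) : dualWeil Q x * heis Q β l μ
      = heis Q β (x.mat 1 1 * l + x.mat 1 0 * μ) (x.mat 0 1 * l + x.mat 0 0 * μ) *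
        dualWeil Q x := by
  have hx : x ∈ Subgroup.closure {Mp2Z.lift ModularGroup.S, Mp2Z.lift ModularGroup.T} := by
    rw [Mp2Z.closure_lift_S_T]; trivial
  induction hx using Subgroup.closure_induction generalizing l μ with
  | mem x hx =>
    rcases hx with rfl | rfl
    · rw [dualWeil_S hQ hsig, weilS_heis, Mp2Z.lift_mat, ModularGroup.coe_S]
      simp
    · rw [dualWeil_T hQ hsig, diagEnd_heis, Mp2Z.lift_mat, ModularGroup.coe_T]
      simp
  | one => simp [Mp2Z.one_mat]
  | mul x y _ _ ihx ihy =>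
    rw [map_mul, mul_assoc, ihy, ← mul_assoc, ihx, mul_assoc, Mp2Z.mul_mat,
      Matrix.SpecialLinearGroup.coe_mul]
    congr 2 <;> simp only [Matrix.mul_apply, Fin.sum_univ_two] <;> ring
  | inv x _ ih =>
    have hdet := Matrix.SpecialLinearGroup.det_coe x.mat
    rw [Matrix.det_fin_two] at hdet
    -- The known relation for x is applied to the preimage of (l, μ) under its matrix.
    have h := ih (x.mat 0 0 * l - x.mat 1 0 * μ) (-x.mat 0 1 * l + x.mat 1 1 * μ)
    have e1 : x.mat 1 1 * (x.mat 0 0 * l - x.mat 1 0 * μ) +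
        x.mat 1 0 * (-x.mat 0 1 * l + x.mat 1 1 * μ) = l := by
      linear_combination l * hdet
    have e2 : x.mat 0 1 * (x.mat 0 0 * l - x.mat 1 0 * μ) +
        x.mat 0 0 * (-x.mat 0 1 * l + x.mat 1 1 * μ) = μ := by
      linear_combination μ * hdet
    rw [e1, e2] at h
    have hinv : dualWeil Q x⁻¹ * dualWeil Q x = 1 := by rw [← map_mul, inv_mul_cancel, map_one]
    have hinv' : dualWeil Q x * dualWeil Q x⁻¹ = 1 := by rw [← map_mul, mul_inv_cancel, map_one]
    have h3 : dualWeil Q x⁻¹ * heis Q β l μ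
        = heis Q β (x.mat 0 0 * l - x.mat 1 0 * μ) (-x.mat 0 1 * l + x.mat 1 1 * μ) *
          dualWeil Q x⁻¹ := by
      calc dualWeil Q x⁻¹ * heis Q β l μ
          = dualWeil Q x⁻¹ * (heis Q β l μ * dualWeil Q x) * dualWeil Q x⁻¹ := by
            rw [mul_assoc, mul_assoc, hinv', mul_one]
        _ = _ := by rw [← h, ← mul_assoc, hinv, one_mul]
    rw [h3, Mp2Z.inv_mat, Matrix.SpecialLinearGroup.coe_inv, Matrix.adjugate_fin_two]
    congr 2
    simp; ring

theorem heis_basisVec (β : A) (l μ : ℤ) (γ : A) :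
    heis Q β l μ (basisVec γ)
      = eqz (-(μ • bil Q γ β) - (l * μ) • Q β) • basisVec (γ + l • β) := by
  classical
  funext δ
  by_cases h : δ = γ + l • β
  · subst h
    simp only [heis, LinearMap.coe_mk, AddHom.coe_mk, add_sub_cancel_right, basisVec,
      Pi.single_eq_same, Pi.smul_apply, smul_eq_mul, mul_one]
    congr 1
    rw [bil_add_left, bil_zsmul_left, bil_self]
    module
  · have h' : δ - l • β ≠ γ := fun h' => h (by rw [← h', sub_add_cancel])
    simp [heis, basisVec, h, h']

/-! ### Lifts of products with `T` -/

theorem Mp2Z.lift_T_mul (g : SL(2, ℤ)) :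
    Mp2Z.lift (ModularGroup.T * g) = Mp2Z.lift ModularGroup.T * Mp2Z.lift g := by
  refine Mp2Z.ext rfl (funext fun τ => ?_)
  rw [Mp2Z.mul_root, Mp2Z.lift_T_root, one_mul, Mp2Z.lift_root, Mp2Z.lift_root, autFactor,
    autFactor, ModularGroup.T_mul_apply_one]

theorem autFactor_mul_T (g : SL(2, ℤ)) (τ : ℍ) :
    autFactor (g * ModularGroup.T) τ = autFactor g (ModularGroup.T • τ) := by
  rw [autFactor_mul]
  simp [autFactor, ModularGroup.coe_T]

theorem Mp2Z.lift_mul_T (g : SL(2, ℤ)) :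
    Mp2Z.lift (g * ModularGroup.T) = Mp2Z.lift g * Mp2Z.lift ModularGroup.T := by
  refine Mp2Z.ext rfl (funext fun τ => ?_)
  rw [Mp2Z.mul_root, Mp2Z.lift_T_root, mul_one, Mp2Z.lift_root, Mp2Z.lift_root, autFactor_mul_T,
    Mp2Z.lift_mat]

theorem dualWeil_T_inv_basisVec (hQ : IsNondegenerate Q) (hsig : ∃ n : ℤ, sig Q = n) (γ : A) :
    dualWeil Q (Mp2Z.lift ModularGroup.T)⁻¹ (basisVec γ) = eqz (Q γ) • basisVec γ := by
  have h : dualWeil Q (Mp2Z.lift ModularGroup.T)⁻¹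
      (dualWeil Q (Mp2Z.lift ModularGroup.T) (basisVec γ)) = basisVec γ := by
    rw [← Module.End.mul_apply, ← map_mul, inv_mul_cancel, map_one, Module.End.one_apply]
  rw [dualWeil_T hQ hsig, diagEnd_basisVec, map_smul] at h
  have h2 := congrArg (eqz (Q γ) • ·) h
  simp only [smul_smul] at h2
  rwa [← eqz_add, add_neg_cancel, eqz_zero, one_smul] at h2

variable {m : ℚ} {β : A}

theorem ee_mul_int_sq (hmβ : (m : AddCircle (1 : ℚ)) = -Q β) (l : ℤ) :
    ee (m * l ^ 2) = eqz (-Q (l • β)) := by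
  have : ee (m * l ^ 2) = eqz ((l * l) • (m : AddCircle (1 : ℚ))) := by
    rw [eqz_zsmul, eqz_coe, ← ee_int_mul]
    congr 1; push_cast; ring
  rw [this, hmβ, Q_zsmul]
  congr 1
  module

/-- The summand depends only on the bottom row: replacing M by TM adds mλ² to the exponent, and the
inverse action of T on 𝔢_{λβ} compensates because m ∈ ℤ - Q(β). -/
theorem jacobiThetaTerm_T_mul (hQ : IsNondegenerate Q) (hsig : ∃ n : ℤ, sig Q = n)
    (hmβ : (m : AddCircle (1 : ℚ)) = -Q β) (τ : ℍ) (z : ℂ) (g : SL(2, ℤ)) (l : ℤ) :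
    jacobiThetaTerm Q m β τ z (ModularGroup.T * g) l = jacobiThetaTerm Q m β τ z g l := by
  have hj := autFactor_ne_zero g τ
  have haut : autFactor (ModularGroup.T * g) τ = autFactor g τ := by
    rw [autFactor, autFactor, ModularGroup.T_mul_apply_one]
  have h10 : (ModularGroup.T * g) 1 0 = g 1 0 := congrFun (ModularGroup.T_mul_apply_one g) 0
  have h00 : (ModularGroup.T * g) 0 0 = g 0 0 + g 1 0 := by
    rw [Matrix.SpecialLinearGroup.coe_mul, ModularGroup.coe_T]
    simp [Matrix.mul_apply]
  have h01 : (ModularGroup.T * g) 0 1 = g 0 1 + g 1 1 := by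
    rw [Matrix.SpecialLinearGroup.coe_mul, ModularGroup.coe_T]
    simp [Matrix.mul_apply]
  rw [jacobiThetaTerm, jacobiThetaTerm, haut, h10, h00, h01, Mp2Z.lift_T_mul, mul_inv_rev, map_mul,
    Module.End.mul_apply, dualWeil_T_inv_basisVec hQ hsig, map_smul, smul_smul]
  congr 1
  have : (m * l ^ 2 * (((g 0 0 + g 1 0 : ℤ) : ℂ) * (τ : ℂ) + ((g 0 1 + g 1 1 : ℤ) : ℂ)) +
      2 * m * l * z - (g 1 0 : ℂ) * m * z ^ 2) / autFactor g τ
      = (m * l ^ 2 * ((g 0 0 : ℂ) * (τ : ℂ) + (g 0 1 : ℂ)) + 2 * m * l * z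
        - (g 1 0 : ℂ) * m * z ^ 2) / autFactor g τ + m * l ^ 2 := by
    rw [div_add' _ _ _ hj]
    congr 1
    rw [autFactor]
    push_cast
    ring
  rw [this, ee_add, mul_assoc, ee_mul_int_sq hmβ, ← eqz_add, neg_add_cancel, eqz_zero, mul_one]

theorem jacobiThetaTerm_T_smul (τ : ℍ) (z : ℂ) (g : SL(2, ℤ)) (l : ℤ) :
    jacobiThetaTerm Q m β (ModularGroup.T • τ) z g l
      = dualWeil Q (Mp2Z.lift ModularGroup.T)
        (jacobiThetaTerm Q m β τ z (g * ModularGroup.T) l) := by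
  have h10 : (g * ModularGroup.T) 1 0 = g 1 0 := by
    rw [Matrix.SpecialLinearGroup.coe_mul, ModularGroup.coe_T]
    simp [Matrix.mul_apply]
  have h00 : (g * ModularGroup.T) 0 0 = g 0 0 := by
    rw [Matrix.SpecialLinearGroup.coe_mul, ModularGroup.coe_T]
    simp [Matrix.mul_apply]
  have h01 : (g * ModularGroup.T) 0 1 = g 0 0 + g 0 1 := by
    rw [Matrix.SpecialLinearGroup.coe_mul, ModularGroup.coe_T]
    simp [Matrix.mul_apply]
  have hτ : ((ModularGroup.T • τ : ℍ) : ℂ) = τ + 1 := by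
    rw [UpperHalfPlane.modular_T_smul, UpperHalfPlane.coe_vadd]
    push_cast; ring
  rw [jacobiThetaTerm, jacobiThetaTerm, map_smul, autFactor_mul_T, h10, h00, h01,
    Mp2Z.lift_mul_T, mul_inv_rev, map_mul, Module.End.mul_apply]
  rw [← Module.End.mul_apply (dualWeil Q _) (dualWeil Q _⁻¹), ← map_mul, mul_inv_cancel, map_one,
    Module.End.one_apply, hτ]
  congr 3
  push_cast
  ring

/-- Translating z by 1 is absorbed by λ ↦ λ+c together with a Heisenberg operator. After conjugation
by ρ*(M)⁻¹ that operator becomes multiplication by a character of A. -/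
theorem jacobiThetaTerm_add_one (hQ : IsNondegenerate Q) (hsig : ∃ n : ℤ, sig Q = n)
    (hmβ : (m : AddCircle (1 : ℚ)) = -Q β) (τ : ℍ) (z : ℂ) (g : SL(2, ℤ)) (l : ℤ) :
    jacobiThetaTerm Q m β τ (z + 1) g (l + g 1 0)
      = diagEnd (fun γ => eqz (-bil Q γ β)) (jacobiThetaTerm Q m β τ z g l) := by
  have hj := autFactor_ne_zero g τ
  have hdet := Matrix.SpecialLinearGroup.det_coe g
  rw [Matrix.det_fin_two] at hdet
  have hdet' : (g 0 0 : ℂ) * g 1 1 - g 0 1 * g 1 0 = 1 := by exact_mod_cast hdet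
  have hcomm : dualWeil Q (Mp2Z.lift g)⁻¹ * heis Q β (g 1 0) (g 0 0)
      = heis Q β 0 1 * dualWeil Q (Mp2Z.lift g)⁻¹ := by
    -- The pair (c, a) is the one that the inverse matrix sends to (0, 1).
    have h := dualWeil_heis hQ hsig β (Mp2Z.lift g)⁻¹ (g 1 0) (g 0 0)
    rw [Mp2Z.inv_mat, Matrix.SpecialLinearGroup.coe_inv, Matrix.adjugate_fin_two,
      Mp2Z.lift_mat] at h
    rw [h]
    congr 2
    · simp; ring
    · simp; linarith
  have hdiag : diagEnd (fun γ => eqz (-bil Q γ β)) = heis Q β 0 1 := by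
    ext1 v
    funext δ
    simp [diagEnd, heis]
  rw [hdiag, jacobiThetaTerm, jacobiThetaTerm, map_smul, ← Module.End.mul_apply, ← hcomm,
    Module.End.mul_apply, heis_basisVec, map_smul, smul_smul, add_smul]
  congr 1
  have h1 : eqz (-(g 0 0 • bil Q (l • β) β) - (g 1 0 * g 0 0) • Q β)
      = ee (m * (2 * l * g 0 0 + g 1 0 * g 0 0)) := by
    have : ee (m * (2 * l * g 0 0 + g 1 0 * g 0 0))
        = eqz ((2 * l * g 0 0 + g 1 0 * g 0 0) • (m : AddCircle (1 : ℚ))) := by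
      rw [eqz_zsmul, eqz_coe, ← ee_int_mul]
      congr 1; push_cast; ring
    rw [this, hmβ, bil_zsmul_left, bil_self]
    congr 1
    module
  rw [h1, ← ee_add]
  congr 1
  rw [div_add' _ _ _ hj]
  congr 1
  rw [autFactor]
  push_cast
  linear_combination (-(m : ℂ) * (2 * l + g 1 0)) * hdet'

end FiniteQuadraticModule

/-! ### Lattice sums -/

theorem coe_SL_smul (g : SL(2, ℤ)) (τ : ℍ) :
    ((g • τ : ℍ) : ℂ) = ((g 0 0 : ℂ) * τ + (g 0 1 : ℂ)) / autFactor g τ := by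
  rw [UpperHalfPlane.specialLinearGroup_apply]
  simp [autFactor]

theorem SL_smul_im (g : SL(2, ℤ)) (τ : ℍ) : (g • τ).im = τ.im / ‖autFactor g τ‖ ^ 2 := by
  rw [ModularGroup.im_smul_eq_div_normSq, autFactor_eq_denom, Complex.normSq_eq_norm_sq]

/-- The theta series of the lattice `ℤτ + ℤ`, normalized to be invariant under `SL₂(ℤ)`. -/
def latticeSum (κ : ℝ) (τ : ℍ) : ℝ :=
  ∑' x : Fin 2 → ℤ, Real.exp (-κ * (‖(x 0 : ℂ) * τ + x 1‖ ^ 2 / τ.im))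

theorem exp_neg_le_two_div_sq {s : ℝ} (hs : 0 < s) : Real.exp (-s) ≤ 2 / s ^ 2 := by
  rw [Real.exp_neg, ← one_div, div_le_div_iff₀ (Real.exp_pos s) (by positivity)]
  have := Real.quadratic_le_exp_of_nonneg hs.le
  nlinarith

/-- exp(-s) ≤ 2/s² reduces the theta series of ℤτ+ℤ to the Eisenstein-type series Σ‖x‖^{-4}, with
constants uniform on a vertical strip. The origin is counted separately. -/
theorem latticeTerm_le {κ : ℝ} (hκ : 0 < κ) {A B : ℝ} (hB : 0 < B) {τ : ℍ}
    (hτ : τ ∈ UpperHalfPlane.verticalStrip A B) (x : Fin 2 → ℤ) :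
    Real.exp (-κ * (‖(x 0 : ℂ) * τ + x 1‖ ^ 2 / τ.im)) ≤
      2 / κ ^ 2 * EisensteinSeries.r ⟨⟨A, B⟩, hB⟩ ^ (-4 : ℝ) * τ.im ^ 2 * ‖x‖ ^ (-4 : ℝ)
        + (if x = 0 then 1 else 0) := by
  have hy := τ.im_pos
  have hr := EisensteinSeries.r_pos ⟨⟨A, B⟩, hB⟩
  split_ifs with hx
  · subst hx
    simp only [Pi.zero_apply, Int.cast_zero, zero_mul, add_zero, norm_zero]
    simp
  · rw [add_zero]
    have h1 := EisensteinSeries.summand_bound_of_mem_verticalStrip (k := 4) (by norm_num) x hB hτ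
    have h2 : 0 < ‖(x 0 : ℂ) * τ + x 1‖ :=
      lt_of_lt_of_le (mul_pos (EisensteinSeries.r_pos τ) (norm_pos_iff.2 hx))
        (EisensteinSeries.r_mul_max_le τ hx)
    have h3 : 0 < κ * (‖(x 0 : ℂ) * τ + x 1‖ ^ 2 / τ.im) := by positivity
    rw [neg_mul]
    refine (exp_neg_le_two_div_sq h3).trans ?_
    have h4 : ‖(x 0 : ℂ) * τ + x 1‖ ^ (-4 : ℝ) = (‖(x 0 : ℂ) * τ + x 1‖ ^ 4)⁻¹ := by
      rw [Real.rpow_neg h2.le]; norm_cast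
    rw [h4] at h1
    calc 2 / (κ * (‖(x 0 : ℂ) * τ + x 1‖ ^ 2 / τ.im)) ^ 2
        = 2 / κ ^ 2 * τ.im ^ 2 * (‖(x 0 : ℂ) * τ + x 1‖ ^ 4)⁻¹ := by field_simp
      _ ≤ 2 / κ ^ 2 * τ.im ^ 2 *
          (EisensteinSeries.r ⟨⟨A, B⟩, hB⟩ ^ (-4 : ℝ) * ‖x‖ ^ (-4 : ℝ)) := by gcongr
      _ = _ := by ring

theorem summable_latticeBound (C : ℝ) :
    Summable fun x : Fin 2 → ℤ => C * ‖x‖ ^ (-4 : ℝ) + (if x = 0 then 1 else 0) :=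
  ((EisensteinSeries.summable_one_div_norm_rpow (by norm_num : (2 : ℝ) < 4)).mul_left C).add
    (summable_of_hasFiniteSupport <| (Set.finite_singleton 0).subset fun x hx => by
      by_contra h
      simp only [Set.mem_singleton_iff] at h
      simp [h] at hx)

theorem mem_verticalStrip_self (τ : ℍ) : τ ∈ UpperHalfPlane.verticalStrip |τ.re| τ.im :=
  ⟨le_rfl, le_rfl⟩

theorem summable_latticeTerm {κ : ℝ} (hκ : 0 < κ) (τ : ℍ) :
    Summable fun x : Fin 2 → ℤ => Real.exp (-κ * (‖(x 0 : ℂ) * τ + x 1‖ ^ 2 / τ.im)) :=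
  Summable.of_nonneg_of_le (fun _ => (Real.exp_pos _).le)
    (latticeTerm_le hκ τ.im_pos (mem_verticalStrip_self τ)) (summable_latticeBound _)

theorem latticeSum_nonneg (κ : ℝ) (τ : ℍ) : 0 ≤ latticeSum κ τ :=
  tsum_nonneg fun _ => (Real.exp_pos _).le

theorem exists_latticeSum_le {κ : ℝ} (hκ : 0 < κ) (A : ℝ) {B : ℝ} (hB : 0 < B) :
    ∃ C, 0 ≤ C ∧ ∀ τ ∈ UpperHalfPlane.verticalStrip A B, latticeSum κ τ ≤ C * (1 + τ.im) ^ 2 := by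
  set C₁ := 2 / κ ^ 2 * EisensteinSeries.r ⟨⟨A, B⟩, hB⟩ ^ (-4 : ℝ)
  have hC₁ : 0 ≤ C₁ := by
    have := EisensteinSeries.r_pos ⟨⟨A, B⟩, hB⟩
    positivity
  set Z := ∑' x : Fin 2 → ℤ, ‖x‖ ^ (-4 : ℝ)
  have hZ : 0 ≤ Z := tsum_nonneg fun _ => by positivity
  have hs := EisensteinSeries.summable_one_div_norm_rpow (by norm_num : (2 : ℝ) < 4)
  refine ⟨C₁ * Z + 1, by positivity, fun τ hτ => ?_⟩
  have hle : latticeSum κ τ ≤ C₁ * τ.im ^ 2 * Z + 1 := by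
    refine ((summable_latticeTerm hκ τ).tsum_le_tsum (latticeTerm_le hκ hB hτ)
      (summable_latticeBound _)).trans (le_of_eq ?_)
    have h0 : Summable fun x : Fin 2 → ℤ => (if x = 0 then (1 : ℝ) else 0) := by
      simpa using summable_latticeBound 0
    rw [(hs.mul_left _).tsum_add h0, tsum_mul_left, tsum_ite_eq]
  refine hle.trans ?_
  have hy := τ.im_pos
  nlinarith [mul_nonneg hC₁ hZ, mul_nonneg (mul_nonneg hC₁ hZ) hy.le]

/-- |xτ+y|²/Im τ is the unimodular quadratic form of τ, and g acts on it by a substitution of the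
integer vector (x,y). -/
theorem latticeSum_smul (κ : ℝ) (g : SL(2, ℤ)) (τ : ℍ) :
    latticeSum κ (g • τ) = latticeSum κ τ := by
  let e : (Fin 2 → ℤ) ≃ (Fin 2 → ℤ) :=
    { toFun := fun x => Matrix.vecMul x (g : Matrix (Fin 2) (Fin 2) ℤ)
      invFun := fun x => Matrix.vecMul x ((g⁻¹ : SL(2, ℤ)) : Matrix (Fin 2) (Fin 2) ℤ)
      left_inv := fun x => by
        beta_reduce
        rw [Matrix.vecMul_vecMul, ← Matrix.SpecialLinearGroup.coe_mul, mul_inv_cancel]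
        simp
      right_inv := fun x => by
        beta_reduce
        rw [Matrix.vecMul_vecMul, ← Matrix.SpecialLinearGroup.coe_mul, inv_mul_cancel]
        simp }
  rw [latticeSum, latticeSum, ← e.tsum_eq fun x : Fin 2 → ℤ =>
    Real.exp (-κ * (‖(x 0 : ℂ) * τ + x 1‖ ^ 2 / τ.im))]
  refine tsum_congr fun x => ?_
  have hj := autFactor_ne_zero g τ
  have hj' : ‖autFactor g τ‖ ≠ 0 := norm_ne_zero_iff.2 hj
  have hy := τ.im_pos.ne'
  have h1 : ((x 0 : ℂ) * ((g • τ : ℍ) : ℂ) + x 1)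
      = (((e x) 0 : ℤ) * (τ : ℂ) + ((e x) 1 : ℤ)) / autFactor g τ := by
    rw [coe_SL_smul, mul_div_assoc', div_add' _ _ _ hj]
    congr 1
    simp only [e, Equiv.coe_fn_mk, Matrix.vecMul, dotProduct, Fin.sum_univ_two, autFactor]
    push_cast
    ring
  rw [h1, SL_smul_im, norm_div, div_pow]
  congr 2
  field_simp

/-! ### Gaussian sums on pairs -/

/-- The exponential `𝐞(mλ²t + 2mλw)`. -/
def thetaExp (m : ℝ) (t w : ℂ) (l : ℤ) : ℂ := ee (m * l ^ 2 * t + 2 * m * l * w)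

theorem thetaExp_eq (m : ℝ) (t w : ℂ) (l : ℤ) :
    thetaExp m t w l = jacobiTheta₂_term l (2 * m * w) (2 * m * t) := by
  rw [thetaExp, ee, jacobiTheta₂_term]
  congr 1
  ring

theorem summable_thetaExp {m : ℝ} (hm : 0 < m) {t : ℂ} (ht : 0 < t.im) (w : ℂ) :
    Summable (thetaExp m t w) := by
  have : (thetaExp m t w) = (jacobiTheta₂_term · (2 * m * w) (2 * m * t)) :=
    funext fun l => thetaExp_eq m t w l
  rw [this, summable_jacobiTheta₂_term_iff]
  have : (2 * (m : ℂ) * t) = ((2 * m : ℝ) : ℂ) * t := by push_cast; ring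
  rw [this, Complex.im_ofReal_mul]
  positivity

/-- The summand `exp(-πm|pt - n/(2m)|²/Im t)`. -/
def pairTerm (m : ℝ) (t : ℂ) (p n : ℤ) : ℝ :=
  Real.exp (-(Real.pi * m) * (‖(p : ℂ) * t - n / (2 * m)‖ ^ 2 / t.im))

theorem norm_sq_pair {m : ℝ} (t : ℂ) (p n : ℤ) :
    ‖(p : ℂ) * t - n / (2 * m)‖ ^ 2 = (p * t.re - n / (2 * m)) ^ 2 + (p * t.im) ^ 2 := by
  have : (p : ℂ) * t - n / (2 * m) = ((p * t.re - n / (2 * m) : ℝ) : ℂ) + ((p * t.im : ℝ) : ℂ) *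
      Complex.I := by
    conv_lhs => rw [← Complex.re_add_im t]
    push_cast
    ring
  rw [this, Complex.sq_norm, Complex.normSq_add_mul_I]

/-- For fixed difference p the product of the two exponentials is a Gaussian in l. Poisson summation
followed by absolute values on the dual side gives the bound. Summing before taking absolute values
is the source of the square root cancellation. -/
theorem norm_tsum_thetaExp_pair_le {m : ℝ} (hm : 0 < m) {t : ℂ} (ht : 0 < t.im) (w : ℂ) (p : ℤ)
    (hs : Summable (pairTerm m t p)) :
    ‖∑' l : ℤ, thetaExp m t w l * (starRingEnd ℂ) (thetaExp m t w (l - p))‖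
      ≤ (4 * m * t.im) ^ (-(1 / 2) : ℝ) * Real.exp (4 * Real.pi * m * (w.im ^ 2 / t.im)) *
        ∑' n, pairTerm m t p n := by
  -- The modulus exp(-2πm l² Im t) occurs in both factors, whence the Gaussian parameter 4m Im t.
  set a : ℝ := 4 * m * t.im with ha
  have ha0 : 0 < a := by positivity
  set tb := (starRingEnd ℂ) t with htb
  set wb := (starRingEnd ℂ) w with hwb
  have e1 : t - tb = 2 * t.im * Complex.I := by rw [htb, Complex.sub_conj]; push_cast; ring
  have e2 : w - wb = 2 * w.im * Complex.I := by rw [hwb, Complex.sub_conj]; push_cast; ring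
  set b : ℂ := Complex.I * m * (2 * p * tb) - 4 * m * w.im with hb
  set C : ℂ := 2 * Real.pi * Complex.I * (m * (-(p : ℂ) ^ 2 * tb + 2 * p * wb)) with hC
  have h1 : ∀ l : ℤ, thetaExp m t w l * (starRingEnd ℂ) (thetaExp m t w (l - p))
      = Complex.exp C * Complex.exp (-Real.pi * (a : ℂ) * l ^ 2 + 2 * Real.pi * b * l) := by
    intro l
    rw [thetaExp, thetaExp, conj_ee, ← ee_add, ee, ← Complex.exp_add]
    congr 1
    simp only [map_add, map_mul, map_pow, Complex.conj_ofReal, map_ofNat, map_intCast]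
    rw [← htb, ← hwb, hC, hb, ha]
    push_cast
    have ht' : t = tb + 2 * t.im * Complex.I := by rw [← e1]; ring
    have hw' : w = wb + 2 * w.im * Complex.I := by rw [← e2]; ring
    generalize hti : (t.im : ℂ) = ti at *
    generalize hwi : (w.im : ℂ) = wi at *
    rw [ht', hw']
    ring_nf
    rw [Complex.I_sq]
    ring
  simp only [h1]
  rw [tsum_mul_left, Complex.tsum_exp_neg_quadratic (by simpa using ha0), norm_mul, norm_mul]
  have hnorm : ∀ n : ℤ, ‖Complex.exp C‖ * ‖Complex.exp (-Real.pi / (a : ℂ) * (n + Complex.I * b) ^ 2)‖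
      = Real.exp (4 * Real.pi * m * (w.im ^ 2 / t.im)) * pairTerm m t p n := by
    intro n
    rw [Complex.norm_exp, Complex.norm_exp, pairTerm, ← Real.exp_add, ← Real.exp_add, norm_sq_pair]
    congr 1
    have hCre : C.re = 2 * Real.pi * m * (-(p : ℝ) ^ 2 * t.im + 2 * p * w.im) := by
      have : C = ((2 * Real.pi * m : ℝ) : ℂ) *
          (Complex.I * (((-(p : ℝ) ^ 2 : ℝ) : ℂ) * tb + ((2 * p : ℝ) : ℂ) * wb)) := by
        rw [hC]; push_cast; ring
      rw [this, Complex.re_ofReal_mul, Complex.I_mul_re, Complex.add_im, Complex.im_ofReal_mul,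
        Complex.im_ofReal_mul, htb, hwb, Complex.conj_im, Complex.conj_im]
      ring
    have hq : ((n : ℂ) + Complex.I * b) = ((n - 2 * m * p * t.re : ℝ) : ℂ) +
        ((2 * m * p * t.im - 4 * m * w.im : ℝ) : ℂ) * Complex.I := by
      have htb' : tb = t.re - t.im * Complex.I := by
        rw [htb]; apply Complex.ext <;> simp
      rw [hb, htb']
      push_cast
      ring_nf
      simp only [Complex.I_sq, Complex.I_pow_three]
      ring
    have hre : ((-Real.pi / (a : ℂ)) * (n + Complex.I * b) ^ 2).re
        = -Real.pi / a * ((n - 2 * m * p * t.re) ^ 2 - (2 * m * p * t.im - 4 * m * w.im) ^ 2) := by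
      rw [hq]
      have : (-Real.pi / (a : ℂ)) = ((-Real.pi / a : ℝ) : ℂ) := by push_cast; ring
      rw [this, Complex.re_ofReal_mul]
      congr 1
      rw [sq, Complex.mul_re]
      simp
      ring
    rw [hCre, hre, ha]
    field_simp
    ring
  have ha_norm : ‖(1 / (a : ℂ) ^ (1 / 2 : ℂ))‖ = a ^ (-(1 / 2) : ℝ) := by
    rw [norm_div, norm_one, Complex.norm_cpow_eq_rpow_re_of_pos ha0, Real.rpow_neg ha0.le]
    norm_num
  have hbound : ‖Complex.exp C‖ * ‖∑' n : ℤ, Complex.exp (-Real.pi / (a : ℂ) *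
      (n + Complex.I * b) ^ 2)‖ ≤ Real.exp (4 * Real.pi * m * (w.im ^ 2 / t.im)) *
        ∑' n, pairTerm m t p n := by
    rw [← tsum_mul_left, ← norm_mul, ← tsum_mul_left]
    refine tsum_of_norm_bounded (hs.mul_left _).hasSum fun n => ?_
    rw [norm_mul, hnorm]
  rw [ha_norm]
  calc ‖Complex.exp C‖ * (a ^ (-(1 / 2) : ℝ) * _) = a ^ (-(1 / 2) : ℝ) * (‖Complex.exp C‖ *
        ‖∑' n : ℤ, Complex.exp (-Real.pi / (a : ℂ) * (n + Complex.I * b) ^ 2)‖) := by ring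
    _ ≤ a ^ (-(1 / 2) : ℝ) * (Real.exp (4 * Real.pi * m * (w.im ^ 2 / t.im)) *
        ∑' n, pairTerm m t p n) := by gcongr
    _ = _ := by ring

/-- The parameter of the lattice sum that bounds theta functions of index `m`. -/
def latticeParam (m : ℚ) : ℝ := Real.pi * m / (4 * (m.num : ℝ) ^ 2)

theorem latticeParam_pos {m : ℚ} (hm : 0 < m) : 0 < latticeParam m := by
  have h1 : (0 : ℝ) < m := by exact_mod_cast hm
  have h2 : (0 : ℝ) < m.num := by exact_mod_cast Rat.num_pos.2 hm
  have := Real.pi_pos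
  rw [latticeParam]
  positivity

/-- Multiplying pτ - n/(2m) by twice the numerator of m clears denominators and lands in ℤτ+ℤ.
Extending the sum to the full lattice then restores SL₂(ℤ)-invariance. -/
theorem pairTerm_eq {m : ℚ} (hm : 0 < m) (τ : ℍ) (p n : ℤ) :
    pairTerm m τ p n = Real.exp (-latticeParam m *
      (‖(((![2 * m.num * p, -(m.den : ℤ) * n] : Fin 2 → ℤ) 0 : ℤ) : ℂ) * (τ : ℂ) +
        ((![2 * m.num * p, -(m.den : ℤ) * n] : Fin 2 → ℤ) 1 : ℤ)‖ ^ 2 / τ.im)) := by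
  have h2 : (0 : ℝ) < m.num := by exact_mod_cast Rat.num_pos.2 hm
  have h2' : (m.num : ℂ) ≠ 0 := by exact_mod_cast (Rat.num_pos.2 hm).ne'
  have h3 : (m.den : ℂ) ≠ 0 := by exact_mod_cast m.den_nz
  have hmc : ((m : ℝ) : ℂ) = m.num / m.den := by
    have := Rat.num_div_den m
    rw [Complex.ofReal_ratCast]
    exact_mod_cast this.symm
  have key : (2 * (m.num : ℂ)) * ((p : ℂ) * τ - n / (2 * ((m : ℝ) : ℂ)))
      = ((2 * m.num * p : ℤ) : ℂ) * τ + ((-(m.den : ℤ) * n : ℤ) : ℂ) := by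
    rw [hmc]
    push_cast
    field_simp
    ring
  have hn : ‖((2 * m.num * p : ℤ) : ℂ) * τ + ((-(m.den : ℤ) * n : ℤ) : ℂ)‖
      = 2 * m.num * ‖(p : ℂ) * τ - n / (2 * ((m : ℝ) : ℂ))‖ := by
    rw [← key, norm_mul, norm_mul]
    congr 1
    rw [Complex.norm_ofNat, Complex.norm_intCast, abs_of_pos h2]
  rw [pairTerm, latticeParam]
  congr 1
  simp only [Matrix.cons_val_zero, Matrix.cons_val_one, Matrix.cons_val_fin_one]
  rw [hn, UpperHalfPlane.coe_im]
  have := τ.im_pos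
  field_simp
  ring

theorem pair_injective {m : ℚ} (hm : 0 < m) : Function.Injective
    fun x : ℤ × ℤ => (![2 * m.num * x.1, -(m.den : ℤ) * x.2] : Fin 2 → ℤ) := by
  intro x y h
  have h2 := (Rat.num_pos.2 hm).ne'
  have h3 : (m.den : ℤ) ≠ 0 := by exact_mod_cast m.den_nz
  have e0 := congrFun h 0
  have e1 := congrFun h 1
  simp only [Matrix.cons_val_zero, Matrix.cons_val_one, Matrix.cons_val_fin_one] at e0 e1
  refine Prod.ext ?_ ?_
  · exact mul_left_cancel₀ (mul_ne_zero two_ne_zero h2) e0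
  · exact mul_left_cancel₀ (neg_ne_zero.2 h3) e1

theorem summable_pairTerm {m : ℚ} (hm : 0 < m) (τ : ℍ) :
    Summable fun x : ℤ × ℤ => pairTerm m τ x.1 x.2 := by
  simp only [pairTerm_eq hm τ]
  exact (summable_latticeTerm (latticeParam_pos hm) τ).comp_injective (pair_injective hm)

theorem tsum_pairTerm_le {m : ℚ} (hm : 0 < m) (τ : ℍ) :
    ∑' x : ℤ × ℤ, pairTerm m τ x.1 x.2 ≤ latticeSum (latticeParam m) τ := by
  simp only [pairTerm_eq hm τ]
  exact tsum_comp_le_tsum_of_inj (summable_latticeTerm (latticeParam_pos hm) τ)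
    (fun _ => (Real.exp_pos _).le) (pair_injective hm)

/-! ### Square root cancellation for vector-valued theta sums -/

section

set_option linter.unusedSectionVars false

variable {A : Type*} [AddCommGroup A]

theorem basisVec_apply_eq (γ δ : A) [Decidable (γ = δ)] :
    basisVec γ δ = if γ = δ then 1 else 0 := by
  classical
  rw [basisVec, Pi.single_apply]
  split_ifs <;> simp_all

theorem norm_basisVec_apply_le (γ δ : A) : ‖basisVec γ δ‖ ≤ 1 := by
  classical
  rw [basisVec_apply_eq]
  split_ifs <;> simp

/-- The vector `∑_l f(l) 𝔢_{lβ}`. -/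
def thetaVec (β : A) (f : ℤ → ℂ) : A → ℂ := fun γ => ∑' l : ℤ, f l * basisVec (l • β) γ

theorem summable_thetaVec (β : A) {f : ℤ → ℂ} (hf : Summable f) (γ : A) :
    Summable fun l : ℤ => f l * basisVec (l • β) γ :=
  Summable.of_norm_bounded hf.norm fun l => by
    rw [norm_mul]
    exact mul_le_of_le_one_right (norm_nonneg _) (norm_basisVec_apply_le _ _)

theorem hasSum_thetaVec (β : A) {f : ℤ → ℂ} (hf : Summable f) :
    HasSum (fun l : ℤ => f l • basisVec (l • β)) (thetaVec β f) :=
  Pi.hasSum.2 fun γ => (summable_thetaVec β hf γ).hasSum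

variable [Fintype A]

/-- The pairs `(p, l)` correspond to the pairs `(l, l - p)`. -/
def diffEquiv : ℤ × ℤ ≃ ℤ × ℤ where
  toFun x := (x.2, x.2 - x.1)
  invFun x := (x.1 - x.2, x.1)
  left_inv x := by simp
  right_inv x := by simp

/-- The condition depends only on the difference p of the pair, so on each line of constant p it is
a constant factor 0 or 1 and can be dropped after summing that line. -/
theorem norm_tsum_pairs_le {F : ℤ × ℤ → ℂ} (hF : Summable F) (P : ℤ → Prop) [DecidablePred P]
    {B : ℤ → ℝ} (hB : Summable B) (h : ∀ p, ‖∑' l : ℤ, F (l, l - p)‖ ≤ B p) :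
    ‖∑' x : ℤ × ℤ, F x * (if P (x.1 - x.2) then 1 else 0)‖ ≤ ∑' p, B p := by
  have hx : Summable fun x : ℤ × ℤ => F x * (if P (x.1 - x.2) then (1 : ℂ) else 0) := by
    refine Summable.of_norm_bounded hF.norm fun x => ?_
    rw [norm_mul]
    refine mul_le_of_le_one_right (norm_nonneg _) ?_
    split_ifs <;> simp
  rw [← diffEquiv.tsum_eq]
  rw [← diffEquiv.summable_iff] at hx
  have hx' := Summable.tsum_prod hx
  simp only [Function.comp_apply] at hx'
  rw [hx']
  refine tsum_of_norm_bounded hB.hasSum fun p => ?_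
  simp only [diffEquiv, Equiv.coe_fn_mk, sub_sub_cancel]
  rw [tsum_mul_right, norm_mul]
  refine (mul_le_of_le_one_right (norm_nonneg _) ?_).trans (h p)
  split_ifs <;> simp

theorem norm_sq_thetaVec (β : A) {f : ℤ → ℂ} (hf : Summable f) (γ : A) :
    ((‖thetaVec β f γ‖ ^ 2 : ℝ) : ℂ) = ∑' x : ℤ × ℤ,
      f x.1 * (starRingEnd ℂ) (f x.2) * (basisVec (x.1 • β) γ * basisVec (x.2 • β) γ) := by
  classical
  have h1 := (summable_thetaVec β hf γ).norm
  have h2 : Summable fun l => ‖(starRingEnd ℂ) (f l * basisVec (l • β) γ)‖ := by simpa using h1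
  push_cast
  rw [← Complex.mul_conj', thetaVec, Complex.conj_tsum,
    tsum_mul_tsum_of_summable_norm h1 h2]
  refine tsum_congr fun x => ?_
  rw [map_mul]
  have : (starRingEnd ℂ) (basisVec (x.2 • β) γ) = basisVec (x.2 • β) γ := by
    rw [basisVec_apply_eq]; split_ifs <;> simp
  rw [this]
  ring

/-- Summing over γ turns the product of two basis vectors into the condition λβ = λ'β. -/
theorem sum_normSq_thetaVec_eq [DecidableEq A] (β : A) {f : ℤ → ℂ} (hf : Summable f)
    (hprod : Summable fun x : ℤ × ℤ => f x.1 * (starRingEnd ℂ) (f x.2)) :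
    ((∑ γ, ‖thetaVec β f γ‖ ^ 2 : ℝ) : ℂ) = ∑' x : ℤ × ℤ,
      f x.1 * (starRingEnd ℂ) (f x.2) * (if (x.1 - x.2) • β = 0 then 1 else 0) := by
  have hsum : ∀ γ, Summable fun x : ℤ × ℤ =>
      f x.1 * (starRingEnd ℂ) (f x.2) * (basisVec (x.1 • β) γ * basisVec (x.2 • β) γ) := by
    intro γ
    refine Summable.of_norm_bounded hprod.norm fun x => ?_
    rw [norm_mul]
    refine mul_le_of_le_one_right (norm_nonneg _) ?_
    rw [norm_mul]
    exact mul_le_one₀ (norm_basisVec_apply_le _ _) (norm_nonneg _) (norm_basisVec_apply_le _ _)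
  rw [Complex.ofReal_sum]
  simp only [norm_sq_thetaVec β hf]
  rw [← Summable.tsum_finsetSum fun γ _ => hsum γ]
  refine tsum_congr fun x => ?_
  rw [← Finset.mul_sum]
  congr 1
  simp only [basisVec_apply_eq, sub_smul, sub_eq_zero]
  simp [eq_comm]

theorem le_of_ofReal_eq {S T : ℝ} {c : ℂ} (h : (S : ℂ) = c) (hc : ‖c‖ ≤ T) : S ≤ T := by
  subst h
  exact (le_abs_self S).trans (by simpa using hc)

theorem summable_mul_conj {f : ℤ → ℂ} (hf : Summable f) :
    Summable fun x : ℤ × ℤ => f x.1 * (starRingEnd ℂ) (f x.2) := by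
  have hn : Summable fun l => ‖f l‖ := hf.norm
  have hfc : Summable fun l => ‖(starRingEnd ℂ) (f l)‖ := by
    simp only [RCLike.norm_conj]
    exact hn
  exact summable_mul_of_summable_norm (f := f) (g := fun l => (starRingEnd ℂ) (f l)) hn hfc

theorem sum_normSq_thetaVec_le (β : A) {f : ℤ → ℂ} (hf : Summable f)
    {B : ℤ → ℝ} (hB : Summable B)
    (h : ∀ p, ‖∑' l : ℤ, f l * (starRingEnd ℂ) (f (l - p))‖ ≤ B p) :
    ∑ γ, ‖thetaVec β f γ‖ ^ 2 ≤ ∑' p, B p := by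
  classical
  exact le_of_ofReal_eq (sum_normSq_thetaVec_eq β hf (summable_mul_conj hf))
    (norm_tsum_pairs_le (summable_mul_conj hf) (fun p => p • β = 0) hB h)

theorem sum_normSq_thetaVec_thetaExp_le (β : A) {m : ℚ} (hm : 0 < m) (τ : ℍ) (w : ℂ) :
    ∑ γ, ‖thetaVec β (thetaExp m τ w) γ‖ ^ 2 ≤
      (4 * m * τ.im) ^ (-(1 / 2) : ℝ) * Real.exp (4 * Real.pi * m * (w.im ^ 2 / τ.im)) *
        latticeSum (latticeParam m) τ := by
  have hm' : (0 : ℝ) < m := by exact_mod_cast hm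
  have hs := summable_pairTerm hm τ
  refine (sum_normSq_thetaVec_le β (summable_thetaExp hm' τ.im_pos w)
    (B := fun p => (4 * m * τ.im) ^ (-(1 / 2) : ℝ) *
      Real.exp (4 * Real.pi * m * (w.im ^ 2 / τ.im)) * ∑' n, pairTerm m τ p n)
    (hs.prod.mul_left _) fun p =>
      norm_tsum_thetaExp_pair_le hm' τ.im_pos w p (hs.prod_factor p)).trans ?_
  rw [tsum_mul_left, ← hs.tsum_prod]
  have := τ.im_pos
  gcongr
  exact tsum_pairTerm_le hm τ

/-- The scalar factor of `jacobiThetaTerm`, twisted by the character `l ↦ 𝐞(lu)`. -/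
def thetaCoeff (m : ℚ) (τ : ℍ) (z : ℂ) (g : SL(2, ℤ)) (u : ℝ) (l : ℤ) : ℂ :=
  ee ((m * l ^ 2 * ((g 0 0 : ℂ) * (τ : ℂ) + (g 0 1 : ℂ)) + 2 * m * l * z
      - (g 1 0 : ℂ) * m * z ^ 2) / autFactor g τ) * ee (l * u)

/-- The quadratic part of the exponent is that of a theta series at Mτ. The twist by 𝐞(lu) is a real
translation of the elliptic variable by u/(2m), so it leaves all bounds unchanged. -/
theorem thetaCoeff_eq {m : ℚ} (hm : 0 < m) (τ : ℍ) (z : ℂ) (g : SL(2, ℤ)) (u : ℝ) (l : ℤ) :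
    thetaCoeff m τ z g u l = ee (-(m * (g 1 0 * z ^ 2 / autFactor g τ))) *
      thetaExp m (g • τ : ℍ) (z / autFactor g τ + u / (2 * m)) l := by
  have hm' : (m : ℂ) ≠ 0 := by exact_mod_cast hm.ne'
  have hj := autFactor_ne_zero g τ
  rw [thetaCoeff, thetaExp, ← ee_add, ← ee_add, coe_SL_smul]
  congr 1
  rw [Complex.ofReal_ratCast]
  field_simp
  ring

theorem summable_thetaCoeff {m : ℚ} (hm : 0 < m) (τ : ℍ) (z : ℂ) (g : SL(2, ℤ)) (u : ℝ) :
    Summable (thetaCoeff m τ z g u) := by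
  have hm' : (0 : ℝ) < m := by exact_mod_cast hm
  have : thetaCoeff m τ z g u = fun l => ee (-(m * (g 1 0 * z ^ 2 / autFactor g τ))) *
      thetaExp m (g • τ : ℍ) (z / autFactor g τ + u / (2 * m)) l :=
    funext fun l => thetaCoeff_eq hm τ z g u l
  rw [this]
  exact (summable_thetaExp hm' (g • τ).im_pos _).mul_left _

/-- This identity makes exp(-2πm(Im z)²/Im τ) times a Jacobi form of index m invariant in absolute
value, up to its weight factor. Here it cancels the prefactor 𝐞(-cmz²/(cτ+d)) against the Gaussian
growth at (Mτ, z/(cτ+d)). -/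
theorem im_sq_identity (τ : ℍ) (z : ℂ) (g : SL(2, ℤ)) :
    (z / autFactor g τ).im ^ 2 / (g • τ).im
      = z.im ^ 2 / τ.im - (g 1 0 * z ^ 2 / autFactor g τ).im := by
  have hj := autFactor_ne_zero g τ
  have hn : Complex.normSq (autFactor g τ) ≠ 0 := by simpa using hj
  have hy := τ.im_pos.ne'
  rw [SL_smul_im, ← Complex.normSq_eq_norm_sq, Complex.div_im, Complex.div_im]
  have h1 : (autFactor g τ).re = g 1 0 * τ.re + g 1 1 := by simp [autFactor]
  have h2 : (autFactor g τ).im = g 1 0 * τ.im := by simp [autFactor]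
  have h3 : ((g 1 0 : ℂ) * z ^ 2).re = g 1 0 * (z.re ^ 2 - z.im ^ 2) := by
    simp only [Complex.mul_re, sq, Complex.intCast_re, Complex.intCast_im]
    ring
  have h4 : ((g 1 0 : ℂ) * z ^ 2).im = g 1 0 * (2 * z.re * z.im) := by
    simp only [Complex.mul_im, sq, Complex.intCast_re, Complex.intCast_im]
    ring
  have h5 : Complex.normSq (autFactor g τ)
      = (g 1 0 * τ.re + g 1 1) ^ 2 + (g 1 0 * τ.im) ^ 2 := by
    rw [Complex.normSq_apply, h1, h2]; ring
  rw [h3, h4, h1, h2]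
  generalize Complex.normSq (autFactor g τ) = N at hn h5 ⊢
  field_simp
  rw [h5]
  ring

/-- The lattice sum at Mτ equals the one at τ, so the only dependence on M left is (Im Mτ)^{-1/2} =
(Im τ)^{-1/2}|cτ+d|. -/
theorem sum_normSq_thetaVec_thetaCoeff_le (β : A) {m : ℚ} (hm : 0 < m) (τ : ℍ) (z : ℂ)
    (g : SL(2, ℤ)) (u : ℝ) :
    ∑ γ, ‖thetaVec β (thetaCoeff m τ z g u) γ‖ ^ 2 ≤
      (4 * m * τ.im) ^ (-(1 / 2) : ℝ) * ‖autFactor g τ‖ *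
        Real.exp (4 * Real.pi * m * (z.im ^ 2 / τ.im)) * latticeSum (latticeParam m) τ := by
  have hm' : (0 : ℝ) < m := by exact_mod_cast hm
  have hy := τ.im_pos
  have hj := norm_pos_iff.2 (autFactor_ne_zero g τ)
  have hvec : ∀ γ, thetaVec β (thetaCoeff m τ z g u) γ
      = ee (-(m * (g 1 0 * z ^ 2 / autFactor g τ))) *
        thetaVec β (thetaExp m (g • τ : ℍ) (z / autFactor g τ + u / (2 * m))) γ := by
    intro γ
    rw [thetaVec, thetaVec, ← tsum_mul_left]
    refine tsum_congr fun l => ?_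
    rw [thetaCoeff_eq hm, mul_assoc]
  simp only [hvec, norm_mul, mul_pow, ← Finset.mul_sum]
  refine (mul_le_mul_of_nonneg_left (sum_normSq_thetaVec_thetaExp_le β hm (g • τ) _)
    (sq_nonneg _)).trans (le_of_eq ?_)
  have him : (z / autFactor g τ + u / (2 * m)).im = (z / autFactor g τ).im := by
    have : (u / (2 * m) : ℂ) = ((u / (2 * m) : ℝ) : ℂ) := by push_cast; rfl
    rw [this, Complex.add_im, Complex.ofReal_im, add_zero]
  have hee : ‖ee (-(m * (g 1 0 * z ^ 2 / autFactor g τ)))‖ ^ 2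
      = Real.exp (4 * Real.pi * m * (g 1 0 * z ^ 2 / autFactor g τ).im) := by
    rw [norm_ee, ← Real.exp_nat_mul]
    congr 1
    have : (m : ℂ) = ((m : ℝ) : ℂ) := by push_cast; rfl
    rw [Complex.neg_im, this, Complex.im_ofReal_mul]
    push_cast
    ring
  have hpow : (4 * m * (g • τ).im : ℝ) ^ (-(1 / 2) : ℝ)
      = (4 * m * τ.im) ^ (-(1 / 2) : ℝ) * ‖autFactor g τ‖ := by
    rw [SL_smul_im, ← mul_div_assoc, Real.div_rpow (by positivity) (by positivity),
      ← Real.rpow_natCast, ← Real.rpow_mul hj.le]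
    norm_num
    rw [Real.rpow_neg_one, div_inv_eq_mul]
  rw [him, hee, latticeSum_smul, im_sq_identity, hpow, mul_sub, Real.exp_sub]
  have := Real.exp_pos (4 * Real.pi * m * (g 1 0 * z ^ 2 / autFactor g τ).im)
  field_simp

/-- Square root cancellation in theta sums, uniformly on vertical strips. -/
theorem exists_norm_thetaVec_le (β : A) {m : ℚ} (hm : 0 < m) (X : ℝ) {Y : ℝ} (hY : 0 < Y) :
    ∃ C, 0 ≤ C ∧ ∀ τ ∈ UpperHalfPlane.verticalStrip X Y, ∀ (z : ℂ) (g : SL(2, ℤ)) (u : ℝ),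
      Real.sqrt (∑ γ, ‖thetaVec β (thetaCoeff m τ z g u) γ‖ ^ 2) ≤
        C * (1 + τ.im) * ‖autFactor g τ‖ ^ (1 / 2 : ℝ) *
          Real.exp (2 * Real.pi * m * (z.im ^ 2 / τ.im)) := by
  have hm' : (0 : ℝ) < m := by exact_mod_cast hm
  obtain ⟨C, hC, hle⟩ := exists_latticeSum_le (latticeParam_pos hm) X hY
  refine ⟨Real.sqrt ((4 * m * Y) ^ (-(1 / 2) : ℝ) * C), Real.sqrt_nonneg _,
    fun τ hτ z g u => ?_⟩
  have hy := τ.im_pos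
  rw [Real.sqrt_le_left (by positivity)]
  refine (sum_normSq_thetaVec_thetaCoeff_le β hm τ z g u).trans ?_
  rw [mul_pow, mul_pow, mul_pow, Real.sq_sqrt (by positivity), ← Real.exp_nat_mul,
    ← Real.rpow_natCast (‖autFactor g τ‖ ^ (1 / 2 : ℝ)), ← Real.rpow_mul (norm_nonneg _)]
  have h1 : (4 * m * τ.im : ℝ) ^ (-(1 / 2) : ℝ) ≤ (4 * m * Y) ^ (-(1 / 2) : ℝ) := by
    apply Real.rpow_le_rpow_of_nonpos (by positivity) _ (by norm_num)
    have := hτ.2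
    gcongr
  have h2 : Real.exp (4 * Real.pi * m * (z.im ^ 2 / τ.im))
      = Real.exp ((2 : ℕ) * (2 * Real.pi * m * (z.im ^ 2 / τ.im))) := by
    congr 1; push_cast; ring
  have h3 : ‖autFactor g τ‖ ^ ((1 / 2 : ℝ) * ((2 : ℕ) : ℝ)) = ‖autFactor g τ‖ := by norm_num
  rw [h3, h2]
  calc _ ≤ (4 * m * Y : ℝ) ^ (-(1 / 2) : ℝ) * ‖autFactor g τ‖ *
        Real.exp ((2 : ℕ) * (2 * Real.pi * m * (z.im ^ 2 / τ.im))) * (C * (1 + τ.im) ^ 2) := by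
        gcongr
        · exact latticeSum_nonneg _ _
        · exact hle τ hτ
    _ = _ := by ring

end

/-! ### Convergence of the Jacobi Eisenstein and Poincaré series -/

section

set_option linter.unusedSectionVars false

variable {A : Type*} [AddCommGroup A] [Fintype A] {Q : QuadraticMap ℤ A (AddCircle (1 : ℚ))}

theorem thetaCoeff_zero (m : ℚ) (τ : ℍ) (z : ℂ) (g : SL(2, ℤ)) (l : ℤ) :
    thetaCoeff m τ z g 0 l = ee ((m * l ^ 2 * ((g 0 0 : ℂ) * (τ : ℂ) + (g 0 1 : ℂ)) + 2 * m * l * z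
      - (g 1 0 : ℂ) * m * z ^ 2) / autFactor g τ) := by
  rw [thetaCoeff, Complex.ofReal_zero, mul_zero, ee_zero, mul_one]

theorem hasSum_end_thetaVec (L : Module.End ℂ (A → ℂ)) (β : A) {f : ℤ → ℂ} (hf : Summable f) :
    HasSum (fun l : ℤ => f l • L (basisVec (l • β))) (L (thetaVec β f)) := by
  have h := (hasSum_thetaVec β hf).mapL (LinearMap.toContinuousLinearMap L)
  simpa using h

theorem hasSum_jacobiThetaTerm (Q : QuadraticMap ℤ A (AddCircle (1 : ℚ))) {m : ℚ} (hm : 0 < m)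
    (β : A) (τ : ℍ) (z : ℂ) (g : SL(2, ℤ)) :
    HasSum (jacobiThetaTerm Q m β τ z g)
      (dualWeil Q (Mp2Z.lift g)⁻¹ (thetaVec β (thetaCoeff m τ z g 0))) := by
  have h := hasSum_end_thetaVec (dualWeil Q (Mp2Z.lift g)⁻¹) β (summable_thetaCoeff hm τ z g 0)
  simp only [thetaCoeff_zero] at h ⊢
  exact h

theorem jacobiEisensteinTerm_eq (Q : QuadraticMap ℤ A (AddCircle (1 : ℚ))) (k : ℝ) {m : ℚ}
    (hm : 0 < m) (β : A) (τ : ℍ) (z : ℂ) (p : {p : ℤ × ℤ // IsCoprime p.1 p.2}) :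
    jacobiEisensteinTerm Q k m β τ z p = (autFactor (rowRep p) τ ^ (-k : ℂ)) •
      dualWeil Q (Mp2Z.lift (rowRep p))⁻¹ (thetaVec β (thetaCoeff m τ z (rowRep p) 0)) := by
  rw [jacobiEisensteinTerm, (hasSum_jacobiThetaTerm Q hm β τ z _).tsum_eq]

theorem rowRep_apply_zero (p : {p : ℤ × ℤ // IsCoprime p.1 p.2}) : rowRep p 1 0 = p.1.1 :=
  (exists_bottomRow p).choose_spec.1

theorem rowRep_apply_one (p : {p : ℤ × ℤ // IsCoprime p.1 p.2}) : rowRep p 1 1 = p.1.2 :=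
  (exists_bottomRow p).choose_spec.2

/-- The bottom row `(c, d)` as a vector. -/
def rowVec (p : {p : ℤ × ℤ // IsCoprime p.1 p.2}) : Fin 2 → ℤ := ![p.1.1, p.1.2]

theorem rowVec_injective : Function.Injective rowVec := by
  intro p q h
  refine Subtype.ext (Prod.ext ?_ ?_)
  · exact congrFun h 0
  · exact congrFun h 1

theorem autFactor_rowRep (p : {p : ℤ × ℤ // IsCoprime p.1 p.2}) (τ : ℍ) :
    autFactor (rowRep p) τ = (rowVec p 0 : ℂ) * τ + rowVec p 1 := by
  rw [autFactor, rowRep_apply_zero, rowRep_apply_one]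
  rfl

theorem summable_rowVec {s : ℝ} (hs : 2 < s) :
    Summable fun p : {p : ℤ × ℤ // IsCoprime p.1 p.2} => ‖rowVec p‖ ^ (-s) :=
  (EisensteinSeries.summable_one_div_norm_rpow hs).comp_injective rowVec_injective

theorem norm_autFactor_rpow_le {s : ℝ} (hs : 0 ≤ s) {X Y : ℝ} (hY : 0 < Y) {τ : ℍ}
    (hτ : τ ∈ UpperHalfPlane.verticalStrip X Y) (p : {p : ℤ × ℤ // IsCoprime p.1 p.2}) :
    ‖autFactor (rowRep p) τ‖ ^ (-s) ≤
      EisensteinSeries.r ⟨⟨X, Y⟩, hY⟩ ^ (-s) * ‖rowVec p‖ ^ (-s) := by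
  rw [autFactor_rowRep]
  exact EisensteinSeries.summand_bound_of_mem_verticalStrip hs (rowVec p) hY hτ

theorem norm_cpow_neg_real (w : ℂ) (k : ℝ) : ‖w ^ (-k : ℂ)‖ = ‖w‖ ^ (-k) := by
  rw [← Complex.ofReal_neg, Complex.norm_cpow_real]

/-- Locally uniform bound for the summands of the Jacobi Eisenstein series. -/
theorem exists_norm_jacobiEisensteinTerm_le (hQ : IsNondegenerate Q)
    (hsig : ∃ n : ℤ, sig Q = n) {k : ℝ} (hk : 5 / 2 < k) {m : ℚ} (hm : 0 < m) (β : A) (X : ℝ)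
    {Y : ℝ} (hY : 0 < Y) :
    ∃ b : {p : ℤ × ℤ // IsCoprime p.1 p.2} → ℝ, (∀ p, 0 ≤ b p) ∧ Summable b ∧
      ∀ τ ∈ UpperHalfPlane.verticalStrip X Y, ∀ (z : ℂ) (p),
        ‖jacobiEisensteinTerm Q k m β τ z p‖ ≤
          b p * ((1 + τ.im) * Real.exp (2 * Real.pi * m * (z.im ^ 2 / τ.im))) := by
  obtain ⟨C, hC, hle⟩ := exists_norm_thetaVec_le β hm X hY
  have hr := EisensteinSeries.r_pos ⟨⟨X, Y⟩, hY⟩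
  -- The theta factor costs |cτ+d|^{1/2}, so the sum over (c,d) converges for k - 1/2 > 2.
  refine ⟨fun p => C * (EisensteinSeries.r ⟨⟨X, Y⟩, hY⟩ ^ (-(k - 1 / 2)) *
    ‖rowVec p‖ ^ (-(k - 1 / 2))), fun p => by positivity,
    ((summable_rowVec (by linarith)).mul_left _).mul_left _, fun τ hτ z p => ?_⟩
  have hj := norm_pos_iff.2 (autFactor_ne_zero (rowRep p) τ)
  have hy := τ.im_pos
  rw [jacobiEisensteinTerm_eq Q k hm, norm_smul, norm_cpow_neg_real]
  calc _ ≤ ‖autFactor (rowRep p) τ‖ ^ (-k) * (C * (1 + τ.im) *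
        ‖autFactor (rowRep p) τ‖ ^ (1 / 2 : ℝ) *
          Real.exp (2 * Real.pi * m * (z.im ^ 2 / τ.im))) := by
        gcongr
        exact (norm_dualWeil_le hQ hsig _ _).trans (hle τ hτ z _ 0)
    _ = C * ‖autFactor (rowRep p) τ‖ ^ (-(k - 1 / 2)) *
        ((1 + τ.im) * Real.exp (2 * Real.pi * m * (z.im ^ 2 / τ.im))) := by
        rw [show -(k - 1 / 2) = -k + 1 / 2 by ring, Real.rpow_add hj]
        ring
    _ ≤ _ := mul_le_mul_of_nonneg_right (mul_le_mul_of_nonneg_left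
        (norm_autFactor_rpow_le (by linarith : 0 ≤ k - 1 / 2) hY hτ p) hC) (by positivity)

theorem summable_jacobiEisensteinTerm (hQ : IsNondegenerate Q) (hsig : ∃ n : ℤ, sig Q = n) {k : ℝ}
    (hk : 5 / 2 < k) {m : ℚ} (hm : 0 < m) (β : A) (τ : ℍ) (z : ℂ) :
    Summable (jacobiEisensteinTerm Q k m β τ z) := by
  obtain ⟨b, -, hb, hle⟩ := exists_norm_jacobiEisensteinTerm_le hQ hsig hk hm β |τ.re| τ.im_pos
  exact Summable.of_norm_bounded (hb.mul_right _) (hle τ (mem_verticalStrip_self τ) z)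

theorem exists_norm_jacobiEisenstein_le (hQ : IsNondegenerate Q) (hsig : ∃ n : ℤ, sig Q = n)
    {k : ℝ} (hk : 5 / 2 < k) {m : ℚ} (hm : 0 < m) (β : A) (X : ℝ) {Y : ℝ} (hY : 0 < Y) :
    ∃ C, 0 ≤ C ∧ ∀ τ ∈ UpperHalfPlane.verticalStrip X Y, ∀ z : ℂ,
      ‖jacobiEisenstein Q k m β τ z‖ ≤
        C * ((1 + τ.im) * Real.exp (2 * Real.pi * m * (z.im ^ 2 / τ.im))) := by
  obtain ⟨b, hb0, hb, hle⟩ := exists_norm_jacobiEisensteinTerm_le hQ hsig hk hm β X hY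
  refine ⟨∑' p, b p, tsum_nonneg hb0, fun τ hτ z => ?_⟩
  have hy := τ.im_pos
  rw [jacobiEisenstein, norm_smul, ← tsum_mul_right]
  refine le_trans (mul_le_of_le_one_left (norm_nonneg _) (by norm_num)) ?_
  exact tsum_of_norm_bounded (hb.mul_right _).hasSum (hle τ hτ z)

theorem norm_dualWeil_le_sqrt_card (hQ : IsNondegenerate Q) (hsig : ∃ n : ℤ, sig Q = n) (x : Mp2Z)
    (v : A → ℂ) : ‖dualWeil Q x v‖ ≤ Real.sqrt (Fintype.card A) * ‖v‖ := by
  refine (norm_dualWeil_le hQ hsig x v).trans ?_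
  rw [Real.sqrt_le_left (by positivity), mul_pow, Real.sq_sqrt (by positivity)]
  calc ∑ γ, ‖v γ‖ ^ 2 ≤ ∑ _γ : A, ‖v‖ ^ 2 :=
        Finset.sum_le_sum fun γ _ => by gcongr; exact norm_le_pi_norm v γ
    _ = _ := by simp

theorem norm_basisVec_le (γ : A) : ‖basisVec γ‖ ≤ 1 :=
  (pi_norm_le_iff_of_nonneg zero_le_one).2 fun δ => norm_basisVec_apply_le γ δ

theorem summable_poincareTerm (hQ : IsNondegenerate Q) (hsig : ∃ n : ℤ, sig Q = n) {k : ℝ}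
    (hk : 2 < k) {φ : ℍ → A → ℂ} {C : ℝ} (hφ : ∀ τ, ‖φ τ‖ ≤ C) (τ : ℍ) :
    Summable (poincareTerm Q k φ τ) := by
  have hr := EisensteinSeries.r_pos ⟨⟨|τ.re|, τ.im⟩, τ.im_pos⟩
  refine Summable.of_norm_bounded (((summable_rowVec hk).mul_left
    (EisensteinSeries.r ⟨⟨|τ.re|, τ.im⟩, τ.im_pos⟩ ^ (-k))).mul_right
    (Real.sqrt (Fintype.card A) * C)) fun p => ?_
  rw [poincareTerm, norm_smul, norm_cpow_neg_real]
  have h1 := norm_autFactor_rpow_le (by linarith : 0 ≤ k) τ.im_pos (mem_verticalStrip_self τ) p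
  have h2 : ‖dualWeil Q (Mp2Z.lift (rowRep p))⁻¹ (φ (rowRep p • τ))‖
      ≤ Real.sqrt (Fintype.card A) * C :=
    (norm_dualWeil_le_sqrt_card hQ hsig _ _).trans (by gcongr; exact hφ _)
  gcongr

theorem antisymm_sign {k : ℝ} (h : IsAntisymmetricWeight Q k) :
    (-1 : ℂ) ^ ((k + sig Q / 2 : ℝ) : ℂ) = -1 := by
  obtain ⟨-, j, hj, hjk⟩ := h
  rw [hjk, Complex.ofReal_intCast, Complex.cpow_intCast, hj.neg_one_zpow]

theorem norm_ee_mul_le_one {n : ℝ} (hn : 0 ≤ n) (τ : ℍ) : ‖ee (n * τ)‖ ≤ 1 := by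
  rw [norm_ee, Complex.im_ofReal_mul, UpperHalfPlane.coe_im, Real.exp_le_one_iff]
  have := τ.im_pos
  have := Real.pi_pos
  have : 0 ≤ 2 * Real.pi * (n * τ.im) := by positivity
  linarith

theorem norm_expSeed_le {k : ℝ} (h : IsAntisymmetricWeight Q k) {n : ℚ} (hn : 0 ≤ n) (γ : A)
    (τ : ℍ) : ‖expSeed Q k n γ τ‖ ≤ 1 := by
  have hn' : (0 : ℝ) ≤ n := by exact_mod_cast hn
  have h1 := norm_ee_mul_le_one hn' τ
  rw [Complex.ofReal_ratCast] at h1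
  rw [expSeed, antisymm_sign h, norm_smul, norm_div, Complex.norm_ofNat]
  have h2 : ‖basisVec γ + (-1 : ℂ) • basisVec (-γ)‖ ≤ 2 := by
    refine (norm_add_le _ _).trans ?_
    rw [norm_smul, norm_neg, norm_one, one_mul]
    linarith [norm_basisVec_le γ, norm_basisVec_le (-γ)]
  calc _ ≤ 1 / 2 * (2 : ℝ) := by gcongr
    _ = 1 := by norm_num

/-! ### Holomorphy of the summands -/

theorem eqz_out (x : AddCircle (1 : ℚ)) : ∃ q : ℚ, (q : AddCircle (1 : ℚ)) = x :=
  QuotientAddGroup.mk_surjective x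

theorem basisVec_eq_sum (hQ : IsNondegenerate Q) (γ δ : A) :
    basisVec γ δ = (Fintype.card A : ℂ)⁻¹ * ∑ ε, eqz (bil Q (γ - δ) ε) := by
  classical
  have hn := card_ne_zero' A
  rw [sum_eqz_bil hQ, basisVec_apply_eq]
  simp only [sub_eq_zero]
  split_ifs
  · rw [inv_mul_cancel₀ hn]
  · simp

/-- The condition λβ = γ is detected by averaging over the characters of A. Each component is thus a
finite combination of translated Jacobi theta functions, whose joint holomorphy is known. -/
theorem thetaVec_thetaExp_eq (hQ : IsNondegenerate Q) {m : ℝ} (hm : 0 < m) (β γ : A)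
    (q : A → ℚ) (hq : ∀ ε, (q ε : AddCircle (1 : ℚ)) = bil Q β ε) {t : ℂ} (ht : 0 < t.im) (w : ℂ) :
    thetaVec β (thetaExp m t w) γ = (Fintype.card A : ℂ)⁻¹ *
      ∑ ε, eqz (-bil Q γ ε) * jacobiTheta₂ (2 * m * w + q ε) (2 * m * t) := by
  have ht2 : 0 < (2 * m * t : ℂ).im := by
    have : (2 * (m : ℂ) * t) = ((2 * m : ℝ) : ℂ) * t := by push_cast; ring
    rw [this, Complex.im_ofReal_mul]
    positivity
  have hs : ∀ ε, HasSum (fun l : ℤ => eqz (-bil Q γ ε) *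
      jacobiTheta₂_term l (2 * m * w + q ε) (2 * m * t))
      (eqz (-bil Q γ ε) * jacobiTheta₂ (2 * m * w + q ε) (2 * m * t)) :=
    fun ε => (hasSum_jacobiTheta₂_term _ ht2).mul_left _
  refine ((hasSum_sum fun ε _ => hs ε).mul_left _).tsum_eq ▸ ?_
  rw [thetaVec]
  refine tsum_congr fun l => ?_
  rw [basisVec_eq_sum hQ, mul_left_comm, Finset.mul_sum]
  congr 1
  refine Finset.sum_congr rfl fun ε _ => ?_
  rw [thetaExp_eq, bil_sub_left, bil_zsmul_left, sub_eq_add_neg, eqz_add, eqz_zsmul, ← hq, eqz_coe,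
    ← ee_int_mul, mul_comm (ee _), mul_left_comm]
  congr 1
  rw [jacobiTheta₂_term, jacobiTheta₂_term, ee, ← Complex.exp_add]
  congr 1
  ring

theorem differentiableAt_thetaVec (hQ : IsNondegenerate Q) {m : ℝ} (hm : 0 < m) (β γ : A)
    {x : ℂ × ℂ} (hx : 0 < x.1.im) :
    DifferentiableAt ℂ (fun x : ℂ × ℂ => thetaVec β (thetaExp m x.1 x.2) γ) x := by
  choose q hq using fun ε => eqz_out (bil Q β ε)
  have hev : (fun x : ℂ × ℂ => thetaVec β (thetaExp m x.1 x.2) γ) =ᶠ[nhds x]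
      fun x => (Fintype.card A : ℂ)⁻¹ *
        ∑ ε, eqz (-bil Q γ ε) * jacobiTheta₂ (2 * m * x.2 + q ε) (2 * m * x.1) := by
    have : ∀ᶠ x' : ℂ × ℂ in nhds x, 0 < x'.1.im :=
      (isOpen_lt continuous_const (Complex.continuous_im.comp continuous_fst)).mem_nhds hx
    filter_upwards [this] with x' hx'
    exact thetaVec_thetaExp_eq hQ hm β γ q hq hx' x'.2
  refine DifferentiableAt.congr_of_eventuallyEq ?_ hev
  refine DifferentiableAt.const_mul (DifferentiableAt.fun_sum fun ε _ =>
    DifferentiableAt.const_mul ?_ _) _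
  have ht2 : 0 < (2 * m * x.1 : ℂ).im := by
    have : (2 * (m : ℂ) * x.1) = ((2 * m : ℝ) : ℂ) * x.1 := by push_cast; ring
    rw [this, Complex.im_ofReal_mul]
    positivity
  have h1 := (hasFDerivAt_jacobiTheta₂ (2 * m * x.2 + q ε) ht2).differentiableAt
  exact DifferentiableAt.comp (f := fun x : ℂ × ℂ => ((2 * m * x.2 + q ε, 2 * m * x.1) : ℂ × ℂ)) x
    h1 (by fun_prop)

/-- The summand of the Jacobi Eisenstein series as a function on `ℂ × ℂ`. -/
def jacobiFun (Q : QuadraticMap ℤ A (AddCircle (1 : ℚ))) (k : ℝ) (m : ℚ) (β : A)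
    (p : {p : ℤ × ℤ // IsCoprime p.1 p.2}) (γ : A) (x : ℂ × ℂ) : ℂ :=
  ((rowRep p 1 0 : ℂ) * x.1 + (rowRep p 1 1 : ℂ)) ^ (-k : ℂ) *
    (ee (-(m * ((rowRep p 1 0 : ℂ) * x.2 ^ 2 /
      ((rowRep p 1 0 : ℂ) * x.1 + (rowRep p 1 1 : ℂ))))) *
    ∑ δ, thetaVec β (thetaExp m
      (((rowRep p 0 0 : ℂ) * x.1 + (rowRep p 0 1 : ℂ)) /
        ((rowRep p 1 0 : ℂ) * x.1 + (rowRep p 1 1 : ℂ)))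
      (x.2 / ((rowRep p 1 0 : ℂ) * x.1 + (rowRep p 1 1 : ℂ)))) δ *
      dualWeil Q (Mp2Z.lift (rowRep p))⁻¹ (basisVec δ) γ)

theorem jacobiEisensteinTerm_apply (Q : QuadraticMap ℤ A (AddCircle (1 : ℚ))) (k : ℝ) {m : ℚ}
    (hm : 0 < m) (β : A) (τ : ℍ) (z : ℂ) (p : {p : ℤ × ℤ // IsCoprime p.1 p.2}) (γ : A) :
    jacobiEisensteinTerm Q k m β τ z p γ = jacobiFun Q k m β p γ (τ, z) := by
  have hvec : thetaVec β (thetaCoeff m τ z (rowRep p) 0)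
      = ee (-(m * (rowRep p 1 0 * z ^ 2 / autFactor (rowRep p) τ))) •
        thetaVec β (thetaExp m (rowRep p • τ : ℍ) (z / autFactor (rowRep p) τ)) := by
    funext δ
    rw [Pi.smul_apply, smul_eq_mul, thetaVec, thetaVec, ← tsum_mul_left]
    refine tsum_congr fun l => ?_
    rw [thetaCoeff_eq hm, mul_assoc, Complex.ofReal_zero, zero_div, add_zero]
  rw [jacobiEisensteinTerm_eq Q k hm, hvec, jacobiFun, map_smul, Pi.smul_apply, Pi.smul_apply,
    smul_eq_mul, smul_eq_mul, coe_SL_smul]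
  congr 2
  conv_lhs => rw [eq_sum_basisVec (thetaVec β _), map_sum, Finset.sum_apply]
  refine Finset.sum_congr rfl fun δ _ => ?_
  rw [map_smul, Pi.smul_apply, smul_eq_mul]
  rfl

theorem differentiableAt_jacobiFun (hQ : IsNondegenerate Q) (k : ℝ) {m : ℚ} (hm : 0 < m) (β : A)
    (p : {p : ℤ × ℤ // IsCoprime p.1 p.2}) (γ : A) {x : ℂ × ℂ} (hx : 0 < x.1.im) :
    DifferentiableAt ℂ (jacobiFun Q k m β p γ) x := by
  have hm' : (0 : ℝ) < m := by exact_mod_cast hm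
  have hj : (rowRep p 1 0 : ℂ) * x.1 + (rowRep p 1 1 : ℂ) ≠ 0 :=
    autFactor_ne_zero (rowRep p) ⟨x.1, hx⟩
  have hjd : DifferentiableAt ℂ
      (fun x : ℂ × ℂ => (rowRep p 1 0 : ℂ) * x.1 + (rowRep p 1 1 : ℂ)) x := by fun_prop
  have hpow : DifferentiableAt ℂ
      (fun x : ℂ × ℂ => ((rowRep p 1 0 : ℂ) * x.1 + (rowRep p 1 1 : ℂ)) ^ (-k : ℂ)) x := by
    -- For c = 0 the base is the constant ±1, possibly on the branch cut; for c ≠ 0 it stays off the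
    -- real axis.
    by_cases hc : rowRep p 1 0 = 0
    · simp only [hc, Int.cast_zero, zero_mul]
      exact differentiableAt_const _
    · refine hjd.cpow_const (Or.inr ?_)
      have : ((rowRep p 1 0 : ℂ) * x.1 + (rowRep p 1 1 : ℂ)).im = (rowRep p 1 0 : ℝ) * x.1.im := by
        simp
      rw [this]
      exact mul_ne_zero (by exact_mod_cast hc) hx.ne'
  refine hpow.mul (DifferentiableAt.mul ?_ (DifferentiableAt.fun_sum fun δ _ =>
    DifferentiableAt.mul_const ?_ _))
  · unfold ee
    fun_prop (disch := exact hj)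
  · have him : 0 < (((rowRep p 0 0 : ℂ) * x.1 + (rowRep p 0 1 : ℂ)) /
        ((rowRep p 1 0 : ℂ) * x.1 + (rowRep p 1 1 : ℂ))).im := by
      have := (rowRep p • (⟨x.1, hx⟩ : ℍ)).im_pos
      rwa [← UpperHalfPlane.coe_im, coe_SL_smul] at this
    refine DifferentiableAt.comp (g := fun y : ℂ × ℂ => thetaVec β (thetaExp m y.1 y.2) δ)
      (f := fun x : ℂ × ℂ => ((((rowRep p 0 0 : ℂ) * x.1 + (rowRep p 0 1 : ℂ)) /
        ((rowRep p 1 0 : ℂ) * x.1 + (rowRep p 1 1 : ℂ)),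
        x.2 / ((rowRep p 1 0 : ℂ) * x.1 + (rowRep p 1 1 : ℂ))) : ℂ × ℂ)) x
      (differentiableAt_thetaVec hQ hm' β δ him) ?_
    fun_prop (disch := exact hj)

end

section

set_option linter.unusedSectionVars false

variable {A : Type*} [AddCommGroup A] [Fintype A] {Q : QuadraticMap ℤ A (AddCircle (1 : ℚ))}

theorem end_map_tsum (L : Module.End ℂ (A → ℂ)) {ι : Type*} {f : ι → A → ℂ} (hf : Summable f) :
    L (∑' i, f i) = ∑' i, L (f i) :=
  (LinearMap.toContinuousLinearMap L).map_tsum hf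

/-! ### Periodicity -/

/-- Each (c,d)-summand is quasi-periodic by itself, after shifting its summation index by c. -/
theorem jacobiEisenstein_add_one (hQ : IsNondegenerate Q) (hsig : ∃ n : ℤ, sig Q = n) {k : ℝ}
    (hk : 5 / 2 < k) {m : ℚ} (hm : 0 < m) {β : A} (hmβ : (m : AddCircle (1 : ℚ)) = -Q β) (τ : ℍ)
    (z : ℂ) : jacobiEisenstein Q k m β τ (z + 1)
      = diagEnd (fun γ => eqz (-bil Q γ β)) (jacobiEisenstein Q k m β τ z) := by
  rw [jacobiEisenstein, jacobiEisenstein, map_smul,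
    end_map_tsum _ (summable_jacobiEisensteinTerm hQ hsig hk hm β τ z)]
  congr 1
  refine tsum_congr fun p => ?_
  rw [jacobiEisensteinTerm, jacobiEisensteinTerm, map_smul,
    end_map_tsum _ (hasSum_jacobiThetaTerm Q hm β τ z _).summable]
  congr 1
  rw [← (Equiv.addRight (rowRep p 1 0)).tsum_eq]
  exact tsum_congr fun l => jacobiThetaTerm_add_one hQ hsig hmβ τ z (rowRep p) l

/-- The summand of the Jacobi Eisenstein series that belongs to a matrix. -/
def jacobiSummand (Q : QuadraticMap ℤ A (AddCircle (1 : ℚ))) (k : ℝ) (m : ℚ) (β : A)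
    (τ : ℍ) (z : ℂ) (g : SL(2, ℤ)) : A → ℂ :=
  (autFactor g τ ^ (-k : ℂ)) • ∑' l : ℤ, jacobiThetaTerm Q m β τ z g l

theorem jacobiSummand_T_mul (hQ : IsNondegenerate Q) (hsig : ∃ n : ℤ, sig Q = n) (k : ℝ)
    {m : ℚ} {β : A} (hmβ : (m : AddCircle (1 : ℚ)) = -Q β) (τ : ℍ) (z : ℂ) (g : SL(2, ℤ)) :
    jacobiSummand Q k m β τ z (ModularGroup.T * g) = jacobiSummand Q k m β τ z g := by
  have haut : autFactor (ModularGroup.T * g) τ = autFactor g τ := by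
    rw [autFactor, autFactor, ModularGroup.T_mul_apply_one]
  rw [jacobiSummand, jacobiSummand, haut]
  congr 1
  exact tsum_congr fun l => jacobiThetaTerm_T_mul hQ hsig hmβ τ z g l

theorem jacobiSummand_T_zpow_mul (hQ : IsNondegenerate Q) (hsig : ∃ n : ℤ, sig Q = n) (k : ℝ)
    {m : ℚ} {β : A} (hmβ : (m : AddCircle (1 : ℚ)) = -Q β) (τ : ℍ) (z : ℂ) (n : ℤ)
    (g : SL(2, ℤ)) :
    jacobiSummand Q k m β τ z (ModularGroup.T ^ n * g) = jacobiSummand Q k m β τ z g := by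
  induction n with
  | zero => simp
  | succ n ih =>
    rw [add_comm, zpow_one_add, mul_assoc, jacobiSummand_T_mul hQ hsig k hmβ, ih]
  | pred n ih =>
    rw [← ih, ← jacobiSummand_T_mul hQ hsig k hmβ τ z (ModularGroup.T ^ (-(n : ℤ) - 1) * g),
      ← mul_assoc, ← zpow_one_add]
    congr 3
    ring

theorem exists_eq_T_zpow_mul {g h : SL(2, ℤ)} (h0 : g 1 0 = h 1 0) (h1 : g 1 1 = h 1 1) :
    ∃ n : ℤ, g = ModularGroup.T ^ n * h := by
  have hg := Matrix.SpecialLinearGroup.det_coe g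
  have hh := Matrix.SpecialLinearGroup.det_coe h
  rw [Matrix.det_fin_two] at hg hh
  rw [h0, h1] at hg
  refine ⟨g 0 1 * h 0 0 - g 0 0 * h 0 1, ?_⟩
  apply Subtype.ext
  rw [Matrix.SpecialLinearGroup.coe_mul, ModularGroup.coe_T_zpow]
  ext i j
  fin_cases i <;> fin_cases j
  · simp [Matrix.mul_apply]
    linear_combination h 0 0 * hg - g 0 0 * hh
  · simp [Matrix.mul_apply]
    linear_combination h 0 1 * hg - g 0 1 * hh
  · simp [Matrix.mul_apply, h0]
  · simp [Matrix.mul_apply, h1]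

/-- The action of `T` on bottom rows. -/
def rowShift : {p : ℤ × ℤ // IsCoprime p.1 p.2} ≃ {p : ℤ × ℤ // IsCoprime p.1 p.2} where
  toFun p := ⟨(p.1.1, p.1.1 + p.1.2), by simpa [add_comm] using p.2.add_mul_left_right 1⟩
  invFun p := ⟨(p.1.1, p.1.2 - p.1.1), by
    simpa [sub_eq_add_neg] using p.2.add_mul_left_right (-1)⟩
  left_inv p := by simp
  right_inv p := by simp

/-- Replacing τ by τ+1 replaces M by MT and hence permutes the bottom rows by (c,d) ↦ (c,c+d). The
chosen representatives need not match, but they differ by a left power of T, which does not change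
the summand. -/
theorem jacobiEisenstein_T_smul (hQ : IsNondegenerate Q) (hsig : ∃ n : ℤ, sig Q = n) {k : ℝ}
    (hk : 5 / 2 < k) {m : ℚ} (hm : 0 < m) {β : A} (hmβ : (m : AddCircle (1 : ℚ)) = -Q β) (τ : ℍ)
    (z : ℂ) : jacobiEisenstein Q k m β (ModularGroup.T • τ) z
      = diagEnd (fun γ => eqz (-Q γ)) (jacobiEisenstein Q k m β τ z) := by
  rw [jacobiEisenstein, jacobiEisenstein, map_smul,
    end_map_tsum _ (summable_jacobiEisensteinTerm hQ hsig hk hm β τ z)]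
  congr 1
  rw [← rowShift.tsum_eq fun p => diagEnd _ (jacobiEisensteinTerm Q k m β τ z p)]
  refine tsum_congr fun p => ?_
  have hrow0 : (rowRep p * ModularGroup.T) 1 0 = rowRep (rowShift p) 1 0 := by
    rw [Matrix.SpecialLinearGroup.coe_mul, ModularGroup.coe_T, rowRep_apply_zero]
    simp [Matrix.mul_apply, rowRep_apply_zero, rowShift]
  have hrow1 : (rowRep p * ModularGroup.T) 1 1 = rowRep (rowShift p) 1 1 := by
    rw [Matrix.SpecialLinearGroup.coe_mul, ModularGroup.coe_T, rowRep_apply_one]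
    simp [Matrix.mul_apply, rowRep_apply_zero, rowRep_apply_one, rowShift]
  obtain ⟨n, hn⟩ := exists_eq_T_zpow_mul hrow0 hrow1
  have h1 : jacobiEisensteinTerm Q k m β τ z (rowShift p)
      = jacobiSummand Q k m β τ z (rowRep p * ModularGroup.T) := by
    rw [hn, jacobiSummand_T_zpow_mul hQ hsig k hmβ]
    rfl
  rw [h1, ← dualWeil_T hQ hsig, jacobiSummand, map_smul,
    end_map_tsum _ (hasSum_jacobiThetaTerm Q hm β τ z _).summable, jacobiEisensteinTerm,
    autFactor_mul_T]
  congr 1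
  exact tsum_congr fun l => jacobiThetaTerm_T_smul τ z (rowRep p) l

/-! ### The Jacobi Eisenstein series as a function on `ℂ × ℂ` -/

/-- The components of the Jacobi Eisenstein series as functions on `ℂ × ℂ`. -/
def eisFun (Q : QuadraticMap ℤ A (AddCircle (1 : ℚ))) (k : ℝ) (m : ℚ) (β : A) (γ : A)
    (x : ℂ × ℂ) : ℂ :=
  (1 / 2 : ℂ) * ∑' p, jacobiFun Q k m β p γ x

theorem jacobiEisenstein_apply (hQ : IsNondegenerate Q) (hsig : ∃ n : ℤ, sig Q = n) {k : ℝ}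
    (hk : 5 / 2 < k) {m : ℚ} (hm : 0 < m) (β : A) (τ : ℍ) (z : ℂ) (γ : A) :
    jacobiEisenstein Q k m β τ z γ = eisFun Q k m β γ (τ, z) := by
  rw [jacobiEisenstein, Pi.smul_apply, smul_eq_mul,
    tsum_apply (summable_jacobiEisensteinTerm hQ hsig hk hm β τ z), eisFun]
  congr 1
  exact tsum_congr fun p => jacobiEisensteinTerm_apply Q k hm β τ z p γ

/-- The strip bound, made uniform near a point by also bounding Im τ from above and |Im z|; it gives
holomorphy and continuity of the series. -/
theorem exists_local_bound (hQ : IsNondegenerate Q) (hsig : ∃ n : ℤ, sig Q = n) {k : ℝ}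
    (hk : 5 / 2 < k) {m : ℚ} (hm : 0 < m) (β γ : A) {x : ℂ × ℂ} (hx : 0 < x.1.im) :
    ∃ N : Set (ℂ × ℂ), IsOpen N ∧ x ∈ N ∧ (∀ y ∈ N, 0 < y.1.im) ∧
      ∃ u : {p : ℤ × ℤ // IsCoprime p.1 p.2} → ℝ, Summable u ∧
        ∀ p, ∀ y ∈ N, ‖jacobiFun Q k m β p γ y‖ ≤ u p := by
  have hm' : (0 : ℝ) < m := by exact_mod_cast hm
  obtain ⟨b, hb0, hb, hle⟩ := exists_norm_jacobiEisensteinTerm_le hQ hsig hk hm β (|x.1.re| + 1)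
    (half_pos hx)
  set V := |x.2.im| + 1
  refine ⟨{y | |y.1.re| < |x.1.re| + 1 ∧ x.1.im / 2 < y.1.im ∧ y.1.im < x.1.im + 1 ∧
    |y.2.im| < V}, ?_, ?_, ?_, fun p => b p * ((1 + (x.1.im + 1)) *
      Real.exp (2 * Real.pi * m * (V ^ 2 / (x.1.im / 2)))), hb.mul_right _, ?_⟩
  · have c1 : Continuous fun y : ℂ × ℂ => |y.1.re| :=
      (Complex.continuous_re.comp continuous_fst).abs
    have c2 : Continuous fun y : ℂ × ℂ => y.1.im := Complex.continuous_im.comp continuous_fst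
    have c3 : Continuous fun y : ℂ × ℂ => |y.2.im| :=
      (Complex.continuous_im.comp continuous_snd).abs
    exact (isOpen_lt c1 continuous_const).inter ((isOpen_lt continuous_const c2).inter
      ((isOpen_lt c2 continuous_const).inter (isOpen_lt c3 continuous_const)))
  · exact ⟨by linarith, by linarith, by linarith, by simp [V]⟩
  · rintro y ⟨-, hy, -⟩
    linarith
  · rintro p y ⟨h1, h2, h3, h4⟩
    have hy : 0 < y.1.im := by linarith
    have h := hle ⟨y.1, hy⟩ ⟨h1.le, h2.le⟩ y.2 p
    refine (le_trans ?_ h).trans (mul_le_mul_of_nonneg_left ?_ (hb0 p))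
    · have := jacobiEisensteinTerm_apply Q k hm β ⟨y.1, hy⟩ y.2 p γ
      change _ = jacobiFun Q k m β p γ y at this
      rw [← this]
      exact norm_le_pi_norm _ γ
    · have hyim : (⟨y.1, hy⟩ : ℍ).im = y.1.im := rfl
      rw [hyim]
      have hsq : y.2.im ^ 2 ≤ V ^ 2 := by
        rw [← sq_abs]
        gcongr
      gcongr

theorem differentiableAt_eisFun_comp (hQ : IsNondegenerate Q) (hsig : ∃ n : ℤ, sig Q = n) {k : ℝ}
    (hk : 5 / 2 < k) {m : ℚ} (hm : 0 < m) (β γ : A) {c : ℂ → ℂ × ℂ} (hc : Differentiable ℂ c)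
    {s : ℂ} (hs : 0 < (c s).1.im) :
    DifferentiableAt ℂ (fun s => eisFun Q k m β γ (c s)) s := by
  obtain ⟨N, hN, hxN, hpos, u, hu, hle⟩ := exists_local_bound hQ hsig hk hm β γ hs
  have hopen : IsOpen (c ⁻¹' N) := hN.preimage hc.continuous
  refine DifferentiableAt.const_mul ?_ _
  refine (Complex.differentiableOn_tsum_of_summable_norm hu (fun p => ?_) hopen
    fun p w hw => hle p (c w) hw).differentiableAt (hopen.mem_nhds hxN)
  intro w hw
  exact ((differentiableAt_jacobiFun hQ k hm β p γ (hpos _ hw)).comp w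
    (hc w)).differentiableWithinAt

theorem continuousAt_eisFun (hQ : IsNondegenerate Q) (hsig : ∃ n : ℤ, sig Q = n) {k : ℝ}
    (hk : 5 / 2 < k) {m : ℚ} (hm : 0 < m) (β γ : A) {x : ℂ × ℂ} (hx : 0 < x.1.im) :
    ContinuousAt (eisFun Q k m β γ) x := by
  obtain ⟨N, hN, hxN, hpos, u, hu, hle⟩ := exists_local_bound hQ hsig hk hm β γ hx
  refine ContinuousAt.mul continuousAt_const ?_
  refine (continuousOn_tsum (fun p y hy => ?_) hu hle).continuousAt (hN.mem_nhds hxN)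
  exact (differentiableAt_jacobiFun hQ k hm β p γ (hpos y hy)).continuousAt.continuousWithinAt

theorem eisFun_add_one_left (hQ : IsNondegenerate Q) (hsig : ∃ n : ℤ, sig Q = n) {k : ℝ}
    (hk : 5 / 2 < k) {m : ℚ} (hm : 0 < m) {β : A} (hmβ : (m : AddCircle (1 : ℚ)) = -Q β) (γ : A)
    {τ : ℂ} (hτ : 0 < τ.im) (z : ℂ) :
    eisFun Q k m β γ (τ + 1, z) = eqz (-Q γ) * eisFun Q k m β γ (τ, z) := by
  have h := congrFun (jacobiEisenstein_T_smul hQ hsig hk hm hmβ ⟨τ, hτ⟩ z) γ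
  rw [jacobiEisenstein_apply hQ hsig hk hm] at h
  have hcoe : ((ModularGroup.T • (⟨τ, hτ⟩ : ℍ) : ℍ) : ℂ) = τ + 1 := by
    rw [UpperHalfPlane.modular_T_smul, UpperHalfPlane.coe_vadd]
    push_cast
    exact add_comm _ _
  rw [hcoe] at h
  rw [h]
  exact congrArg (eqz (-Q γ) * ·) (jacobiEisenstein_apply hQ hsig hk hm β ⟨τ, hτ⟩ z γ)

theorem eisFun_add_one_right (hQ : IsNondegenerate Q) (hsig : ∃ n : ℤ, sig Q = n) {k : ℝ}
    (hk : 5 / 2 < k) {m : ℚ} (hm : 0 < m) {β : A} (hmβ : (m : AddCircle (1 : ℚ)) = -Q β) (γ : A)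
    {τ : ℂ} (hτ : 0 < τ.im) (z : ℂ) :
    eisFun Q k m β γ (τ, z + 1) = eqz (-bil Q γ β) * eisFun Q k m β γ (τ, z) := by
  have h := congrFun (jacobiEisenstein_add_one hQ hsig hk hm hmβ ⟨τ, hτ⟩ z) γ
  rw [jacobiEisenstein_apply hQ hsig hk hm] at h
  exact h.trans
    (congrArg (eqz (-bil Q γ β) * ·) (jacobiEisenstein_apply hQ hsig hk hm β ⟨τ, hτ⟩ z γ))

theorem exists_norm_eisFun_le (hQ : IsNondegenerate Q) (hsig : ∃ n : ℤ, sig Q = n)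
    {k : ℝ} (hk : 5 / 2 < k) {m : ℚ} (hm : 0 < m) (β γ : A) {Y : ℝ} (hY : 0 < Y) :
    ∃ C, 0 ≤ C ∧ ∀ τ z : ℂ, |τ.re| ≤ 1 → Y ≤ τ.im → ‖eisFun Q k m β γ (τ, z)‖ ≤
        C * ((1 + τ.im) * Real.exp (2 * Real.pi * m * (z.im ^ 2 / τ.im))) := by
  obtain ⟨C, hC, hle⟩ := exists_norm_jacobiEisenstein_le hQ hsig hk hm β 1 hY
  refine ⟨C, hC, fun τ z h1 h2 => ?_⟩
  have hτ : 0 < τ.im := hY.trans_le h2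
  refine le_trans ?_ (hle ⟨τ, hτ⟩ ⟨h1, h2⟩ z)
  have := jacobiEisenstein_apply hQ hsig hk hm β ⟨τ, hτ⟩ z γ
  change _ = eisFun Q k m β γ (τ, z) at this
  rw [← this]
  exact norm_le_pi_norm _ γ

theorem differentiableAt_jacobiEisenstein (hQ : IsNondegenerate Q) (hsig : ∃ n : ℤ, sig Q = n)
    {k : ℝ} (hk : 5 / 2 < k) {m : ℚ} (hm : 0 < m) (β : A) (τ : ℍ) (z : ℂ) :
    DifferentiableAt ℂ (jacobiEisenstein Q k m β τ) z := by
  rw [differentiableAt_pi]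
  intro γ
  simp only [jacobiEisenstein_apply hQ hsig hk hm]
  exact differentiableAt_eisFun_comp hQ hsig hk hm β γ (c := fun z => ((τ : ℂ), z))
    (by fun_prop) τ.im_pos

end

/-! ### Fourier expansion of quasi-periodic functions on the line -/

/-- A base point turns `ℤ` into the coset `-α`. -/
def negCosetEquiv {α : AddCircle (1 : ℚ)} (n₀ : negCoset α) : ℤ ≃ negCoset α :=
  Equiv.ofBijective (fun j => ⟨n₀.1 + j, by
    rw [AddCircle.coe_add, n₀.2, add_eq_left, AddCircle.coe_eq_zero_iff]
    exact ⟨j, by simp⟩⟩) (by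
    constructor
    · intro i j h
      have := congrArg Subtype.val h
      simpa using this
    · rintro ⟨n, hn⟩
      have h : ((n - n₀.1 : ℚ) : AddCircle (1 : ℚ)) = 0 := by
        rw [AddCircle.coe_sub, hn, n₀.2, sub_self]
      obtain ⟨j, hj⟩ := (AddCircle.coe_eq_zero_iff (1 : ℚ)).1 h
      refine ⟨j, Subtype.ext ?_⟩
      have hj' : (j : ℚ) = n - n₀.1 := by simpa using hj
      change n₀.1 + (j : ℚ) = n
      rw [hj']
      ring)

theorem coe_negCosetEquiv {α : AddCircle (1 : ℚ)} (n₀ : negCoset α) (j : ℤ) :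
    (negCosetEquiv n₀ j : ℚ) = n₀.1 + j := rfl

instance nonempty_negCoset (α : AddCircle (1 : ℚ)) : Nonempty (negCoset α) := by
  obtain ⟨x, hx⟩ := QuotientAddGroup.mk_surjective (-α)
  exact ⟨⟨x, hx⟩⟩

theorem eqz_neg_eq_ee {α : AddCircle (1 : ℚ)} (n : negCoset α) : eqz (-α) = ee (n : ℚ) := by
  rw [← eqz_coe, n.2]

theorem continuous_ee : Continuous ee := by
  unfold ee
  fun_prop

theorem hasSum_fourier_of_quasiperiodic {α : AddCircle (1 : ℚ)} {f : ℝ → ℂ} (hf : Continuous f)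
    (hper : ∀ x, f (x + 1) = eqz (-α) * f x)
    (hsum : Summable fun n : negCoset α => ∫ x in (0 : ℝ)..1, f x * ee (-((n : ℚ) * x))) (x : ℝ) :
    HasSum (fun n : negCoset α => (∫ x in (0 : ℝ)..1, f x * ee (-((n : ℚ) * x))) *
      ee ((n : ℚ) * x)) (f x) := by
  obtain ⟨n₀⟩ := nonempty_negCoset α
  -- Dividing by a character with the same multiplier makes the function 1-periodic, so classical
  -- Fourier series apply.
  set g : ℝ → ℂ := fun x => ee (-((n₀ : ℚ) * x)) * f x with hg
  have hgper : Function.Periodic g 1 := fun x => by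
    simp only [hg]
    rw [hper, eqz_neg_eq_ee n₀]
    push_cast
    rw [mul_add, neg_add, ee_add, mul_one, ee_neg (n₀ : ℚ)]
    field_simp [ee_ne_zero]
  have hgc : Continuous g := by
    have := continuous_ee
    simp only [hg]
    fun_prop
  have : Fact (0 < (1 : ℝ)) := ⟨one_pos⟩
  let G : C(AddCircle (1 : ℝ), ℂ) :=
    ⟨hgper.lift, continuous_coinduced_dom.mpr hgc⟩
  have hG : ∀ x : ℝ, G x = g x := fun x => hgper.lift_coe x
  have hcoef : ∀ j : ℤ, fourierCoeff G j =
      ∫ x in (0 : ℝ)..1, f x * ee (-((negCosetEquiv n₀ j : ℚ) * x)) := fun j => by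
    rw [fourierCoeff_eq_intervalIntegral G j 0, zero_add, div_one, one_smul]
    refine intervalIntegral.integral_congr fun x _ => ?_
    rw [hG, fourier_coe_apply, coe_negCosetEquiv]
    simp only [hg, smul_eq_mul]
    push_cast
    rw [add_mul, neg_add, ee_add, ee.eq_1 (-(j * x))]
    ring_nf
  have hS : Summable (fourierCoeff G) := by
    have h := (negCosetEquiv n₀).summable_iff.2 hsum
    exact h.congr fun j => (hcoef j).symm
  have h := (has_pointwise_sum_fourier_series_of_summable hS (x : AddCircle (1 : ℝ))).mul_left
    (ee ((n₀ : ℚ) * x))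
  rw [hG] at h
  have hx : ee ((n₀ : ℚ) * x) * g x = f x := by
    simp only [hg]
    rw [← mul_assoc, ← ee_add, add_neg_cancel, ee_zero, one_mul]
  rw [hx] at h
  rw [← (negCosetEquiv n₀).hasSum_iff]
  refine h.congr_fun fun j => ?_
  simp only [Function.comp_apply]
  rw [hcoef, fourier_coe_apply, coe_negCosetEquiv, smul_eq_mul]
  push_cast
  rw [add_mul, ee_add, ee.eq_1 (j * x)]
  ring_nf

theorem integral_ee_int_mul (j : ℤ) :
    ∫ x in (0 : ℝ)..1, ee (j * x) = if j = 0 then 1 else 0 := by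
  split_ifs with h
  · simp [h, ee_zero]
  · have hc : (2 * (Real.pi : ℂ) * Complex.I * j) ≠ 0 := by
      simp [Real.pi_ne_zero, h, Complex.I_ne_zero]
    have := integral_exp_mul_complex (a := 0) (b := 1) hc
    have h1 : Complex.exp (2 * (Real.pi : ℂ) * Complex.I * j) = 1 := ee_int j
    simp only [ee, ← mul_assoc]
    rw [this]
    simp [h1]

theorem integral_ee_sub_mul {α : AddCircle (1 : ℚ)} (n n' : negCoset α) :
    ∫ x in (0 : ℝ)..1, ee (((n : ℚ) - (n' : ℚ)) * x) = if n = n' then 1 else 0 := by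
  obtain ⟨j, rfl⟩ := (negCosetEquiv n').surjective n
  rw [coe_negCosetEquiv]
  push_cast
  rw [add_sub_cancel_left, integral_ee_int_mul]
  have : negCosetEquiv n' j = n' ↔ j = 0 := by
    rw [Subtype.ext_iff, coe_negCosetEquiv]
    simp
  simp [this]

/-- The integral of a periodic holomorphic function over a horizontal period is constant. -/
theorem integral_horizontal_eq {f : ℂ → ℂ} {a b : ℝ}
    (hf : ∀ z : ℂ, z.im ∈ Set.uIcc a b → DifferentiableAt ℂ f z)
    (hper : ∀ z : ℂ, z.im ∈ Set.uIcc a b → f (z + 1) = f z) :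
    ∫ x in (0 : ℝ)..1, f (x + a * Complex.I) = ∫ x in (0 : ℝ)..1, f (x + b * Complex.I) := by
  have h := Complex.integral_boundary_rect_eq_zero_of_differentiableOn f (a * Complex.I)
    (1 + b * Complex.I) (fun z hz => by
      refine (hf z ?_).differentiableWithinAt
      simpa using hz.2)
  simp only [Complex.mul_re, Complex.ofReal_re, Complex.I_re, mul_zero, Complex.ofReal_im,
    Complex.I_im, mul_one, sub_self, Complex.add_re, Complex.one_re, Complex.mul_im,
    zero_add, Complex.add_im, Complex.one_im, add_zero, Complex.ofReal_one,
    Complex.ofReal_zero] at h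
  have h2 : ∫ y in a..b, f (1 + y * Complex.I) = ∫ y in a..b, f (y * Complex.I) := by
    refine intervalIntegral.integral_congr fun y hy => ?_
    rw [add_comm, hper]
    simpa using hy
  rw [h2] at h
  linear_combination h

theorem summable_exp_neg_abs_negCoset (α : AddCircle (1 : ℚ)) {c : ℝ} (hc : 0 < c) :
    Summable fun n : negCoset α => Real.exp (-c * |((n : ℚ) : ℝ)|) := by
  obtain ⟨n₀⟩ := nonempty_negCoset α
  rw [← (negCosetEquiv n₀).summable_iff]
  have h1 : Summable fun j : ℕ => Real.exp (-c * j) := by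
    have := Real.summable_exp_nat_mul_iff (a := -c) |>.2 (by linarith)
    exact this.congr fun j => by rw [mul_comm]
  have h2 : Summable fun j : ℤ => Real.exp (-c * |(j : ℝ)|) := by
    refine Summable.of_nat_of_neg (h1.congr fun j => ?_) (h1.congr fun j => ?_) <;> simp
  refine Summable.of_nonneg_of_le (fun _ => (Real.exp_pos _).le) (fun j => ?_)
    (h2.mul_left (Real.exp (c * |((n₀ : ℚ) : ℝ)|)))
  rw [Function.comp_apply, coe_negCosetEquiv, ← Real.exp_add]
  gcongr
  have h3 : |(j : ℝ)| ≤ |((n₀.1 + j : ℚ) : ℝ)| + |((n₀ : ℚ) : ℝ)| := by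
    have := abs_sub (((n₀.1 + j : ℚ) : ℝ)) ((n₀ : ℚ) : ℝ)
    push_cast at this ⊢
    simpa using this
  nlinarith

/-! ### Fourier expansion of functions of Jacobi type -/

/-- Quasi-periodic functions on `ℍ × ℂ`, holomorphic in each variable, with the growth of Jacobi
forms of index `m`. -/
structure IsJacobiType (α α' : AddCircle (1 : ℚ)) (m : ℝ) (F : ℂ × ℂ → ℂ) : Prop where
  continuousAt : ∀ x : ℂ × ℂ, 0 < x.1.im → ContinuousAt F x
  differentiableAt_left : ∀ τ z : ℂ, 0 < τ.im → DifferentiableAt ℂ (fun t => F (t, z)) τ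
  differentiableAt_right : ∀ τ z : ℂ, 0 < τ.im → DifferentiableAt ℂ (fun w => F (τ, w)) z
  add_one_left : ∀ τ z : ℂ, 0 < τ.im → F (τ + 1, z) = eqz (-α) * F (τ, z)
  add_one_right : ∀ τ z : ℂ, 0 < τ.im → F (τ, z + 1) = eqz (-α') * F (τ, z)
  bound : ∀ Y : ℝ, 0 < Y → ∃ C, 0 ≤ C ∧ ∀ τ z : ℂ, |τ.re| ≤ 1 → Y ≤ τ.im →
    ‖F (τ, z)‖ ≤ C * ((1 + τ.im) * Real.exp (2 * Real.pi * m * (z.im ^ 2 / τ.im)))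

/-- The `r`-th Fourier integral in the second variable. -/
def innerCoeff (F : ℂ × ℂ → ℂ) (r : ℚ) (v : ℝ) (τ : ℂ) : ℂ :=
  ∫ u in (0 : ℝ)..1, F (τ, u + v * Complex.I) * ee (-(r * (u + v * Complex.I)))

/-- The Fourier integral of index `(n, r)` over the torus at height `(y, v)`. -/
def doubleCoeff (F : ℂ × ℂ → ℂ) (n r : ℚ) (y v : ℝ) : ℂ :=
  ∫ x in (0 : ℝ)..1, innerCoeff F r v (x + y * Complex.I) * ee (-(n * (x + y * Complex.I)))

theorem im_add_mul_I (x y : ℝ) : ((x : ℂ) + y * Complex.I).im = y := by simp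

theorem re_add_mul_I (x y : ℝ) : ((x : ℂ) + y * Complex.I).re = x := by simp

theorem differentiable_ee : Differentiable ℂ ee := by
  unfold ee
  fun_prop

namespace IsJacobiType

variable {α α' : AddCircle (1 : ℚ)} {m : ℝ} {F : ℂ × ℂ → ℂ}

theorem continuous_torus (hF : IsJacobiType α α' m F) {y : ℝ} (hy : 0 < y) (v : ℝ) :
    Continuous fun p : ℝ × ℝ => F (p.1 + y * Complex.I, p.2 + v * Complex.I) := by
  rw [continuous_iff_continuousAt]
  intro p
  have hc : Continuous fun p : ℝ × ℝ =>
      (((p.1 : ℂ) + y * Complex.I, (p.2 : ℂ) + v * Complex.I) : ℂ × ℂ) := by fun_prop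
  exact ContinuousAt.comp (f := fun p : ℝ × ℝ =>
      (((p.1 : ℂ) + y * Complex.I, (p.2 : ℂ) + v * Complex.I) : ℂ × ℂ))
    (hF.continuousAt _ (by simpa using hy)) hc.continuousAt

theorem continuous_innerCoeff (hF : IsJacobiType α α' m F) {y : ℝ} (hy : 0 < y) (r : ℚ) (v : ℝ) :
    Continuous fun x : ℝ => innerCoeff F r v (x + y * Complex.I) := by
  have h1 := hF.continuous_torus hy v
  have h2 := continuous_ee
  exact intervalIntegral.continuous_parametric_intervalIntegral_of_continuous'
    (f := fun x u : ℝ => F (x + y * Complex.I, u + v * Complex.I) *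
      ee (-(r * (u + v * Complex.I))))
    (h1.mul (h2.comp (by fun_prop))) 0 1

theorem innerCoeff_add_one (hF : IsJacobiType α α' m F) {τ : ℂ} (hτ : 0 < τ.im) (r : ℚ) (v : ℝ) :
    innerCoeff F r v (τ + 1) = eqz (-α) * innerCoeff F r v τ := by
  rw [innerCoeff, innerCoeff, ← intervalIntegral.integral_const_mul]
  refine intervalIntegral.integral_congr fun u _ => ?_
  simp only [hF.add_one_left _ _ hτ, mul_assoc]

/-- The multiplier of F under z+1 matches that of 𝐞(rz) because r lies in the right coset. The
integrand is therefore periodic and its horizontal line of integration can be moved. -/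
theorem innerCoeff_const (hF : IsJacobiType α α' m F) {τ : ℂ} (hτ : 0 < τ.im) (r : negCoset α')
    (v v' : ℝ) : innerCoeff F r v τ = innerCoeff F r v' τ := by
  refine integral_horizontal_eq (f := fun w => F (τ, w) * ee (-((r : ℚ) * w)))
    (fun z _ => ?_) fun z _ => ?_
  · exact (hF.differentiableAt_right τ z hτ).mul
      ((differentiable_ee _).comp z (by fun_prop))
  · rw [hF.add_one_right _ _ hτ, eqz_neg_eq_ee r, mul_add, neg_add, ee_add, mul_one,
      ee_neg (r : ℚ)]
    field_simp [ee_ne_zero]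

theorem doubleCoeff_const_right (hF : IsJacobiType α α' m F) (n : ℚ) (r : negCoset α')
    {y : ℝ} (hy : 0 < y) (v v' : ℝ) : doubleCoeff F n r y v = doubleCoeff F n r y v' := by
  refine intervalIntegral.integral_congr fun x _ => ?_
  rw [hF.innerCoeff_const (by simpa using hy) r v v']

/-- With the τ-integral innermost, the contour in τ can be moved as well. -/
theorem doubleCoeff_eq_swap (hF : IsJacobiType α α' m F) (n r : ℚ) {y : ℝ} (hy : 0 < y) (v : ℝ) :
    doubleCoeff F n r y v = ∫ u in (0 : ℝ)..1, (∫ x in (0 : ℝ)..1,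
      F (x + y * Complex.I, u + v * Complex.I) * ee (-(n * (x + y * Complex.I)))) *
        ee (-(r * (u + v * Complex.I))) := by
  have h1 := hF.continuous_torus hy v
  have h2 := continuous_ee
  simp only [doubleCoeff, innerCoeff, ← intervalIntegral.integral_mul_const]
  rw [MeasureTheory.intervalIntegral_intervalIntegral_swap]
  · refine intervalIntegral.integral_congr fun u _ => ?_
    refine intervalIntegral.integral_congr fun x _ => ?_
    ring
  · have hc : Continuous (Function.uncurry fun x u : ℝ =>
        F (x + y * Complex.I, u + v * Complex.I) * ee (-(r * (u + v * Complex.I))) *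
          ee (-(n * (x + y * Complex.I)))) :=
      (h1.mul (h2.comp (by fun_prop))).mul (h2.comp (by fun_prop))
    refine (hc.continuousOn.integrableOn_compact
      ((isCompact_uIcc (a := 0) (b := 1)).prod (isCompact_uIcc (a := 0) (b := 1)))).mono_set ?_
    exact Set.prod_mono Set.uIoc_subset_uIcc Set.uIoc_subset_uIcc

theorem doubleCoeff_const_left (hF : IsJacobiType α α' m F) (n : negCoset α) (r : ℚ)
    {y y' : ℝ} (hy : 0 < y) (hy' : 0 < y') (v : ℝ) :
    doubleCoeff F n r y v = doubleCoeff F n r y' v := by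
  rw [hF.doubleCoeff_eq_swap _ _ hy, hF.doubleCoeff_eq_swap _ _ hy']
  refine intervalIntegral.integral_congr fun u _ => ?_
  congr 1
  have hpos : ∀ z : ℂ, z.im ∈ Set.uIcc y y' → 0 < z.im := fun z hz =>
    (lt_min hy hy').trans_le hz.1
  refine integral_horizontal_eq
    (f := fun t => F (t, u + v * Complex.I) * ee (-((n : ℚ) * t)))
    (fun z hz => ?_) fun z hz => ?_
  · exact (hF.differentiableAt_left z _ (hpos z hz)).mul
      ((differentiable_ee _).comp z (by fun_prop))
  · rw [hF.add_one_left _ _ (hpos z hz), eqz_neg_eq_ee n, mul_add, neg_add, ee_add, mul_one,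
      ee_neg (n : ℚ)]
    field_simp [ee_ne_zero]

theorem doubleCoeff_const (hF : IsJacobiType α α' m F) (n : negCoset α) (r : negCoset α')
    {y y' : ℝ} (hy : 0 < y) (hy' : 0 < y') (v v' : ℝ) :
    doubleCoeff F n r y v = doubleCoeff F n r y' v' :=
  (hF.doubleCoeff_const_left n r hy hy' v).trans (hF.doubleCoeff_const_right n r hy' v v')

theorem norm_ee_neg_mul (n : ℚ) (x y : ℝ) :
    ‖ee (-(n * (x + y * Complex.I)))‖ = Real.exp (2 * Real.pi * n * y) := by
  rw [norm_ee]
  simp [mul_assoc]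

theorem norm_ee_mul (n : ℚ) (z : ℂ) : ‖ee (n * z)‖ = Real.exp (-(2 * Real.pi * n * z.im)) := by
  rw [norm_ee]
  simp
  ring

theorem norm_doubleCoeff_le {C Y : ℝ} (hle : ∀ τ z : ℂ, |τ.re| ≤ 1 → Y ≤ τ.im →
    ‖F (τ, z)‖ ≤ C * ((1 + τ.im) * Real.exp (2 * Real.pi * m * (z.im ^ 2 / τ.im)))) (n r : ℚ)
    {y : ℝ} (hy : Y ≤ y) (v : ℝ) :
    ‖doubleCoeff F n r y v‖ ≤ C * ((1 + y) * Real.exp (2 * Real.pi * m * (v ^ 2 / y))) *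
      Real.exp (2 * Real.pi * r * v) * Real.exp (2 * Real.pi * n * y) := by
  have h : ∀ x ∈ Set.uIoc (0 : ℝ) 1, ‖innerCoeff F r v (x + y * Complex.I)‖ ≤
      C * ((1 + y) * Real.exp (2 * Real.pi * m * (v ^ 2 / y))) *
        Real.exp (2 * Real.pi * r * v) := fun x hx => by
    rw [Set.uIoc_of_le zero_le_one] at hx
    refine (intervalIntegral.norm_integral_le_of_norm_le_const
      (C := C * ((1 + y) * Real.exp (2 * Real.pi * m * (v ^ 2 / y))) *
        Real.exp (2 * Real.pi * r * v)) fun u _ => ?_).trans (by simp)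
    rw [norm_mul, norm_ee_neg_mul]
    have h := hle (x + y * Complex.I) (u + v * Complex.I)
      (by rw [re_add_mul_I, abs_of_pos hx.1]; exact hx.2) (by simpa using hy)
    rw [im_add_mul_I, im_add_mul_I] at h
    gcongr
  refine (intervalIntegral.norm_integral_le_of_norm_le_const
    (C := C * ((1 + y) * Real.exp (2 * Real.pi * m * (v ^ 2 / y))) *
      Real.exp (2 * Real.pi * r * v) * Real.exp (2 * Real.pi * n * y)) fun x hx => ?_).trans
    (by simp)
  rw [norm_mul, norm_ee_neg_mul]
  gcongr
  exact h x hx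

/-- The coefficient does not depend on the heights (Z, w) used to compute it, so a curve of heights
along which the bound tends to zero forces it to vanish. -/
theorem doubleCoeff_eq_zero (hF : IsJacobiType α α' m F) (hm : 0 < m) (n : negCoset α)
    (r : negCoset α') (h : 4 * m * (n : ℚ) < ((r : ℚ) : ℝ) ^ 2) {y : ℝ} (hy : 0 < y) (v : ℝ) :
    doubleCoeff F n r y v = 0 := by
  obtain ⟨C, hC, hle⟩ := hF.bound 1 one_pos
  set N : ℝ := ((n : ℚ) : ℝ)
  set R : ℝ := ((r : ℚ) : ℝ)
  set d : ℝ := 2 * Real.pi * (R ^ 2 / (4 * m) - N) with hd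
  have hdpos : 0 < d := by
    have : N < R ^ 2 / (4 * m) := by
      rw [lt_div_iff₀ (by positivity)]
      linarith
    have := Real.pi_pos
    rw [hd]
    apply mul_pos <;> linarith
  have hbound : ∀ Z : ℝ, 1 ≤ Z → ‖doubleCoeff F n r y v‖ ≤ C * ((1 + Z) * Real.exp (-d * Z)) := by
    intro Z hZ
    have hZ0 : 0 < Z := by linarith
    -- The height w = -RZ/(2m) minimizes mw²/Z + Rw, with minimum -R²Z/(4m). The bound becomes
    -- C(1+Z)exp(-dZ), with d > 0 exactly because R² > 4mN.
    rw [hF.doubleCoeff_const n r hy hZ0 v (-(R * Z / (2 * m)))]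
    refine (norm_doubleCoeff_le hle n r hZ _).trans (le_of_eq ?_)
    rw [mul_assoc, mul_assoc, mul_assoc, ← Real.exp_add, ← Real.exp_add]
    congr 3
    rw [hd]
    field_simp
    ring
  have hlim : Filter.Tendsto (fun Z : ℝ => C * ((1 + Z) * Real.exp (-d * Z))) Filter.atTop
      (nhds 0) := by
    have h1 := Real.tendsto_pow_mul_exp_neg_atTop_nhds_zero 0
    have e0 : Filter.Tendsto (fun Z : ℝ => Real.exp (-d * Z)) Filter.atTop (nhds 0) :=
      Real.tendsto_exp_atBot.comp (Filter.tendsto_id.const_mul_atTop_of_neg (by linarith))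
    have e1 : Filter.Tendsto (fun Z : ℝ => Z * Real.exp (-d * Z)) Filter.atTop (nhds 0) := by
      have := tendsto_rpow_mul_exp_neg_mul_atTop_nhds_zero 1 d hdpos
      simpa using this
    have := (e0.add e1).const_mul C
    simp only [add_zero, mul_zero] at this
    refine this.congr fun Z => by ring
  have := ge_of_tendsto hlim (Filter.eventually_atTop.2 ⟨1, hbound⟩)
  exact norm_eq_zero.1 (le_antisymm this (norm_nonneg _))

/-- Computing the coefficient at height y/2 or 3y/2 and v-1 or v+1, according to the signs of n and
r, gains the factor exp(-πy|n| - 2π|r|). Four fixed pairs of heights suffice, so one constant serves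
all (n, r). -/
theorem exists_norm_doubleCoeff_mul_le (hF : IsJacobiType α α' m F) {y : ℝ}
    (hy : 0 < y) (v : ℝ) : ∃ C, ∀ (n : negCoset α) (r : negCoset α'),
      ‖doubleCoeff F n r y v‖ * Real.exp (-(2 * Real.pi * (n : ℚ) * y)) *
        Real.exp (-(2 * Real.pi * (r : ℚ) * v)) ≤
      C * (Real.exp (-(Real.pi * y) * |((n : ℚ) : ℝ)|) *
        Real.exp (-(2 * Real.pi) * |((r : ℚ) : ℝ)|)) := by
  obtain ⟨C, hC, hle⟩ := hF.bound (y / 2) (half_pos hy)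
  set B : ℝ → ℝ → ℝ := fun Z w =>
    C * ((1 + Z) * Real.exp (2 * Real.pi * m * (w ^ 2 / Z))) with hB
  have hBpos : ∀ Z w, 0 < Z → 0 ≤ B Z w := fun Z w hZ => by simp only [hB]; positivity
  have key : ∀ (n : negCoset α) (r : negCoset α') (Z w : ℝ), y / 2 ≤ Z →
      ‖doubleCoeff F n r y v‖ * Real.exp (-(2 * Real.pi * (n : ℚ) * y)) *
        Real.exp (-(2 * Real.pi * (r : ℚ) * v)) ≤
      B Z w * (Real.exp (2 * Real.pi * (n : ℚ) * (Z - y)) *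
        Real.exp (2 * Real.pi * (r : ℚ) * (w - v))) := by
    intro n r Z w hZ
    rw [hF.doubleCoeff_const n r hy (lt_of_lt_of_le (half_pos hy) hZ) v w]
    refine (mul_le_mul_of_nonneg_right (mul_le_mul_of_nonneg_right
      (norm_doubleCoeff_le hle n r hZ w) (Real.exp_pos _).le) (Real.exp_pos _).le).trans
      (le_of_eq ?_)
    simp only [hB, mul_sub, Real.exp_sub, Real.exp_neg]
    field_simp
  have hy1 : 0 < y / 2 := half_pos hy
  have hy2 : 0 < 3 * y / 2 := by positivity
  have b1 := hBpos (y / 2) (v - 1) hy1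
  have b2 := hBpos (y / 2) (v + 1) hy1
  have b3 := hBpos (3 * y / 2) (v - 1) hy2
  have b4 := hBpos (3 * y / 2) (v + 1) hy2
  refine ⟨B (y / 2) (v - 1) + B (y / 2) (v + 1) + B (3 * y / 2) (v - 1) +
    B (3 * y / 2) (v + 1), fun n r => ?_⟩
  have hfin : ∀ Z w : ℝ, y / 2 ≤ Z → B Z w ≤ B (y / 2) (v - 1) + B (y / 2) (v + 1) +
      B (3 * y / 2) (v - 1) + B (3 * y / 2) (v + 1) →
      ((n : ℚ) : ℝ) * (Z - y) = -(y / 2) * |((n : ℚ) : ℝ)| →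
      ((r : ℚ) : ℝ) * (w - v) = - |((r : ℚ) : ℝ)| →
      ‖doubleCoeff F n r y v‖ * Real.exp (-(2 * Real.pi * (n : ℚ) * y)) *
        Real.exp (-(2 * Real.pi * (r : ℚ) * v)) ≤
      (B (y / 2) (v - 1) + B (y / 2) (v + 1) +
        B (3 * y / 2) (v - 1) + B (3 * y / 2) (v + 1)) *
        (Real.exp (-(Real.pi * y) * |((n : ℚ) : ℝ)|) *
        Real.exp (-(2 * Real.pi) * |((r : ℚ) : ℝ)|)) := by
    intro Z w hZ hBZ h1 h2
    refine (key n r Z w hZ).trans ?_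
    rw [mul_assoc (2 * Real.pi), mul_assoc (2 * Real.pi), h1, h2]
    refine mul_le_mul hBZ (le_of_eq ?_) (by positivity) (by positivity)
    congr 2 <;> ring
  rcases le_total 0 ((n : ℚ) : ℝ) with hn | hn <;> rcases le_total 0 ((r : ℚ) : ℝ) with hr | hr
  · exact hfin (y / 2) (v - 1) le_rfl (by linarith) (by rw [abs_of_nonneg hn]; ring)
      (by rw [abs_of_nonneg hr]; ring)
  · exact hfin (y / 2) (v + 1) le_rfl (by linarith) (by rw [abs_of_nonneg hn]; ring)
      (by rw [abs_of_nonpos hr]; ring)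
  · exact hfin (3 * y / 2) (v - 1) (by linarith) (by linarith) (by rw [abs_of_nonpos hn]; ring)
      (by rw [abs_of_nonneg hr]; ring)
  · exact hfin (3 * y / 2) (v + 1) (by linarith) (by linarith) (by rw [abs_of_nonpos hn]; ring)
      (by rw [abs_of_nonpos hr]; ring)

theorem summable_doubleCoeff_mul (hF : IsJacobiType α α' m F) {τ : ℂ} (hτ : 0 < τ.im) (z : ℂ) :
    Summable fun p : negCoset α × negCoset α' =>
      doubleCoeff F p.1 p.2 τ.im z.im * ee ((p.1 : ℚ) * τ) * ee ((p.2 : ℚ) * z) := by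
  obtain ⟨C, hC⟩ := hF.exists_norm_doubleCoeff_mul_le hτ z.im
  have hs := ((summable_exp_neg_abs_negCoset α (c := Real.pi * τ.im)
    (mul_pos Real.pi_pos hτ)).mul_of_nonneg (summable_exp_neg_abs_negCoset α'
      (c := 2 * Real.pi) (by positivity)) (fun _ => (Real.exp_pos _).le)
      fun _ => (Real.exp_pos _).le).mul_left C
  refine Summable.of_norm_bounded hs fun p => ?_
  rw [norm_mul, norm_mul, norm_ee_mul, norm_ee_mul]
  exact hC p.1 p.2

/-- F is expanded in z and each coefficient in τ. The one-dimensional theorem needs summable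
coefficients, and both times these come from the absolutely convergent double series. -/
theorem hasSum_doubleCoeff (hF : IsJacobiType α α' m F) {τ : ℂ} (hτ : 0 < τ.im) (z : ℂ) :
    HasSum (fun p : negCoset α × negCoset α' =>
      doubleCoeff F p.1 p.2 τ.im z.im * ee ((p.1 : ℚ) * τ) * ee ((p.2 : ℚ) * z)) (F (τ, z)) := by
  have hτeq : ((τ.re : ℂ) + τ.im * Complex.I) = τ := Complex.re_add_im τ
  have hzeq : ((z.re : ℂ) + z.im * Complex.I) = z := Complex.re_add_im z
  have hs := hF.summable_doubleCoeff_mul hτ z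
  have hs' : Summable fun p : negCoset α' × negCoset α =>
      doubleCoeff F p.2 p.1 τ.im z.im * ee ((p.2 : ℚ) * τ) * ee ((p.1 : ℚ) * z) :=
    hs.prod_symm
  have hrow : ∀ r : negCoset α', HasSum (fun n : negCoset α =>
      doubleCoeff F n r τ.im z.im * ee ((n : ℚ) * τ) * ee ((r : ℚ) * z))
      (innerCoeff F r z.im τ * ee ((r : ℚ) * z)) := by
    intro r
    refine HasSum.mul_right _ ?_
    have hcoef : ∀ n : negCoset α, ∫ x in (0 : ℝ)..1,
        innerCoeff F r z.im (x + τ.im * Complex.I) * ee (-((n : ℚ) * x))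
          = doubleCoeff F n r τ.im z.im * ee ((n : ℚ) * (τ.im * Complex.I)) := by
      intro n
      rw [doubleCoeff, ← intervalIntegral.integral_mul_const]
      refine intervalIntegral.integral_congr fun x _ => ?_
      rw [mul_assoc, ← ee_add]
      congr 2
      ring
    have h := hasSum_fourier_of_quasiperiodic (hF.continuous_innerCoeff hτ r z.im) (α := α)
      (fun x => by
        rw [← hF.innerCoeff_add_one (by simpa using hτ)]
        congr 1
        push_cast
        ring) (by
        have hfib := hs'.prod_factor r
        have h2 := (hfib.mul_right (ee ((r : ℚ) * z))⁻¹).norm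
        refine Summable.of_norm (h2.congr fun n => ?_)
        rw [hcoef, mul_inv_cancel_right₀ (ee_ne_zero _), norm_mul, norm_mul, norm_ee_mul,
          norm_ee_mul]
        simp) τ.re
    rw [hτeq] at h
    refine h.congr_fun fun n => ?_
    rw [hcoef, mul_assoc, ← ee_add]
    congr 2
    rw [← mul_add, add_comm, hτeq]
  have hcoef : ∀ r : negCoset α', ∫ u in (0 : ℝ)..1,
      F (τ, u + z.im * Complex.I) * ee (-((r : ℚ) * u))
        = innerCoeff F r z.im τ * ee ((r : ℚ) * (z.im * Complex.I)) := by
    intro r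
    rw [innerCoeff, ← intervalIntegral.integral_mul_const]
    refine intervalIntegral.integral_congr fun x _ => ?_
    rw [mul_assoc, ← ee_add]
    congr 2
    ring
  have htot := hs'.hasSum.prod_fiberwise hrow
  have h := hasSum_fourier_of_quasiperiodic (α := α')
    (f := fun u : ℝ => F (τ, u + z.im * Complex.I)) (by
      have := (hF.continuous_torus hτ z.im).comp
        (f := fun u : ℝ => ((τ.re, u) : ℝ × ℝ)) (by fun_prop)
      simpa only [Function.comp_def, hτeq] using this)
    (fun u => by
      rw [← hF.add_one_right _ _ hτ]
      push_cast
      congr 2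
      ring) (by
      refine Summable.of_norm (htot.summable.norm.congr fun r => ?_)
      rw [hcoef, norm_mul, norm_mul, norm_ee_mul, norm_ee_mul]
      simp) z.re
  rw [hzeq] at h
  have h2 : HasSum (fun r : negCoset α' => innerCoeff F r z.im τ * ee ((r : ℚ) * z))
      (F (τ, z)) := by
    refine h.congr_fun fun r => ?_
    rw [hcoef, mul_assoc, ← ee_add]
    congr 2
    rw [← mul_add, add_comm, hzeq]
  rw [← h2.unique htot |>.symm]
  exact (Equiv.prodComm (negCoset α) (negCoset α')).hasSum_iff.2 hs'.hasSum

end IsJacobiType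

theorem hasSum_intervalIntegral_of_norm_le {ι : Type*} [Countable ι] {f : ι → ℝ → ℂ} {g : ℝ → ℂ}
    {b : ι → ℝ} (hf : ∀ i, Continuous (f i)) (hb : Summable b) (hle : ∀ i t, ‖f i t‖ ≤ b i)
    (hg : ∀ t, HasSum (fun i => f i t) (g t)) :
    HasSum (fun i => ∫ t in (0 : ℝ)..1, f i t) (∫ t in (0 : ℝ)..1, g t) :=
  intervalIntegral.hasSum_integral_of_dominated_convergence (fun i _ => b i)
    (fun i => (hf i).aestronglyMeasurable) (fun i => Filter.Eventually.of_forall fun t _ => hle i t)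
    (Filter.Eventually.of_forall fun _ _ => hb) intervalIntegrable_const
    (Filter.Eventually.of_forall fun t _ => hg t)

theorem deriv_ee_mul (r : ℚ) :
    deriv (fun z : ℂ => ee (r * z)) 0 = 2 * Real.pi * Complex.I * r := by
  have h : HasDerivAt (fun z : ℂ => ee (r * z)) (2 * Real.pi * Complex.I * r) 0 := by
    have h1 : HasDerivAt (fun z : ℂ => 2 * Real.pi * Complex.I * (r * z))
        (2 * Real.pi * Complex.I * (r * 1)) 0 :=
      ((hasDerivAt_id (0 : ℂ)).const_mul _).const_mul _
    have h2 := h1.cexp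
    simpa [ee] using h2
  exact h.deriv

/-- The rational numbers in a given coset with bounded square form a finite set. -/
theorem finite_coset_sq_le (x : AddCircle (1 : ℚ)) (B : ℚ) :
    {r : ℚ | (r : AddCircle (1 : ℚ)) = -x ∧ r ^ 2 ≤ B}.Finite := by
  obtain ⟨r₀⟩ := nonempty_negCoset x
  refine ((Set.finite_Icc (⌊-(B + 1) - r₀.1⌋) (⌈B + 1 - r₀.1⌉)).image
    fun j : ℤ => r₀.1 + (j : ℚ)).subset ?_
  rintro r ⟨h1, h2⟩
  obtain ⟨j, hj⟩ := (negCosetEquiv r₀).surjective ⟨r, h1⟩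
  have hj' : r₀.1 + (j : ℚ) = r := congrArg Subtype.val hj
  refine ⟨j, ⟨?_, ?_⟩, hj'⟩
  · have : -(B + 1) - r₀.1 ≤ j := by nlinarith [sq_nonneg (r + 1)]
    exact_mod_cast (Int.floor_le _).trans this
  · have : (j : ℚ) ≤ B + 1 - r₀.1 := by nlinarith [sq_nonneg (r - 1)]
    exact_mod_cast this.trans (Int.le_ceil _)

namespace IsJacobiType

variable {α α' : AddCircle (1 : ℚ)} {m : ℝ} {F : ℂ × ℂ → ℂ} {c : ℚ → ℚ → ℂ}

/-- Uniqueness: an absolutely convergent expansion may be integrated termwise over the torus at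
height (1, 0), and orthogonality isolates one coefficient. Properties of the torus integrals thus
hold for any admissible c. -/
theorem coeff_eq_doubleCoeff
    (hc : ∀ τ z : ℂ, 0 < τ.im → HasSum (fun p : negCoset α × negCoset α' =>
      c p.1 p.2 * ee ((p.1 : ℚ) * τ) * ee ((p.2 : ℚ) * z)) (F (τ, z)))
    (n : negCoset α) (r : negCoset α') : c n r = doubleCoeff F n r 1 0 := by
  have hcont := continuous_ee
  have hcountable : Countable (negCoset α × negCoset α') := inferInstance
  have him : ∀ x : ℝ, 0 < ((x : ℂ) + (1 : ℝ) * Complex.I).im := fun x => by simp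
  have hbase := (hc ((0 : ℝ) + (1 : ℝ) * Complex.I) 0 (him 0)).summable.norm
  have hb : Summable fun p : negCoset α × negCoset α' =>
      ‖c p.1 p.2‖ * Real.exp (-(2 * Real.pi * (p.1 : ℚ))) := by
    refine hbase.congr fun p => ?_
    rw [norm_mul, norm_mul, norm_ee_mul, norm_ee_mul]
    simp
  have hin : ∀ x : ℝ, HasSum (fun p : negCoset α × negCoset α' =>
      c p.1 p.2 * ee ((p.1 : ℚ) * (x + (1 : ℝ) * Complex.I)) * (if p.2 = r then 1 else 0))
      (innerCoeff F r 0 (x + (1 : ℝ) * Complex.I)) := by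
    intro x
    have h := hasSum_intervalIntegral_of_norm_le
      (f := fun (p : negCoset α × negCoset α') (u : ℝ) =>
        c p.1 p.2 * ee ((p.1 : ℚ) * (x + (1 : ℝ) * Complex.I)) *
          ee ((p.2 : ℚ) * (u + (0 : ℝ) * Complex.I)) * ee (-((r : ℚ) * (u + (0 : ℝ) * Complex.I))))
      (g := fun u : ℝ => F (x + (1 : ℝ) * Complex.I, u + (0 : ℝ) * Complex.I) *
        ee (-((r : ℚ) * (u + (0 : ℝ) * Complex.I)))) (fun p => by fun_prop) hb
      (fun p u => by
        rw [norm_mul, norm_mul, norm_mul, norm_ee_neg_mul, norm_ee_mul, norm_ee_mul]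
        simp) (fun u => (hc _ _ (him x)).mul_right _)
    refine h.congr_fun fun p => ?_
    rw [← integral_ee_sub_mul, ← intervalIntegral.integral_const_mul]
    refine intervalIntegral.integral_congr fun u _ => ?_
    rw [mul_assoc (c _ _ * _) (ee ((p.2 : ℚ) * _)), ← ee_add]
    congr 2
    push_cast
    ring
  have hout : HasSum (fun p : negCoset α × negCoset α' =>
      c p.1 p.2 * (if p.2 = r then 1 else 0) * (if p.1 = n then 1 else 0))
      (doubleCoeff F n r 1 0) := by
    have h := hasSum_intervalIntegral_of_norm_le
      (f := fun (p : negCoset α × negCoset α') (x : ℝ) =>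
        c p.1 p.2 * ee ((p.1 : ℚ) * (x + (1 : ℝ) * Complex.I)) * (if p.2 = r then 1 else 0) *
          ee (-((n : ℚ) * (x + (1 : ℝ) * Complex.I))))
      (g := fun x : ℝ => innerCoeff F r 0 (x + (1 : ℝ) * Complex.I) *
        ee (-((n : ℚ) * (x + (1 : ℝ) * Complex.I)))) (fun p => by fun_prop)
      (hb.mul_right (Real.exp (2 * Real.pi * (n : ℚ) * 1)))
      (fun p x => by
        rw [norm_mul, norm_mul, norm_mul, norm_ee_neg_mul, norm_ee_mul]
        refine mul_le_mul_of_nonneg_right ?_ (Real.exp_pos _).le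
        rw [im_add_mul_I, mul_one]
        refine mul_le_of_le_one_right (by positivity) ?_
        split_ifs <;> simp)
      (fun x => (hin x).mul_right _)
    refine h.congr_fun fun p => ?_
    have hE : ∀ x : ℝ, ee ((p.1 : ℚ) * (x + (1 : ℝ) * Complex.I)) *
        ee (-((n : ℚ) * (x + (1 : ℝ) * Complex.I)))
        = ee (((p.1 : ℚ) - (n : ℚ)) * Complex.I) * ee (((p.1 : ℚ) - (n : ℚ)) * x) := fun x => by
      rw [← ee_add, ← ee_add]
      congr 1
      push_cast
      ring
    have hI : ∫ x in (0 : ℝ)..1, c p.1 p.2 * ee ((p.1 : ℚ) * (x + (1 : ℝ) * Complex.I)) *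
          (if p.2 = r then 1 else 0) * ee (-((n : ℚ) * (x + (1 : ℝ) * Complex.I)))
        = c p.1 p.2 * (if p.2 = r then 1 else 0) * ee (((p.1 : ℚ) - (n : ℚ)) * Complex.I) *
          (if p.1 = n then 1 else 0) := by
      rw [← integral_ee_sub_mul p.1 n, ← intervalIntegral.integral_const_mul]
      refine intervalIntegral.integral_congr fun x _ => ?_
      linear_combination (c p.1 p.2 * (if p.2 = r then 1 else 0)) * hE x
    rw [hI]
    by_cases hp : p.1 = n
    · simp [hp, ee_zero]
    · simp [hp]
  have hsingle := hasSum_single (f := fun p : negCoset α × negCoset α' =>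
      c p.1 p.2 * (if p.2 = r then 1 else 0) * (if p.1 = n then 1 else 0)) (n, r) fun p hp => by
    by_cases h1 : p.1 = n
    · have h2 : p.2 ≠ r := fun h2 => hp (Prod.ext h1 h2)
      simp [h2]
    · simp [h1]
  simpa using hsingle.unique hout

/-- An absolutely convergent expansion may be differentiated termwise at `z = 0`. -/
theorem hasSum_deriv
    (hc : ∀ τ z : ℂ, 0 < τ.im → HasSum (fun p : negCoset α × negCoset α' =>
      c p.1 p.2 * ee ((p.1 : ℚ) * τ) * ee ((p.2 : ℚ) * z)) (F (τ, z))) {τ : ℂ} (hτ : 0 < τ.im) :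
    HasSum (fun p : negCoset α × negCoset α' =>
      c p.1 p.2 * ee ((p.1 : ℚ) * τ) * deriv (fun z : ℂ => ee ((p.2 : ℚ) * z)) 0)
      (deriv (fun z => F (τ, z)) 0) := by
  have hde := differentiable_ee
  -- On |Im w| < 1 one has |𝐞(rw)| ≤ |𝐞(ri)| + |𝐞(-ri)|, so absolute convergence at z = ±i dominates
  -- the series.
  have hu := (hc τ Complex.I hτ).summable.norm.add (hc τ (-Complex.I) hτ).summable.norm
  have hopen : IsOpen {w : ℂ | |w.im| < 1} :=
    isOpen_lt (Complex.continuous_im.abs) continuous_const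
  have h := Complex.hasSum_deriv_of_summable_norm (U := {w : ℂ | |w.im| < 1}) (z := 0)
    (F := fun (p : negCoset α × negCoset α') (w : ℂ) =>
      c p.1 p.2 * ee ((p.1 : ℚ) * τ) * ee ((p.2 : ℚ) * w)) hu (fun p => by
        have : Differentiable ℂ fun w : ℂ =>
          c p.1 p.2 * ee ((p.1 : ℚ) * τ) * ee ((p.2 : ℚ) * w) := by fun_prop
        exact this.differentiableOn) hopen (fun p w hw => by
        rw [norm_mul _ (ee ((p.2 : ℚ) * w)), norm_mul _ (ee ((p.2 : ℚ) * Complex.I)),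
          norm_mul _ (ee ((p.2 : ℚ) * -Complex.I)), ← mul_add]
        refine mul_le_mul_of_nonneg_left ?_ (norm_nonneg _)
        rw [norm_ee_mul, norm_ee_mul, norm_ee_mul]
        have hw' := abs_lt.1 (show |w.im| < 1 from hw)
        have hpi := Real.pi_pos
        simp only [Complex.I_im, Complex.neg_im]
        rcases le_total 0 (((p.2 : ℚ)) : ℝ) with h0 | h0
        · refine le_add_of_nonneg_of_le (Real.exp_pos _).le (Real.exp_le_exp.2 ?_)
          have := mul_nonneg (mul_nonneg hpi.le h0) (by linarith [hw'.1] : 0 ≤ w.im + 1)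
          linarith
        · refine le_add_of_le_of_nonneg (Real.exp_le_exp.2 ?_) (Real.exp_pos _).le
          have := mul_nonneg (mul_nonneg hpi.le (neg_nonneg.2 h0))
            (by linarith [hw'.2] : 0 ≤ 1 - w.im)
          linarith) (by simp)
  have hF : (fun w => ∑' p : negCoset α × negCoset α',
      c p.1 p.2 * ee ((p.1 : ℚ) * τ) * ee ((p.2 : ℚ) * w)) = fun w => F (τ, w) :=
    funext fun w => (hc τ w hτ).tsum_eq
  rw [hF] at h
  refine h.congr_fun fun p => ?_
  rw [deriv_const_mul _ (by fun_prop)]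

end IsJacobiType

/-- Collecting the terms with equal `n` in a double expansion supported on `r² ≤ 4mn`. -/
theorem hasSum_collect {α α' : AddCircle (1 : ℚ)} {m : ℚ} {c : ℚ → ℚ → ℂ} {κ S : ℂ} {e : ℚ → ℂ}
    (hvan : ∀ (n : negCoset α) (r : negCoset α'), 4 * m * n.1 < r.1 ^ 2 → c n r = 0)
    (h : HasSum (fun p : negCoset α × negCoset α' =>
      κ * (c p.1 p.2 * e p.1 * ((p.2 : ℚ) : ℂ))) S) :
    HasSum (fun n : negCoset α => κ *
      (∑ᶠ r ∈ {r : ℚ | (r : AddCircle (1 : ℚ)) = -α' ∧ r ^ 2 ≤ 4 * m * n}, (r : ℂ) * c n r) *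
        e n) S := by
  refine h.prod_fiberwise fun n => ?_
  have hfin := finite_coset_sq_le α' (4 * m * n)
  rw [finsum_mem_eq_finite_toFinset_sum _ hfin, Finset.mul_sum, Finset.sum_mul]
  -- The sum over the coset is viewed as a sum over ℚ of an indicator; its support lies in the
  -- finite set r² ≤ 4mn.
  have hs := hasSum_sum_of_ne_finset_zero (L := SummationFilter.unconditional ℚ)
    (f := Set.indicator {r : ℚ | (r : AddCircle (1 : ℚ)) = -α'} fun r : ℚ =>
      κ * (c n r * e n * (r : ℂ))) (s := hfin.toFinset) fun r hr => by
    rw [Set.Finite.mem_toFinset] at hr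
    by_cases hr1 : (r : AddCircle (1 : ℚ)) = -α'
    · have hlt : 4 * m * n.1 < r ^ 2 := by
        by_contra hle
        exact hr ⟨hr1, not_lt.1 hle⟩
      have := hvan n ⟨r, hr1⟩ hlt
      simp [this]
    · exact Set.indicator_of_notMem (s := {r : ℚ | (r : AddCircle (1 : ℚ)) = -α'}) hr1 _
  have heq : ∑ r ∈ hfin.toFinset, Set.indicator {r : ℚ | (r : AddCircle (1 : ℚ)) = -α'}
      (fun r : ℚ => κ * (c n r * e n * (r : ℂ))) r
      = ∑ r ∈ hfin.toFinset, κ * ((r : ℂ) * c n r) * e n := by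
    refine Finset.sum_congr rfl fun r hr => ?_
    rw [Set.Finite.mem_toFinset] at hr
    rw [Set.indicator_of_mem (s := {r : ℚ | (r : AddCircle (1 : ℚ)) = -α'}) hr.1]
    ring
  rw [heq] at hs
  exact hasSum_subtype_iff_indicator.2 hs

/-! ### The derivative of the theta series -/

theorem norm_thetaExp {m : ℝ} (t w : ℂ) (l : ℤ) : ‖thetaExp m t w l‖ =
    Real.exp (-(2 * Real.pi * m * (l ^ 2 * t.im + 2 * l * w.im))) := by
  have h : ((m : ℂ) * l ^ 2 * t + 2 * m * l * w).im = m * (l ^ 2 * t.im + 2 * l * w.im) := by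
    have : ((m : ℂ) * l ^ 2 * t + 2 * m * l * w)
        = ((m * l ^ 2 : ℝ) : ℂ) * t + ((2 * m * l : ℝ) : ℂ) * w := by push_cast; ring
    rw [this, Complex.add_im, Complex.im_ofReal_mul, Complex.im_ofReal_mul]
    ring
  rw [thetaExp, norm_ee, h]
  congr 1
  ring

theorem norm_thetaExp_le_add {m : ℝ} (hm : 0 < m) (t : ℂ) {w w₀ : ℂ} (hw : |(w - w₀).im| < 1)
    (l : ℤ) : ‖thetaExp m t w l‖ ≤
      ‖thetaExp m t (w₀ + Complex.I) l‖ + ‖thetaExp m t (w₀ - Complex.I) l‖ := by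
  rw [norm_thetaExp, norm_thetaExp, norm_thetaExp]
  have hw' := abs_lt.1 hw
  rw [Complex.sub_im] at hw'
  have hpi : 0 < 4 * Real.pi * m := by have := Real.pi_pos; positivity
  simp only [Complex.add_im, Complex.sub_im, Complex.I_im]
  rcases le_total 0 (l : ℝ) with h0 | h0
  · refine le_add_of_nonneg_of_le (Real.exp_pos _).le (Real.exp_le_exp.2 ?_)
    have := mul_nonneg (mul_nonneg hpi.le h0) (by linarith [hw'.1] : 0 ≤ w.im - w₀.im + 1)
    linarith
  · refine le_add_of_le_of_nonneg (Real.exp_le_exp.2 ?_) (Real.exp_pos _).le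
    have := mul_nonneg (mul_nonneg hpi.le (neg_nonneg.2 h0))
      (by linarith [hw'.2] : 0 ≤ 1 - (w.im - w₀.im))
    linarith

theorem hasDerivAt_thetaExp (m : ℝ) (t w : ℂ) (l : ℤ) :
    HasDerivAt (fun w => thetaExp m t w l)
      (4 * Real.pi * Complex.I * m * (l * thetaExp m t w l)) w := by
  have h1 : HasDerivAt (fun w : ℂ => 2 * Real.pi * Complex.I * (m * l ^ 2 * t + 2 * m * l * w))
      (2 * Real.pi * Complex.I * (2 * m * l * 1)) w :=
    (((hasDerivAt_id w).const_mul _).const_add _).const_mul _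
  refine h1.cexp.congr_deriv ?_
  rw [thetaExp, ee]
  ring

/-- Termwise differentiation, dominated near w₀ by the terms at w₀ ± i. The bounded weights b stand
for the components of 𝔢_{lβ}. -/
theorem hasDerivAt_tsum_mul_thetaExp {m : ℝ} (hm : 0 < m) {t : ℂ} (ht : 0 < t.im) {b : ℤ → ℂ}
    (hb : ∀ l, ‖b l‖ ≤ 1) (w₀ : ℂ) :
    Summable (fun l : ℤ => l * thetaExp m t w₀ l * b l) ∧
    HasDerivAt (fun w => ∑' l : ℤ, thetaExp m t w l * b l)
      (4 * Real.pi * Complex.I * m * ∑' l : ℤ, l * thetaExp m t w₀ l * b l) w₀ := by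
  have hu : Summable fun l : ℤ =>
      ‖thetaExp m t (w₀ + Complex.I) l‖ + ‖thetaExp m t (w₀ - Complex.I) l‖ :=
    (summable_thetaExp hm ht _).norm.add (summable_thetaExp hm ht _).norm
  have hopen : IsOpen {w : ℂ | |(w - w₀).im| < 1} :=
    isOpen_lt (Complex.continuous_im.comp (continuous_id.sub continuous_const)).abs
      continuous_const
  have hmem : w₀ ∈ {w : ℂ | |(w - w₀).im| < 1} := by simp
  have hd : ∀ (l : ℤ) (w : ℂ), HasDerivAt (fun w => thetaExp m t w l * b l)
      (4 * Real.pi * Complex.I * m * (l * thetaExp m t w l) * b l) w :=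
    fun l w => (hasDerivAt_thetaExp m t w l).mul_const _
  have hdo : ∀ l : ℤ, DifferentiableOn ℂ (fun w => thetaExp m t w l * b l)
      {w : ℂ | |(w - w₀).im| < 1} := fun l w _ =>
    (hd l w).differentiableAt.differentiableWithinAt
  have hle : ∀ (l : ℤ) (w : ℂ), w ∈ {w : ℂ | |(w - w₀).im| < 1} → ‖thetaExp m t w l * b l‖ ≤
      ‖thetaExp m t (w₀ + Complex.I) l‖ + ‖thetaExp m t (w₀ - Complex.I) l‖ := fun l w hw => by
    rw [norm_mul]
    exact (mul_le_of_le_one_right (norm_nonneg _) (hb l)).trans (norm_thetaExp_le_add hm t hw l)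
  have hdiff := (Complex.differentiableOn_tsum_of_summable_norm hu hdo hopen hle).differentiableAt
    (hopen.mem_nhds hmem)
  have hsum := Complex.hasSum_deriv_of_summable_norm hu hdo hopen hle hmem
  have hc : (4 * (Real.pi : ℂ) * Complex.I * m) ≠ 0 := by
    simp [Real.pi_ne_zero, hm.ne', Complex.I_ne_zero]
  have hs : Summable (fun l : ℤ => l * thetaExp m t w₀ l * b l) := by
    have := (hsum.summable.mul_left (4 * (Real.pi : ℂ) * Complex.I * m)⁻¹)
    refine this.congr fun l => ?_
    rw [(hd l w₀).deriv, mul_assoc (4 * (Real.pi : ℂ) * Complex.I * m), inv_mul_cancel_left₀ hc]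
  refine ⟨hs, hdiff.hasDerivAt.congr_deriv ?_⟩
  rw [← hsum.tsum_eq, ← tsum_mul_left]
  refine tsum_congr fun l => ?_
  rw [(hd l w₀).deriv]
  ring

theorem summable_moment {m : ℝ} (hm : 0 < m) {t : ℂ} (ht : 0 < t.im) (w : ℂ) :
    Summable fun l : ℤ => l * thetaExp m t w l := by
  have h := (hasDerivAt_tsum_mul_thetaExp hm ht (b := fun _ => 1) (by simp) w).1
  simpa using h

theorem hasDerivAt_thetaVec {A : Type*} [AddCommGroup A] {m : ℝ} (hm : 0 < m) (β γ : A) {t : ℂ}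
    (ht : 0 < t.im) (w : ℂ) : HasDerivAt (fun w => thetaVec β (thetaExp m t w) γ)
      (4 * Real.pi * Complex.I * m * thetaVec β (fun l : ℤ => l * thetaExp m t w l) γ) w :=
  (hasDerivAt_tsum_mul_thetaExp hm ht
    (fun l => norm_basisVec_apply_le (l • β) γ) w).2

/-- Since |cτ+d| is bounded below uniformly in M, constants can be absorbed into positive powers of
it. -/
theorem le_norm_autFactor (g : SL(2, ℤ)) (τ : ℍ) : min 1 τ.im ≤ ‖autFactor g τ‖ := by
  by_cases hc : g 1 0 = 0
  · have hdet := Matrix.SpecialLinearGroup.det_coe g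
    rw [Matrix.det_fin_two, hc, mul_zero, sub_zero] at hdet
    have hd : IsUnit (g 1 1) := IsUnit.of_mul_eq_one_right _ hdet
    have : ‖autFactor g τ‖ = 1 := by
      rw [autFactor, hc]
      rcases Int.isUnit_iff.1 hd with h | h <;> simp [h]
    rw [this]
    exact min_le_left _ _
  · refine (min_le_right _ _).trans ?_
    have him : (autFactor g τ).im = (g 1 0 : ℝ) * τ.im := by simp [autFactor]
    refine le_trans ?_ (Complex.abs_im_le_norm _)
    rw [him, abs_mul, abs_of_pos τ.im_pos]
    refine le_mul_of_one_le_left τ.im_pos.le ?_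
    rw [← Int.cast_abs]
    exact_mod_cast Int.one_le_abs hc

theorem norm_lower_entry_div_le (g : SL(2, ℤ)) (τ : ℍ) :
    ‖(g 1 0 : ℂ) / autFactor g τ‖ ≤ 1 / τ.im := by
  rw [norm_div, div_le_div_iff₀ (norm_pos_iff.2 (autFactor_ne_zero g τ)) τ.im_pos, one_mul]
  have him : (autFactor g τ).im = (g 1 0 : ℝ) * τ.im := by simp [autFactor]
  refine le_trans (le_of_eq ?_) (Complex.abs_im_le_norm _)
  rw [him, abs_mul, abs_of_pos τ.im_pos, Complex.norm_intCast]

/-- The first moments of the theta series grow at most like `|cτ + d|^{3/2}`. -/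
theorem exists_norm_moment_le {A : Type*} [AddCommGroup A] [Fintype A] (β : A) {m : ℚ}
    (hm : 0 < m) (τ : ℍ) :
    ∃ C, 0 ≤ C ∧ ∀ (g : SL(2, ℤ)) (u : ℝ) (γ : A),
      ‖thetaVec β (fun l : ℤ => l * thetaExp m (g • τ : ℍ) (u / (2 * m)) l) γ‖ ≤
        C * ‖autFactor g τ‖ ^ (3 / 2 : ℝ) := by
  have hm' : (0 : ℝ) < m := by exact_mod_cast hm
  have hy := τ.im_pos
  have hpi := Real.pi_pos
  obtain ⟨C, hC, hle⟩ := exists_norm_thetaVec_le β hm |τ.re| τ.im_pos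
  set E := Real.exp (2 * Real.pi * m * (1 / τ.im)) with hE
  refine ⟨(4 * Real.pi * m)⁻¹ * (E * (C * (1 + τ.im) * E)), by positivity, fun g u γ => ?_⟩
  have hj := autFactor_ne_zero g τ
  have hD : 0 < ‖autFactor g τ‖ := norm_pos_iff.2 hj
  have ht : 0 < ((g • τ : ℍ) : ℂ).im := (g • τ).im_pos
  -- The circle has radius 1/|cτ+d|, so that z = (w - u/(2m))(cτ+d) has modulus 1 and the theta
  -- bound at (τ, z) holds with constants independent of M.
  have hsphere : ∀ w ∈ Metric.sphere ((u : ℂ) / (2 * m)) (‖autFactor g τ‖⁻¹),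
      ‖thetaVec β (thetaExp m (g • τ : ℍ) w) γ‖ ≤
        E * (C * (1 + τ.im) * E) * ‖autFactor g τ‖ ^ (1 / 2 : ℝ) := by
    intro w hw
    set z := (w - u / (2 * m)) * autFactor g τ with hz
    have hz1 : ‖z‖ = 1 := by
      rw [hz, norm_mul, mem_sphere_iff_norm.1 hw, inv_mul_cancel₀ hD.ne']
    have hw2 : w = z / autFactor g τ + u / (2 * m) := by
      rw [hz]
      field_simp
      ring
    have hvec : thetaVec β (thetaExp m (g • τ : ℍ) w) γ
        = ee (m * (g 1 0 * z ^ 2 / autFactor g τ)) * thetaVec β (thetaCoeff m τ z g u) γ := by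
      rw [thetaVec, thetaVec, ← tsum_mul_left]
      refine tsum_congr fun l => ?_
      rw [thetaCoeff_eq hm, hw2, ← mul_assoc, ← mul_assoc, ← ee_add, add_neg_cancel, ee_zero,
        one_mul]
    rw [hvec, norm_mul]
    have h1 : ‖ee (m * (g 1 0 * z ^ 2 / autFactor g τ))‖ ≤ E := by
      rw [norm_ee, hE, Real.exp_le_exp]
      have h2 : |((m : ℂ) * (g 1 0 * z ^ 2 / autFactor g τ)).im| ≤ m * (1 / τ.im) := by
        refine (Complex.abs_im_le_norm _).trans ?_
        have h3 : (m : ℂ) * (g 1 0 * z ^ 2 / autFactor g τ)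
            = ((m : ℝ) : ℂ) * (g 1 0 / autFactor g τ) * z ^ 2 := by push_cast; ring
        rw [h3, norm_mul, norm_pow, hz1, one_pow, mul_one, norm_mul, Complex.norm_real,
          Real.norm_of_nonneg hm'.le]
        exact mul_le_mul_of_nonneg_left (norm_lower_entry_div_le g τ) hm'.le
      have h3 := mul_le_mul_of_nonneg_left ((neg_le_abs _).trans h2) hpi.le
      linarith
    have h2 : ‖thetaVec β (thetaCoeff m τ z g u) γ‖ ≤
        C * (1 + τ.im) * ‖autFactor g τ‖ ^ (1 / 2 : ℝ) * E := by
      refine le_trans ?_ ((hle τ (mem_verticalStrip_self τ) z g u).trans ?_)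
      · refine Real.le_sqrt_of_sq_le ?_
        exact Finset.single_le_sum (f := fun γ => ‖thetaVec β (thetaCoeff m τ z g u) γ‖ ^ 2)
          (fun _ _ => by positivity) (Finset.mem_univ γ)
      · have hz2 : z.im ^ 2 ≤ 1 := by
          have := Complex.abs_im_le_norm z
          rw [hz1] at this
          exact (sq_le_one_iff_abs_le_one _).2 this
        rw [hE]
        gcongr
    calc _ ≤ E * (C * (1 + τ.im) * ‖autFactor g τ‖ ^ (1 / 2 : ℝ) * E) := by gcongr
      _ = _ := by ring
  have hdiff : Differentiable ℂ fun w => thetaVec β (thetaExp m (g • τ : ℍ) w) γ :=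
    fun w => (hasDerivAt_thetaVec hm' β γ ht w).differentiableAt
  -- Cauchy's estimate divides by the radius, which turns the exponent 1/2 into 3/2.
  have hcauchy := Complex.norm_deriv_le_of_forall_mem_sphere_norm_le (inv_pos.2 hD)
    hdiff.diffContOnCl hsphere
  rw [(hasDerivAt_thetaVec hm' β γ ht _).deriv, div_inv_eq_mul, norm_mul] at hcauchy
  have hnorm : ‖(4 * (Real.pi : ℂ) * Complex.I * (m : ℝ))‖ = 4 * Real.pi * m := by
    rw [norm_mul, norm_mul, norm_mul, Complex.norm_I, Complex.norm_real, Complex.norm_real,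
      Real.norm_of_nonneg hpi.le, Real.norm_of_nonneg hm'.le]
    simp
  rw [hnorm] at hcauchy
  have hpow : ‖autFactor g τ‖ ^ (3 / 2 : ℝ)
      = ‖autFactor g τ‖ ^ (1 / 2 : ℝ) * ‖autFactor g τ‖ := by
    rw [show (3 / 2 : ℝ) = 1 / 2 + 1 by norm_num, Real.rpow_add hD, Real.rpow_one]
  rw [hpow, mul_assoc (4 * Real.pi * (m : ℝ))⁻¹, ← mul_assoc (E * _), ← div_eq_inv_mul,
    le_div_iff₀ (by positivity), mul_comm]
  exact hcauchy

/-! ### Partial sums of Fourier series -/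

/-- The Dirichlet kernel `∑_{|l| ≤ N} 𝐞(-lu)`. -/
def dirichletKernel (N : ℕ) (u : ℝ) : ℂ := ∑ l ∈ Finset.Icc (-(N : ℤ)) N, ee (-(l * u))

theorem norm_dirichletKernel_le (N : ℕ) (u : ℝ) : ‖dirichletKernel N u‖ ≤ 2 * N + 1 := by
  refine (norm_sum_le _ _).trans ?_
  have h : ∀ l ∈ Finset.Icc (-(N : ℤ)) N, ‖ee (-((l : ℂ) * u))‖ = 1 := fun l _ => by
    have := norm_ee_real (-(l * u))
    push_cast at this
    exact this
  rw [Finset.sum_congr rfl h, Finset.sum_const, Int.card_Icc, nsmul_eq_mul, mul_one]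
  have : ((N : ℤ) + 1 - -(N : ℤ)).toNat = 2 * N + 1 := by omega
  rw [this]
  push_cast
  exact le_rfl

theorem dirichletKernel_mul (N : ℕ) (u : ℝ) :
    dirichletKernel N u * (ee u - 1) = ee ((N + 1) * u) - ee (-(N * u)) := by
  induction N with
  | zero => simp [dirichletKernel, ee_zero]
  | succ N ih =>
    have h : dirichletKernel (N + 1) u
        = dirichletKernel N u + (ee ((N + 1) * u) + ee (-((N + 1) * u))) := by
      rw [dirichletKernel, dirichletKernel]
      push_cast
      rw [show (-((N : ℤ) + 1)) = -(N + 1 : ℤ) from rfl, Finset.Icc_succ_succ,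
        Finset.sum_union (by simp), Finset.sum_pair (by omega)]
      push_cast
      rw [neg_mul, neg_neg]
    rw [h, add_mul, ih]
    have h1 : ee ((N + 1) * u) * ee u = ee ((N + 1 + 1) * u) := by
      rw [← ee_add]
      ring_nf
    have h2 : ee (-((N + 1) * u)) * ee u = ee (-(N * u)) := by
      rw [← ee_add]
      ring_nf
    push_cast
    linear_combination h1 + h2

theorem norm_ee_sub_one (u : ℝ) : ‖ee u - 1‖ = 2 * |Real.sin (Real.pi * u)| := by
  have h := Complex.norm_exp_I_mul_ofReal_sub_one (2 * Real.pi * u)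
  rw [norm_mul, Real.norm_ofNat, Real.norm_eq_abs] at h
  rw [show Real.pi * u = 2 * Real.pi * u / 2 by ring, ← h, ee]
  congr 3
  push_cast
  ring

theorem min_le_norm_ee_sub_one {u : ℝ} (h0 : 0 < u) (h1 : u < 1) :
    2 * min u (1 - u) ≤ ‖ee u - 1‖ := by
  have hpi := Real.pi_pos
  have key : ∀ v : ℝ, 0 < v → v ≤ 1 / 2 → v ≤ |Real.sin (Real.pi * v)| := fun v hv hv2 => by
    refine le_trans ?_ (le_abs_self _)
    have := Real.mul_le_sin (x := Real.pi * v) (by positivity) (by nlinarith)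
    have h2 : 2 / Real.pi * (Real.pi * v) = 2 * v := by field_simp
    linarith
  rw [norm_ee_sub_one]
  refine mul_le_mul_of_nonneg_left ?_ zero_le_two
  rcases le_total u (1 / 2) with h | h
  · exact (min_le_left _ _).trans (key u h0 h)
  · refine (min_le_right _ _).trans ((key (1 - u) (by linarith) (by linarith)).trans ?_)
    rw [mul_sub, mul_one, Real.sin_pi_sub]

/-- A geometric mean of the bounds 2N+1 and 1/min(u, 1-u). The exponent 7/8 < 1 keeps the
singularities integrable; the small loss N^{1/8} is affordable later, so the logarithmic L¹ bound is
not needed. -/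
theorem norm_dirichletKernel_le_rpow (N : ℕ) {u : ℝ} (h0 : 0 < u) (h1 : u < 1) :
    ‖dirichletKernel N u‖ ≤ (2 * N + 1 : ℝ) ^ (1 / 8 : ℝ) *
      (u ^ (-(7 / 8) : ℝ) + (1 - u) ^ (-(7 / 8) : ℝ)) := by
  set μ := min u (1 - u) with hμ
  have hμ0 : 0 < μ := lt_min h0 (by linarith)
  have hD := norm_nonneg (dirichletKernel N u)
  have h2 : ‖dirichletKernel N u‖ ≤ μ⁻¹ := by
    have h := congrArg norm (dirichletKernel_mul N u)
    have h3 : ‖ee ((N + 1) * u) - ee (-(N * u))‖ ≤ 2 := by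
      refine (norm_sub_le _ _).trans ?_
      have a := norm_ee_real ((N + 1) * u)
      have b := norm_ee_real (-(N * u))
      push_cast at a b
      rw [a, b]
      norm_num
    rw [norm_mul] at h
    have h4 := mul_le_mul_of_nonneg_left (min_le_norm_ee_sub_one h0 h1) hD
    rw [← one_div, le_div_iff₀ hμ0]
    linarith
  have h3 : ‖dirichletKernel N u‖
      = ‖dirichletKernel N u‖ ^ (1 / 8 : ℝ) * ‖dirichletKernel N u‖ ^ (7 / 8 : ℝ) := by
    rw [← Real.rpow_add_of_nonneg hD (by norm_num) (by norm_num)]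
    norm_num
  rw [h3]
  have h4 : ‖dirichletKernel N u‖ ^ (7 / 8 : ℝ) ≤
      u ^ (-(7 / 8) : ℝ) + (1 - u) ^ (-(7 / 8) : ℝ) := by
    refine (Real.rpow_le_rpow hD h2 (by norm_num)).trans ?_
    rw [Real.inv_rpow hμ0.le, ← Real.rpow_neg hμ0.le]
    have a : 0 ≤ u ^ (-(7 / 8) : ℝ) := Real.rpow_nonneg h0.le _
    have b : 0 ≤ (1 - u) ^ (-(7 / 8) : ℝ) := Real.rpow_nonneg (by linarith) _
    rcases min_choice u (1 - u) with h | h <;> rw [hμ, h] <;> linarith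
  have h5 := norm_dirichletKernel_le N u
  gcongr

theorem intervalIntegrable_rpow_sub :
    IntervalIntegrable (fun u : ℝ => (1 - u) ^ (-(7 / 8) : ℝ)) MeasureTheory.volume 0 1 := by
  have h := (intervalIntegral.intervalIntegrable_rpow' (a := 0) (b := 1)
    (r := (-(7 / 8) : ℝ)) (by norm_num)).comp_sub_left 1
  simpa using h.symm

theorem integral_rpow_add :
    ∫ u in (0 : ℝ)..1, (u ^ (-(7 / 8) : ℝ) + (1 - u) ^ (-(7 / 8) : ℝ)) = 16 := by
  have h1 : ∫ u in (0 : ℝ)..1, u ^ (-(7 / 8) : ℝ) = 8 := by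
    rw [integral_rpow (Or.inl (by norm_num))]
    norm_num
  have h2 : ∫ u in (0 : ℝ)..1, (1 - u) ^ (-(7 / 8) : ℝ) = 8 := by
    have := intervalIntegral.integral_comp_sub_left (a := 0) (b := 1)
      (fun u : ℝ => u ^ (-(7 / 8) : ℝ)) 1
    rw [sub_self, sub_zero, h1] at this
    exact this
  rw [intervalIntegral.integral_add (intervalIntegral.intervalIntegrable_rpow' (by norm_num))
    intervalIntegrable_rpow_sub, h1, h2]
  norm_num

theorem integral_mul_dirichletKernel (a : ℂ) (l : ℤ) (N : ℕ) :
    ∫ u in (0 : ℝ)..1, a * ee (l * u) * dirichletKernel N u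
      = if l ∈ Finset.Icc (-(N : ℤ)) N then a else 0 := by
  have hc := continuous_ee
  have h : ∀ u : ℝ, a * ee (l * u) * dirichletKernel N u
      = ∑ i ∈ Finset.Icc (-(N : ℤ)) N, a * ee (((l - i : ℤ) : ℂ) * u) := fun u => by
    rw [dirichletKernel, Finset.mul_sum]
    refine Finset.sum_congr rfl fun i _ => ?_
    rw [mul_assoc, ← ee_add]
    push_cast
    ring_nf
  simp only [h]
  rw [intervalIntegral.integral_finsetSum fun i _ => by
    exact Continuous.intervalIntegrable (by fun_prop) _ _]
  simp only [intervalIntegral.integral_const_mul, integral_ee_int_mul, sub_eq_zero, mul_ite,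
    mul_one, mul_zero]
  rw [Finset.sum_ite_eq]

/-- The symmetric partial sums of an absolutely convergent Fourier series at `0` grow at most like
`N^{1/8}` relative to the supremum of the series. -/
theorem norm_sum_Icc_le {a : ℤ → ℂ} (ha : Summable fun l => ‖a l‖) {B : ℝ}
    (hB : ∀ u : ℝ, ‖∑' l : ℤ, a l * ee (l * u)‖ ≤ B) (N : ℕ) :
    ‖∑ l ∈ Finset.Icc (-(N : ℤ)) N, a l‖ ≤ 16 * (2 * N + 1 : ℝ) ^ (1 / 8 : ℝ) * B := by
  have hc := continuous_ee
  have hnorm : ∀ (l : ℤ) (u : ℝ), ‖ee ((l : ℂ) * u)‖ = 1 := fun l u => by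
    have := norm_ee_real (l * u)
    push_cast at this
    exact this
  have hs : ∀ u : ℝ, Summable fun l : ℤ => a l * ee (l * u) := fun u =>
    Summable.of_norm (ha.congr fun l => by rw [norm_mul, hnorm, mul_one])
  have hdc : Continuous (dirichletKernel N) := by
    unfold dirichletKernel
    fun_prop
  -- Integrating the twisted series against the Dirichlet kernel recovers the symmetric partial sum.
  have h := hasSum_intervalIntegral_of_norm_le
    (f := fun (l : ℤ) (u : ℝ) => a l * ee (l * u) * dirichletKernel N u)
    (g := fun u : ℝ => (∑' l : ℤ, a l * ee (l * u)) * dirichletKernel N u)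
    (fun l => by fun_prop) (ha.mul_right (2 * N + 1 : ℝ)) (fun l u => by
      rw [norm_mul, norm_mul, hnorm, mul_one]
      exact mul_le_mul_of_nonneg_left (norm_dirichletKernel_le N u) (norm_nonneg _))
    (fun u => (hs u).hasSum.mul_right _)
  simp only [integral_mul_dirichletKernel] at h
  have h2 := hasSum_sum_of_ne_finset_zero (L := SummationFilter.unconditional ℤ)
    (f := fun l : ℤ => if l ∈ Finset.Icc (-(N : ℤ)) N then a l else 0)
    (s := Finset.Icc (-(N : ℤ)) N) fun l hl => if_neg hl
  have h3 := h.unique h2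
  rw [Finset.sum_congr rfl fun l hl => if_pos hl] at h3
  rw [← h3]
  have hB0 : 0 ≤ B := (norm_nonneg _).trans (hB 0)
  have hint : IntervalIntegrable (fun u : ℝ => B * ((2 * N + 1 : ℝ) ^ (1 / 8 : ℝ) *
      (u ^ (-(7 / 8) : ℝ) + (1 - u) ^ (-(7 / 8) : ℝ)))) MeasureTheory.volume 0 1 :=
    (((intervalIntegral.intervalIntegrable_rpow' (by norm_num)).add
      intervalIntegrable_rpow_sub).const_mul _).const_mul _
  refine (intervalIntegral.norm_integral_le_of_norm_le zero_le_one ?_ hint).trans (le_of_eq ?_)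
  -- The pointwise kernel bound requires u < 1, so the endpoint is discarded as a null set.
  · have h1 : ∀ᵐ u : ℝ, u ≠ 1 := by
      simp [MeasureTheory.ae_iff]
    filter_upwards [h1] with u hu1 hu
    rw [norm_mul]
    exact mul_le_mul (hB u) (norm_dirichletKernel_le_rpow N hu.1 (lt_of_le_of_ne hu.2 hu1))
      (norm_nonneg _) hB0
  · rw [intervalIntegral.integral_const_mul, intervalIntegral.integral_const_mul,
      integral_rpow_add]
    ring

/-! ### Truncated moments and the interchange of the limit with the sum over (c,d) -/

section

set_option linter.unusedSectionVars false

variable {A : Type*} [AddCommGroup A] [Fintype A] {Q : QuadraticMap ℤ A (AddCircle (1 : ℚ))}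

/-- The partial sums `∑_{|l| ≤ N} l 𝐞(ml²t) 𝔢_{lβ}`. -/
def partialMoment (m : ℝ) (β : A) (t : ℂ) (N : ℕ) : A → ℂ :=
  ∑ l ∈ Finset.Icc (-(N : ℤ)) N, (l * thetaExp m t 0 l) • basisVec (l • β)

theorem partialMoment_apply (m : ℝ) (β : A) (t : ℂ) (N : ℕ) (γ : A) : partialMoment m β t N γ =
    ∑ l ∈ Finset.Icc (-(N : ℤ)) N, l * thetaExp m t 0 l * basisVec (l • β) γ := by
  rw [partialMoment, Finset.sum_apply]
  rfl

theorem thetaExp_zero_mul_ee {m : ℝ} (hm : m ≠ 0) (t : ℂ) (u : ℝ) (l : ℤ) :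
    thetaExp m t 0 l * ee (l * u) = thetaExp m t (u / (2 * m)) l := by
  have hm' : (m : ℂ) ≠ 0 := by exact_mod_cast hm
  rw [thetaExp, thetaExp, ← ee_add]
  congr 1
  field_simp
  ring

theorem tendsto_partialMoment {m : ℝ} (hm : 0 < m) (β : A) {t : ℂ} (ht : 0 < t.im) :
    Filter.Tendsto (partialMoment m β t) Filter.atTop
      (nhds (thetaVec β fun l : ℤ => l * thetaExp m t 0 l)) := by
  have h := hasSum_thetaVec β (summable_moment hm ht 0)
  have h2 : HasSum _ _ (SummationFilter.symmetricIcc ℤ) :=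
    h.mono_left (SummationFilter.LeAtTop.le_atTop)
  rw [HasSum, SummationFilter.symmetricIcc_eq_map_Icc_nat, Filter.tendsto_map'_iff] at h2
  exact h2

theorem summable_abs_mul_exp {c : ℝ} (hc : 0 < c) :
    Summable fun l : ℤ => |(l : ℝ)| * Real.exp (-c * |(l : ℝ)|) := by
  have h := Real.summable_pow_mul_exp_neg_nat_mul 1 hc
  refine Summable.of_nat_of_neg (h.congr fun j => ?_) (h.congr fun j => ?_) <;> simp

/-- With D = |cτ+d|, the terms decay exponentially once |l| ≥ D². Below that cutoff the Dirichlet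
kernel loses at most (D²)^{1/8} = D^{1/4} against the full moment bound D^{3/2}, giving D^{7/4} for
every N. -/
theorem exists_norm_partialMoment_le (β : A) {m : ℚ} (hm : 0 < m) (τ : ℍ) :
    ∃ C, 0 ≤ C ∧ ∀ (g : SL(2, ℤ)) (N : ℕ),
      ‖partialMoment m β (g • τ : ℍ) N‖ ≤ C * ‖autFactor g τ‖ ^ (7 / 4 : ℝ) := by
  have hm' : (0 : ℝ) < m := by exact_mod_cast hm
  have hy := τ.im_pos
  have hpi := Real.pi_pos
  obtain ⟨C, hC, hle⟩ := exists_norm_moment_le β hm τ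
  set δ := min 1 τ.im with hδ
  have hδ0 : 0 < δ := lt_min one_pos hy
  set κ := 2 * Real.pi * m * τ.im with hκ
  have hκ0 : 0 < κ := by positivity
  have hsum := summable_abs_mul_exp hκ0
  set T := ∑' l : ℤ, |(l : ℝ)| * Real.exp (-κ * |(l : ℝ)|) with hT
  have hT0 : 0 ≤ T := tsum_nonneg fun l => by positivity
  set c₁ := (2 + (δ ^ 2)⁻¹) ^ (1 / 8 : ℝ) with hc₁
  have hc₁0 : 0 ≤ c₁ := by positivity
  refine ⟨16 * c₁ * C + T * (δ ^ (7 / 4 : ℝ))⁻¹, by positivity, fun g N => ?_⟩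
  set D := ‖autFactor g τ‖ with hD
  have hδD : δ ≤ D := le_norm_autFactor g τ
  have hD0 : 0 < D := hδ0.trans_le hδD
  have ht : 0 < ((g • τ : ℍ) : ℂ).im := (g • τ).im_pos
  refine (pi_norm_le_iff_of_nonneg (by positivity)).2 fun γ => ?_
  rw [partialMoment_apply]
  set a : ℤ → ℂ := fun l => l * thetaExp m (g • τ : ℍ) 0 l * basisVec (l • β) γ with ha
  have hale : ∀ l, ‖a l‖ ≤ |(l : ℝ)| * ‖thetaExp m (g • τ : ℍ) 0 l‖ := fun l => by
    simp only [ha]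
    rw [norm_mul, norm_mul, Complex.norm_intCast]
    exact mul_le_of_le_one_right (by positivity) (norm_basisVec_apply_le _ _)
  have hasum : Summable fun l => ‖a l‖ :=
    (summable_thetaVec β (summable_moment hm' ht 0) γ).norm
  have hB : ∀ u : ℝ, ‖∑' l : ℤ, a l * ee (l * u)‖ ≤ C * D ^ (3 / 2 : ℝ) := fun u => by
    refine le_trans (le_of_eq ?_) (hle g u γ)
    rw [thetaVec]
    congr 1
    refine tsum_congr fun l => ?_
    have h1 := thetaExp_zero_mul_ee hm'.ne' (g • τ : ℍ) u l
    rw [Complex.ofReal_ratCast] at h1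
    simp only [ha]
    rw [← h1]
    ring
  set M := ⌊D ^ 2⌋₊ with hM
  -- For N ≤ M the tail is empty; otherwise it consists of the indices with M < |l| ≤ N.
  set N₀ := min N M with hN₀
  have hsub : Finset.Icc (-(N₀ : ℤ)) N₀ ⊆ Finset.Icc (-(N : ℤ)) N := by
    have : N₀ ≤ N := min_le_left _ _
    exact Finset.Icc_subset_Icc (by omega) (by omega)
  rw [← Finset.sum_sdiff hsub]
  have hhead : ‖∑ l ∈ Finset.Icc (-(N₀ : ℤ)) N₀, a l‖ ≤ 16 * c₁ * C * D ^ (7 / 4 : ℝ) := by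
    refine (norm_sum_Icc_le hasum hB N₀).trans ?_
    have h1 : (2 * N₀ + 1 : ℝ) ≤ (2 + (δ ^ 2)⁻¹) * D ^ 2 := by
      have h2 : (N₀ : ℝ) ≤ D ^ 2 :=
        le_trans (by exact_mod_cast min_le_right N M) (Nat.floor_le (by positivity))
      have h3 : 1 ≤ (δ ^ 2)⁻¹ * D ^ 2 := by
        rw [← div_eq_inv_mul, one_le_div (by positivity)]
        gcongr
      linarith
    have h2 : (2 * N₀ + 1 : ℝ) ^ (1 / 8 : ℝ) ≤ c₁ * D ^ (1 / 4 : ℝ) := by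
      refine (Real.rpow_le_rpow (by positivity) h1 (by norm_num)).trans (le_of_eq ?_)
      rw [Real.mul_rpow (by positivity) (by positivity), ← Real.rpow_natCast D 2,
        ← Real.rpow_mul hD0.le]
      norm_num [hc₁]
    have h3 : D ^ (7 / 4 : ℝ) = D ^ (1 / 4 : ℝ) * D ^ (3 / 2 : ℝ) := by
      rw [← Real.rpow_add hD0]
      norm_num
    calc _ ≤ 16 * (c₁ * D ^ (1 / 4 : ℝ)) * (C * D ^ (3 / 2 : ℝ)) := by gcongr
      _ = _ := by rw [h3]; ring
  have htail : ‖∑ l ∈ Finset.Icc (-(N : ℤ)) N \ Finset.Icc (-(N₀ : ℤ)) N₀, a l‖ ≤ T := by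
    refine (norm_sum_le _ _).trans ((Finset.sum_le_sum fun l hl => ?_).trans
      (hsum.sum_le_tsum _ fun l _ => by positivity))
    refine (hale l).trans (mul_le_mul_of_nonneg_left ?_ (abs_nonneg _))
    rw [norm_thetaExp, Real.exp_le_exp, UpperHalfPlane.coe_im, SL_smul_im, ← hD]
    have hl2 : D ^ 2 ≤ |(l : ℝ)| := by
      rw [Finset.mem_sdiff, Finset.mem_Icc, Finset.mem_Icc] at hl
      have h1 : M + 1 ≤ l.natAbs := by omega
      have h2 := (Nat.lt_floor_add_one (D ^ 2)).le
      refine h2.trans ?_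
      rw [← Int.cast_abs, Int.abs_eq_natAbs, Int.cast_natCast]
      exact_mod_cast h1
    -- For |l| ≥ D² the Gaussian exponent l²/D² is at least |l|, which makes the tail bounded
    -- independently of M and N.
    have h1 : |(l : ℝ)| ≤ (l : ℝ) ^ 2 / D ^ 2 := by
      rw [le_div_iff₀ (by positivity)]
      have h0 := mul_le_mul_of_nonneg_left hl2 (abs_nonneg (l : ℝ))
      rwa [abs_mul_abs_self, ← sq] at h0
    have h2 := mul_le_mul_of_nonneg_left h1 hκ0.le
    have h3 : 2 * Real.pi * m * ((l : ℝ) ^ 2 * (τ.im / D ^ 2) + 2 * l * (0 : ℂ).im)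
        = κ * ((l : ℝ) ^ 2 / D ^ 2) := by
      rw [Complex.zero_im, hκ]
      ring
    rw [h3]
    linarith
  refine (norm_add_le _ _).trans ?_
  -- The lower bound δ ≤ D absorbs the constant T into D^{7/4}.
  have h4 : T ≤ T * (δ ^ (7 / 4 : ℝ))⁻¹ * D ^ (7 / 4 : ℝ) := by
    rw [mul_assoc]
    refine le_mul_of_one_le_right hT0 ?_
    rw [← div_eq_inv_mul, one_le_div (by positivity)]
    gcongr
  rw [add_mul]
  linarith

/-- Antisymmetrization does not change the partial sums. -/
theorem sum_smul_expSeed {k : ℝ} (h : IsAntisymmetricWeight Q k) (m : ℚ) (β : A) (τ : ℍ) (N : ℕ) :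
    ∑ l ∈ Finset.Icc (-(N : ℤ)) N, (l : ℂ) • expSeed Q k (l ^ 2 * m) (l • β) τ
      = partialMoment m β τ N := by
  have h1 : ∀ l : ℤ, (l : ℂ) • expSeed Q k (l ^ 2 * m) (l • β) τ
      = (1 / 2 : ℂ) • ((l * thetaExp m τ 0 l) • basisVec (l • β))
        + (1 / 2 : ℂ) • (((-l : ℤ) * thetaExp m τ 0 (-l)) • basisVec ((-l) • β)) := fun l => by
    have h2 : ee (((l ^ 2 * m : ℚ) : ℂ) * τ) = thetaExp m τ 0 l := by
      rw [thetaExp]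
      congr 1
      push_cast
      ring
    have h3 : thetaExp m τ 0 (-l) = thetaExp m τ 0 l := by
      rw [thetaExp, thetaExp]
      congr 1
      push_cast
      ring
    rw [expSeed, antisymm_sign h, h2, h3, neg_smul l β]
    push_cast
    module
  rw [Finset.sum_congr rfl fun l _ => h1 l, Finset.sum_add_distrib, ← Finset.smul_sum,
    ← Finset.smul_sum]
  have h2 : ∑ l ∈ Finset.Icc (-(N : ℤ)) N,
      (((-l : ℤ) * thetaExp m τ 0 (-l)) • basisVec ((-l) • β) : A → ℂ) = partialMoment m β τ N := by
    refine Finset.sum_equiv (Equiv.neg ℤ) (fun l => ?_) fun l _ => rfl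
    simp only [Finset.mem_Icc, Equiv.neg_apply]
    omega
  rw [h2]
  change (1 / 2 : ℂ) • partialMoment m β τ N + (1 / 2 : ℂ) • partialMoment m β τ N = _
  module

/-- A finite sum over l commutes with the sum over (c,d), and linearity of ρ* gathers the
antisymmetrized seeds into one truncated moment. -/
theorem sum_smul_expPoincare (hQ : IsNondegenerate Q) {k : ℝ} (hk : 2 < k)
    (h : IsAntisymmetricWeight Q k) {m : ℚ} (hm : 0 < m) (β : A) (τ : ℍ) (N : ℕ) :
    ∑ l ∈ Finset.Icc (-(N : ℤ)) N, (l : ℂ) • expPoincare Q k (l ^ 2 * m) (l • β) τ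
      = (1 / 2 : ℂ) • ∑' p, (autFactor (rowRep p) τ ^ (-k : ℂ)) •
        dualWeil Q (Mp2Z.lift (rowRep p))⁻¹ (partialMoment m β (rowRep p • τ : ℍ) N) := by
  have hs : ∀ l : ℤ, Summable (poincareTerm Q k (expSeed Q k (l ^ 2 * m) (l • β)) τ) := fun l =>
    summable_poincareTerm hQ h.sig_int hk
      (fun τ => norm_expSeed_le h (by positivity) (l • β) τ) τ
  have h1 : ∀ l : ℤ, (l : ℂ) • expPoincare Q k (l ^ 2 * m) (l • β) τ = (1 / 2 : ℂ) •
      ∑' p, (l : ℂ) • poincareTerm Q k (expSeed Q k (l ^ 2 * m) (l • β)) τ p := fun l => by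
    rw [(hs l).tsum_const_smul, expPoincare, poincareSeries, smul_comm]
  rw [Finset.sum_congr rfl fun l _ => h1 l, ← Finset.smul_sum,
    ← Summable.tsum_finsetSum fun l _ => (hs l).const_smul _]
  congr 1
  refine tsum_congr fun p => ?_
  rw [← sum_smul_expSeed h, map_sum, Finset.smul_sum]
  refine Finset.sum_congr rfl fun l _ => ?_
  rw [poincareTerm, map_smul, smul_comm]

/-- The summand `(cτ + d)^{-k} ρ*(M)^{-1} ∑_l l 𝐞(ml² Mτ) 𝔢_{lβ}`. -/
def momentTerm (Q : QuadraticMap ℤ A (AddCircle (1 : ℚ))) (k : ℝ) (m : ℚ) (β : A) (τ : ℍ)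
    (p : {p : ℤ × ℤ // IsCoprime p.1 p.2}) : A → ℂ :=
  (autFactor (rowRep p) τ ^ (-k : ℂ)) • dualWeil Q (Mp2Z.lift (rowRep p))⁻¹
    (thetaVec β fun l : ℤ => l * thetaExp m (rowRep p • τ : ℍ) 0 l)

/-- Dominated convergence in N. The majorant |cτ+d|^{-(k-7/4)} is summable over coprime pairs
because k ≥ 4 gives k - 7/4 ≥ 9/4 > 2. -/
theorem hasSum_smul_expPoincare (hQ : IsNondegenerate Q) {k : ℝ} (hk : 4 ≤ k)
    (h : IsAntisymmetricWeight Q k) {m : ℚ} (hm : 0 < m) (β : A) (τ : ℍ) :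
    HasSum (fun l : ℤ => (l : ℂ) • expPoincare Q k (l ^ 2 * m) (l • β) τ)
      ((1 / 2 : ℂ) • ∑' p, momentTerm Q k m β τ p) (SummationFilter.symmetricIcc ℤ) := by
  have hm' : (0 : ℝ) < m := by exact_mod_cast hm
  rw [HasSum, SummationFilter.symmetricIcc_eq_map_Icc_nat, Filter.tendsto_map'_iff]
  have hfun : ((fun s : Finset ℤ => ∑ l ∈ s, (l : ℂ) • expPoincare Q k (l ^ 2 * m) (l • β) τ) ∘
      fun N : ℕ => Finset.Icc (-(N : ℤ)) N) = fun N : ℕ => (1 / 2 : ℂ) •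
        ∑' p, (autFactor (rowRep p) τ ^ (-k : ℂ)) •
        dualWeil Q (Mp2Z.lift (rowRep p))⁻¹ (partialMoment m β (rowRep p • τ : ℍ) N) :=
    funext fun N => sum_smul_expPoincare hQ (by linarith) h hm β τ N
  rw [hfun]
  refine Filter.Tendsto.const_smul ?_ _
  obtain ⟨C, hC, hle⟩ := exists_norm_partialMoment_le β hm τ
  have hr := EisensteinSeries.r_pos ⟨⟨|τ.re|, τ.im⟩, τ.im_pos⟩
  refine tendsto_tsum_of_dominated_convergence (bound := fun p =>
    Real.sqrt (Fintype.card A) * C * (EisensteinSeries.r ⟨⟨|τ.re|, τ.im⟩, τ.im_pos⟩ ^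
      (-(k - 7 / 4)) * ‖rowVec p‖ ^ (-(k - 7 / 4))))
    (((summable_rowVec (by linarith)).mul_left _).mul_left _) (fun p => ?_)
    (Filter.Eventually.of_forall fun N p => ?_)
  · refine Filter.Tendsto.const_smul ?_ _
    exact ((LinearMap.toContinuousLinearMap
      (dualWeil Q (Mp2Z.lift (rowRep p))⁻¹)).continuous.tendsto _).comp
      (tendsto_partialMoment hm' β (rowRep p • τ).im_pos)
  · have hj := norm_pos_iff.2 (autFactor_ne_zero (rowRep p) τ)
    rw [norm_smul, norm_cpow_neg_real]
    calc _ ≤ ‖autFactor (rowRep p) τ‖ ^ (-k) * (Real.sqrt (Fintype.card A) *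
          (C * ‖autFactor (rowRep p) τ‖ ^ (7 / 4 : ℝ))) := by
          gcongr
          exact (norm_dualWeil_le_sqrt_card hQ h.sig_int _ _).trans (by gcongr; exact hle _ N)
      _ = Real.sqrt (Fintype.card A) * C * ‖autFactor (rowRep p) τ‖ ^ (-(k - 7 / 4)) := by
          rw [show -(k - 7 / 4) = -k + 7 / 4 by ring, Real.rpow_add hj]
          ring
      _ ≤ _ := mul_le_mul_of_nonneg_left (norm_autFactor_rpow_le (by linarith) τ.im_pos
          (mem_verticalStrip_self τ) p) (by positivity)

/-! ### The derivative of the Jacobi Eisenstein series at `z = 0` -/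

/-- The factor 𝐞(-cmz²/(cτ+d)) is even in z and contributes nothing at 0; the chain rule through
z/(cτ+d) produces the division by cτ+d. -/
theorem hasDerivAt_thetaVec_thetaCoeff {m : ℚ} (hm : 0 < m) (β : A) (τ : ℍ) (g : SL(2, ℤ)) :
    HasDerivAt (fun z => thetaVec β (thetaCoeff m τ z g 0))
      ((4 * Real.pi * Complex.I * m / autFactor g τ) •
        thetaVec β fun l : ℤ => l * thetaExp m (g • τ : ℍ) 0 l) 0 := by
  have hm' : (0 : ℝ) < m := by exact_mod_cast hm
  rw [hasDerivAt_pi]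
  intro γ
  have heq : (fun z => thetaVec β (thetaCoeff m τ z g 0) γ) = fun z =>
      ee (-(m * (g 1 0 * z ^ 2 / autFactor g τ))) *
        thetaVec β (thetaExp m (g • τ : ℍ) (z / autFactor g τ)) γ := by
    funext z
    rw [thetaVec, thetaVec, ← tsum_mul_left]
    refine tsum_congr fun l => ?_
    rw [thetaCoeff_eq hm, mul_assoc, Complex.ofReal_zero, zero_div, add_zero]
  rw [heq]
  have h1 : HasDerivAt (fun z : ℂ => 2 * Real.pi * Complex.I *
      (-(m * (g 1 0 * z ^ 2 / autFactor g τ)))) 0 0 := by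
    have h := ((((hasDerivAt_pow 2 (0 : ℂ)).const_mul (g 1 0 : ℂ)).div_const
      (autFactor g τ)).const_mul (m : ℂ)).neg.const_mul (2 * (Real.pi : ℂ) * Complex.I)
    simpa using h
  have h2 := h1.cexp
  have h3 : HasDerivAt (fun z : ℂ => z / autFactor g τ) (1 / autFactor g τ) 0 :=
    (hasDerivAt_id (0 : ℂ)).div_const _
  have h4 := hasDerivAt_thetaVec hm' β γ (t := ((g • τ : ℍ) : ℂ)) (g • τ).im_pos
    (0 / autFactor g τ)
  have h5 := h4.comp (0 : ℂ) h3
  have h6 := h2.mul h5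
  refine HasDerivAt.congr_deriv (f := fun z => ee (-(m * (g 1 0 * z ^ 2 / autFactor g τ))) *
        thetaVec β (thetaExp m (g • τ : ℍ) (z / autFactor g τ)) γ) h6 ?_
  simp only [zero_div, Pi.smul_apply, smul_eq_mul]
  simp
  ring

theorem hasDerivAt_jacobiEisensteinTerm (Q : QuadraticMap ℤ A (AddCircle (1 : ℚ))) (k : ℝ) {m : ℚ}
    (hm : 0 < m) (β : A) (τ : ℍ) (p : {p : ℤ × ℤ // IsCoprime p.1 p.2}) :
    HasDerivAt (fun z => jacobiEisensteinTerm Q (k - 1) m β τ z p)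
      ((4 * Real.pi * Complex.I * m : ℂ) • momentTerm Q k m β τ p) 0 := by
  have hj := autFactor_ne_zero (rowRep p) τ
  simp only [jacobiEisensteinTerm_eq Q (k - 1) hm]
  have h := (LinearMap.toContinuousLinearMap
    (dualWeil Q (Mp2Z.lift (rowRep p))⁻¹)).hasFDerivAt.comp_hasDerivAt (0 : ℂ)
      (hasDerivAt_thetaVec_thetaCoeff hm β τ (rowRep p))
  refine (h.const_smul (autFactor (rowRep p) τ ^ (-((k - 1 : ℝ) : ℂ)))).congr_deriv ?_
  rw [LinearMap.coe_toContinuousLinearMap', map_smul, momentTerm, smul_smul, smul_smul]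
  congr 1
  -- The denominator cτ+d coming from the chain rule raises the weight from k-1 to k.
  have : (-((k - 1 : ℝ) : ℂ)) = -k + 1 := by push_cast; ring
  rw [this, Complex.cpow_add _ _ hj, Complex.cpow_one]
  field_simp

/-- The summands are holomorphic in z and dominated uniformly on |Im z| < 1, so the series is
differentiated termwise. -/
theorem deriv_jacobiEisenstein (hQ : IsNondegenerate Q) (hsig : ∃ n : ℤ, sig Q = n) {k : ℝ}
    (hk : 4 ≤ k) {m : ℚ} (hm : 0 < m) (β : A) (τ : ℍ) :
    deriv (jacobiEisenstein Q (k - 1) m β τ) 0 = (4 * Real.pi * Complex.I * m : ℂ) •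
      ((1 / 2 : ℂ) • ∑' p, momentTerm Q k m β τ p) := by
  obtain ⟨b, hb0, hb, hle⟩ := exists_norm_jacobiEisensteinTerm_le hQ hsig
    (by linarith : 5 / 2 < k - 1) hm β |τ.re| τ.im_pos
  have hm' : (0 : ℝ) < m := by exact_mod_cast hm
  have hy := τ.im_pos
  have hopen : IsOpen {w : ℂ | |w.im| < 1} :=
    isOpen_lt (Complex.continuous_im.abs) continuous_const
  have hdiff : ∀ p, DifferentiableOn ℂ (fun z => jacobiEisensteinTerm Q (k - 1) m β τ z p)
      {w : ℂ | |w.im| < 1} := fun p z _ => by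
    refine DifferentiableAt.differentiableWithinAt ?_
    rw [differentiableAt_pi]
    intro γ
    simp only [jacobiEisensteinTerm_apply Q _ hm]
    exact (differentiableAt_jacobiFun hQ _ hm β p γ (x := ((τ : ℂ), z)) hy).comp z
      (by fun_prop : DifferentiableAt ℂ (fun z : ℂ => ((τ : ℂ), z)) z)
  have hbd : ∀ (p) (w : ℂ), w ∈ {w : ℂ | |w.im| < 1} →
      ‖jacobiEisensteinTerm Q (k - 1) m β τ w p‖ ≤
        b p * ((1 + τ.im) * Real.exp (2 * Real.pi * m * (1 / τ.im))) := fun p w hw => by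
    refine (hle τ (mem_verticalStrip_self τ) w p).trans
      (mul_le_mul_of_nonneg_left ?_ (hb0 p))
    have : w.im ^ 2 ≤ 1 := (sq_le_one_iff_abs_le_one _).2 (le_of_lt hw)
    gcongr
  have h := Complex.hasSum_deriv_of_summable_norm (hb.mul_right _) hdiff hopen hbd
    (z := 0) (by simp)
  have hd : DifferentiableAt ℂ (fun w => ∑' p, jacobiEisensteinTerm Q (k - 1) m β τ w p) 0 :=
    (Complex.differentiableOn_tsum_of_summable_norm (hb.mul_right _) hdiff hopen
      hbd).differentiableAt (hopen.mem_nhds (by simp))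
  have h1 : deriv (jacobiEisenstein Q (k - 1) m β τ) 0 = (1 / 2 : ℂ) •
      deriv (fun w => ∑' p, jacobiEisensteinTerm Q (k - 1) m β τ w p) 0 :=
    (hd.hasDerivAt.const_smul (1 / 2 : ℂ)).deriv
  rw [h1, ← h.tsum_eq, smul_comm]
  congr 1
  rw [tsum_congr fun p => (hasDerivAt_jacobiEisensteinTerm Q k hm β τ p).deriv, tsum_const_smul'']

theorem formR_eq_deriv (hQ : IsNondegenerate Q) {k : ℝ} (hk : 4 ≤ k)
    (h : IsAntisymmetricWeight Q k) {m : ℚ} (hm : 0 < m) (β : A) (τ : ℍ) :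
    formR Q k m β τ = (1 / (4 * Real.pi * Complex.I * m) : ℂ) •
      deriv (jacobiEisenstein Q (k - 1) m β τ) 0 := by
  have hm' : (m : ℂ) ≠ 0 := by exact_mod_cast hm.ne'
  have hc : (4 * (Real.pi : ℂ) * Complex.I * m) ≠ 0 := by
    simp [Real.pi_ne_zero, hm.ne', Complex.I_ne_zero]
  rw [formR, (hasSum_smul_expPoincare hQ hk h hm β τ).tsum_eq,
    deriv_jacobiEisenstein hQ h.sig_int hk hm, smul_smul, one_div_mul_cancel hc, one_smul]

end

section

set_option linter.unusedSectionVars false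

variable {A : Type*} [AddCommGroup A] [Fintype A] {Q : QuadraticMap ℤ A (AddCircle (1 : ℚ))}

/-! ### The Fourier expansion of the Jacobi Eisenstein series -/

theorem isJacobiType_eisFun (hQ : IsNondegenerate Q) (hsig : ∃ n : ℤ, sig Q = n) {k : ℝ}
    (hk : 5 / 2 < k) {m : ℚ} (hm : 0 < m) {β : A} (hmβ : (m : AddCircle (1 : ℚ)) = -Q β) (γ : A) :
    IsJacobiType (Q γ) (bil Q γ β) m (eisFun Q k m β γ) where
  continuousAt _ hx := continuousAt_eisFun hQ hsig hk hm β γ hx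
  differentiableAt_left _ z hτ :=
    differentiableAt_eisFun_comp hQ hsig hk hm β γ (c := fun t => (t, z)) (by fun_prop) hτ
  differentiableAt_right τ _ hτ :=
    differentiableAt_eisFun_comp hQ hsig hk hm β γ (c := fun w => (τ, w)) (by fun_prop) hτ
  add_one_left _ z hτ := eisFun_add_one_left hQ hsig hk hm hmβ γ hτ z
  add_one_right _ z hτ := eisFun_add_one_right hQ hsig hk hm hmβ γ hτ z
  bound _ hY := exists_norm_eisFun_le hQ hsig hk hm β γ hY

theorem exists_hasJacobiExpansion (hQ : IsNondegenerate Q) (hsig : ∃ n : ℤ, sig Q = n) {k : ℝ}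
    (hk : 5 / 2 < k) {m : ℚ} (hm : 0 < m) {β : A} (hmβ : (m : AddCircle (1 : ℚ)) = -Q β) :
    ∃ c : ℚ → ℚ → A → ℂ, HasJacobiExpansion Q β (jacobiEisenstein Q k m β) c := by
  refine ⟨fun n r γ => doubleCoeff (eisFun Q k m β γ) n r 1 0, fun τ z γ => ?_⟩
  have hF := isJacobiType_eisFun hQ hsig hk hm hmβ γ
  rw [jacobiEisenstein_apply hQ hsig hk hm]
  refine (hF.hasSum_doubleCoeff (τ := (τ : ℂ)) τ.im_pos z).congr_fun fun p => ?_
  beta_reduce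
  rw [hF.doubleCoeff_const p.1 p.2 one_pos τ.im_pos 0 z.im]
  rfl

/-- A Jacobi expansion in terms of the components on `ℂ × ℂ`. -/
theorem HasJacobiExpansion.hasSum_eisFun (hQ : IsNondegenerate Q) (hsig : ∃ n : ℤ, sig Q = n)
    {k : ℝ} (hk : 5 / 2 < k) {m : ℚ} (hm : 0 < m) {β : A} {c : ℚ → ℚ → A → ℂ}
    (hc : HasJacobiExpansion Q β (jacobiEisenstein Q k m β) c) (γ : A) (τ z : ℂ) (hτ : 0 < τ.im) :
    HasSum (fun p : negCoset (Q γ) × negCoset (bil Q γ β) =>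
      c p.1 p.2 γ * ee ((p.1 : ℚ) * τ) * ee ((p.2 : ℚ) * z)) (eisFun Q k m β γ (τ, z)) := by
  have h := hc ⟨τ, hτ⟩ z γ
  rw [jacobiEisenstein_apply hQ hsig hk hm] at h
  exact h

theorem coeff_eq_zero (hQ : IsNondegenerate Q) (hsig : ∃ n : ℤ, sig Q = n)
    {k : ℝ} (hk : 5 / 2 < k) {m : ℚ} (hm : 0 < m) {β : A} (hmβ : (m : AddCircle (1 : ℚ)) = -Q β)
    {c : ℚ → ℚ → A → ℂ} (hc : HasJacobiExpansion Q β (jacobiEisenstein Q k m β) c) (γ : A)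
    (n : negCoset (Q γ)) (r : negCoset (bil Q γ β)) (h : 4 * m * n.1 < r.1 ^ 2) :
    c n r γ = 0 := by
  have h1 := IsJacobiType.coeff_eq_doubleCoeff (F := eisFun Q k m β γ)
    (c := fun n r => c n r γ) (hc.hasSum_eisFun hQ hsig hk hm γ) n r
  rw [h1]
  exact (isJacobiType_eisFun hQ hsig hk hm hmβ γ).doubleCoeff_eq_zero (by exact_mod_cast hm) n r
    (by exact_mod_cast h) one_pos 0

/-- The absolutely convergent expansion is differentiated termwise at z = 0 and inserted into the
derivative formula for R; 1/(4πim) splits as 1/(2m) · 1/(2πi). -/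
theorem hasSum_formR (hQ : IsNondegenerate Q) {k : ℝ} (hk : 4 ≤ k)
    (hanti : IsAntisymmetricWeight Q k) {m : ℚ} (hm : 0 < m) {β : A} {c : ℚ → ℚ → A → ℂ}
    (hc : HasJacobiExpansion Q β (jacobiEisenstein Q (k - 1) m β) c) (τ : ℍ) (γ : A) :
    HasSum (fun x : negCoset (Q γ) × negCoset (bil Q γ β) =>
      (1 / (2 * m) : ℂ) * (c x.1 x.2 γ * ee ((x.1 : ℚ) * τ) *
        (1 / (2 * Real.pi * Complex.I) * deriv (fun z : ℂ => ee ((x.2 : ℚ) * z)) 0)))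
      (formR Q k m β τ γ) := by
  have hk' : 5 / 2 < k - 1 := by linarith
  have h := (IsJacobiType.hasSum_deriv (F := eisFun Q (k - 1) m β γ) (c := fun n r => c n r γ)
    (hc.hasSum_eisFun hQ hanti.sig_int hk' hm γ) (τ := τ) τ.im_pos).mul_left
    (1 / (4 * Real.pi * Complex.I * m) : ℂ)
  have hd : deriv (jacobiEisenstein Q (k - 1) m β τ) 0 γ
      = deriv (fun z => eisFun Q (k - 1) m β γ (τ, z)) 0 := by
    rw [deriv_pi fun γ => differentiableAt_pi.1
      (differentiableAt_jacobiEisenstein hQ hanti.sig_int hk' hm β τ 0) γ]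
    simp only [jacobiEisenstein_apply hQ hanti.sig_int hk' hm]
  rw [formR_eq_deriv hQ hk hanti hm, Pi.smul_apply, smul_eq_mul, hd]
  refine h.congr_fun fun p => ?_
  have hm' : (m : ℂ) ≠ 0 := by exact_mod_cast hm.ne'
  have hpi : (Real.pi : ℂ) ≠ 0 := by exact_mod_cast Real.pi_ne_zero
  have hI := Complex.I_ne_zero
  field_simp
  ring

theorem hasFourierExpansion_formR (hQ : IsNondegenerate Q) {k : ℝ} (hk : 4 ≤ k)
    (hanti : IsAntisymmetricWeight Q k) {m : ℚ} (hm : 0 < m) {β : A}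
    (hmβ : (m : AddCircle (1 : ℚ)) = -Q β) {c : ℚ → ℚ → A → ℂ}
    (hc : HasJacobiExpansion Q β (jacobiEisenstein Q (k - 1) m β) c) :
    HasFourierExpansion Q (formR Q k m β) (fun n γ => (1 / (2 * m) : ℂ) *
      ∑ᶠ r ∈ {r : ℚ | (r : AddCircle (1 : ℚ)) = -bil Q γ β ∧ r ^ 2 ≤ 4 * m * n},
        (r : ℂ) * c n r γ) := by
  intro τ γ
  refine hasSum_collect (c := fun n r => c n r γ) (e := fun n => ee (n * τ))
    (fun n r h => coeff_eq_zero hQ hanti.sig_int (by linarith) hm hmβ hc γ n r h) ?_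
  refine (hasSum_formR hQ hk hanti hm hc τ γ).congr_fun fun p => ?_
  have hpi : (Real.pi : ℂ) ≠ 0 := by exact_mod_cast Real.pi_ne_zero
  have hI := Complex.I_ne_zero
  rw [deriv_ee_mul]
  field_simp

end

end JacobiEis

end

theorem mainTheorem3 {A : Type*} [AddCommGroup A] [Fintype A]
    (Q : QuadraticMap ℤ A (AddCircle (1 : ℚ))) (hQ : JacobiEis.IsNondegenerate Q)
    (k : ℝ) (hk : 4 ≤ k) (hanti : JacobiEis.IsAntisymmetricWeight Q k)
    (β : A) (m : ℚ) (hm : 0 < m) (hmβ : (m : AddCircle (1 : ℚ)) = -Q β) :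
    -- all the series in question converge
    (∀ (l : ℤ) (τ : ℍ), Summable (JacobiEis.poincareTerm Q k
      (JacobiEis.expSeed Q k (l ^ 2 * m) (l • β)) τ)) ∧
    (∀ τ : ℍ, Summable
      (fun l : ℤ => (l : ℂ) • JacobiEis.expPoincare Q k (l ^ 2 * m) (l • β) τ)
      (SummationFilter.symmetricIcc ℤ)) ∧
    (∀ (τ : ℍ) (z : ℂ) (g : SL(2, ℤ)), Summable (JacobiEis.jacobiThetaTerm Q m β τ z g)) ∧
    (∀ (τ : ℍ) (z : ℂ), Summable (JacobiEis.jacobiEisensteinTerm Q (k - 1) m β τ z)) ∧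
    -- `R_{k,m,β}` is the first development coefficient of `E_{k-1,m,β}`
    (∀ τ : ℍ, DifferentiableAt ℂ (JacobiEis.jacobiEisenstein Q (k - 1) m β τ) 0 ∧
      JacobiEis.formR Q k m β τ = (1 / (4 * Real.pi * Complex.I * m) : ℂ) •
        deriv (JacobiEis.jacobiEisenstein Q (k - 1) m β τ) 0) ∧
    -- `E_{k-1,m,β}` has a Fourier expansion, and it determines that of `R_{k,m,β}`
    (∃ c : ℚ → ℚ → A → ℂ,
      JacobiEis.HasJacobiExpansion Q β (JacobiEis.jacobiEisenstein Q (k - 1) m β) c) ∧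
    (∀ c : ℚ → ℚ → A → ℂ,
      JacobiEis.HasJacobiExpansion Q β (JacobiEis.jacobiEisenstein Q (k - 1) m β) c →
      (∀ (γ : A) (n : JacobiEis.negCoset (Q γ)) (r : JacobiEis.negCoset (JacobiEis.bil Q γ β)),
        4 * m * n.1 < r.1 ^ 2 → c n r γ = 0) ∧
      (∀ (τ : ℍ) (γ : A),
        HasSum (fun x : JacobiEis.negCoset (Q γ) × JacobiEis.negCoset (JacobiEis.bil Q γ β) =>
          (1 / (2 * m) : ℂ) * (c x.1 x.2 γ * JacobiEis.ee ((x.1 : ℚ) * τ) *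
            (1 / (2 * Real.pi * Complex.I) *
              deriv (fun z : ℂ => JacobiEis.ee ((x.2 : ℚ) * z)) 0)))
          (JacobiEis.formR Q k m β τ γ)) ∧
      JacobiEis.HasFourierExpansion Q (JacobiEis.formR Q k m β) (fun n γ =>
        (1 / (2 * m) : ℂ) *
          ∑ᶠ r ∈ {r : ℚ | (r : AddCircle (1 : ℚ)) = -JacobiEis.bil Q γ β ∧ r ^ 2 ≤ 4 * m * n},
            (r : ℂ) * c n r γ)) := by
  have hk' : 5 / 2 < k - 1 := by linarith
  have hsig := hanti.sig_int
  refine ⟨fun l τ => JacobiEis.summable_poincareTerm hQ hsig (by linarith)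
      (fun τ => JacobiEis.norm_expSeed_le hanti (by positivity) (l • β) τ) τ,
    fun τ => (JacobiEis.hasSum_smul_expPoincare hQ hk hanti hm β τ).summable,
    fun τ z g => (JacobiEis.hasSum_jacobiThetaTerm Q hm β τ z g).summable,
    fun τ z => JacobiEis.summable_jacobiEisensteinTerm hQ hsig hk' hm β τ z,
    fun τ => ⟨JacobiEis.differentiableAt_jacobiEisenstein hQ hsig hk' hm β τ 0,
      JacobiEis.formR_eq_deriv hQ hk hanti hm β τ⟩,
    JacobiEis.exists_hasJacobiExpansion hQ hsig hk' hm hmβ,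
    fun c hc => ⟨fun γ n r h => JacobiEis.coeff_eq_zero hQ hsig hk' hm hmβ hc γ n r h,
      fun τ γ => JacobiEis.hasSum_formR hQ hk hanti hm hc τ γ,
      JacobiEis.hasFourierExpansion_formR hQ hk hanti hm hmβ hc⟩⟩
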